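/- **Notation.** A *partition* of $[0,\infty)$ is a sequence $\pi=(t_k)_{k\in\mathbb N}$ in $[0,\infty]$ with $t_0=0$, $t_k<t_{k+1}$ whenever $t_{k+1}<\infty$, and $t_k\to\infty$. For a continuous $x:[0,\infty)\to\mathbb R$ put $x_\infty:=0$ and $$O_t(x,\pi):=\sup\{|x_b-x_a| : a,b\in[t_k,t_{k+1})\cap[0,t]\text{ for some }k\}.$$ Given a sequence of partitions $\Pi=(\pi_n)_n$ with $O_T(x,\pi_n)\to0$ for all $T<\infty$, write $x\in\mathcal Q^\Pi$ if the measures $\mu_n:=\sum_{t_j\in\pi_n,\,t_{j+1}<\infty}(x_{t_{j+1}}-x_{t_j})^2\delta_{t_j}$ on $[0,\infty)$ converge vaguely (that is, when tested against continuous functions with compact support) to a locally finite measure $\mu$ without atoms; then $\langle x\rangle_t:=\mu([0,t])$, and $\int_0^t k_s\,d\langle x\rangle_s:=\int_{[0,t]}k\,d\mu$. The *discrete local time* along $\pi=(t_j)_j$ is $$L^{\pi}_t(u):=2\sum_{t_j\in\pi}\mathbf 1_{J_j(t)}(u)\,|x_{t_{j+1}\wedge t}-u|,\qquad u\in\mathbb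 R,$$ where $J_j(t)=[a,b)$ if $a\le b$ and $J_j(t)=[b,a)$ if $a>b$, with $a=x_{t_j\wedge t}$, $b=x_{t_{j+1}\wedge t}$. Here $L^p=L^p(\mathbb R,du)$; $W^{1,q}$ is the set of (locally) absolutely continuous $g:\mathbb R\to\mathbb R$ whose a.e. derivative $g'$ belongs to $L^q$ (with no integrability required of $g$), and $W^{2,q}$ is the set of $C^1$ functions $f$ with $f'\in W^{1,q}$. A sequence $(F_n)_n$ in $L^1$ is *equi-integrable* if for every $\varepsilon>0$ there are $\delta>0$ and a set $S$ of finite Lebesgue measure such that, for all $n$, $\int_A|F_n|\,du\le\varepsilon$ for every Borel $A$ of Lebesgue measure at most $\delta$, and $\int_{\mathbb R\setminus S}|F_n|\,du\le\varepsilon$. **Theorem 3.1.** Let $x:[0,\infty)\to\mathbb R$ be continuous and let $\Pi=(\pi_n)_n$ be a sequence of partitions of $[0,\infty)$ such that $O_t(x,\pi_n)\to0$ as $n\to\infty$ for all $t\in[0,\infty)$. Let $1<p<\infty$ and $q=p/(p-1)$. The following are equivalent: 1. For every $g\in W^{1,q}$ and $t\in[0,\infty)$ the sums $\sum_{t_j\in\pi_n}g(x_{t_j})(x_{t_{j+1}\wedge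 t}-x_{t_j\wedge t})$ converge, and their limit, denoted $\int_0^tg(x_s)\,dx_s$, is a continuous function of $t$. 2. For every $g\in W^{1,q}$ the functions $t\mapsto\sum_{t_j\in\pi_n}g(x_{t_j})(x_{t_{j+1}\wedge t}-x_{t_j\wedge t})$ converge uniformly on compact subsets of $[0,\infty)$. 3. There is a family $(L_t)_{t\ge0}$ in $L^p$ such that $L^{\pi_n}_t\to L_t$ weakly in $L^p$ for all $t\in[0,\infty)$, and $t\mapsto L_t\in L^p$ is continuous for the weak topology of $L^p$. 4. There is a family $(L_t)_{t\ge0}$ in $L^p$ such that, for every $h\in L^q$, $\int_{\mathbb R}L^{\pi_n}_t(u)h(u)\,du\to\int_{\mathbb R}L_t(u)h(u)\,du$ uniformly for $t$ in compact subsets of $[0,\infty)$. 5. $x\in\mathcal Q^\Pi$, and for every $M\in[0,\infty)$ there is $t\ge M$ such that $(L^{\pi_n}_t)_n$ is bounded in $L^p$. If these conditions are satisfied, and $(L_t)_{t\ge 0}$ is as in 3 or 4, then $(L^{\pi_n}_t)_n$ is bounded in $L^p$ for all $t\in[0,\infty)$; for all $f\in W^{2,q}$ and $t\in[0,\infty)$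 $$f(x_t)-f(x_0)=\int_0^tf'(x_s)\,dx_s+\frac12\int_{\mathbb R}L_t(u)f''(u)\,du;$$ and for all bounded Borel $h:\mathbb R\to\mathbb R$ and $t\in[0,\infty)$ $$\int_0^th(x_s)\,d\langle x\rangle_s=\int_{\mathbb R}L_t(u)h(u)\,du .$$ All of this also holds for $p=\infty$, $q=1$ if the weak topology of $L^p$ is replaced by the weak$^*$ topology of $L^\infty$ (as the dual of $L^1$), and for $p=1$, $q=\infty$ if in item 5 boundedness in $L^p$ is replaced by equi-integrability. -/

import Mathlib

open MeasureTheory Filter Topology Set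
open scoped ENNReal NNReal

noncomputable section

namespace PathwiseLocalTime

/-- A partition `(t_k)` of `[0,∞)`: the times may take the value `∞`, they start at `0`, increase
strictly as long as they are finite, and tend to `∞`. -/
structure TimePartition where
  t : ℕ → ℝ≥0∞
  t_zero : t 0 = 0
  t_lt_succ : ∀ k, t (k + 1) < ∞ → t k < t (k + 1)
  tendsto_t : Tendsto t atTop (𝓝 ∞)

/-- The value `x_s` for `s ∈ [0,∞]`, with the convention `x_∞ = 0`. -/
def valueAt (x : ℝ≥0 → ℝ) (s : ℝ≥0∞) : ℝ := if s = ∞ then 0 else x s.toNNReal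

/-- The finite time `s ∧ t` for `s ∈ [0,∞]` and `t ∈ [0,∞)`. -/
def capAt (s : ℝ≥0∞) (t : ℝ≥0) : ℝ≥0 := (min s (t : ℝ≥0∞)).toNNReal

/-- The oscillation `O_t(x,P)`: the supremum of `|x b - x a|` over pairs of times `a, b ≤ t` that lie
in one and the same interval `[t_k, t_{k+1})`. -/
def osc (x : ℝ≥0 → ℝ) (P : TimePartition) (t : ℝ≥0) : ℝ :=
  sSup {r : ℝ | ∃ (k : ℕ) (a b : ℝ≥0), a ≤ t ∧ b ≤ t ∧
    P.t k ≤ (a : ℝ≥0∞) ∧ (a : ℝ≥0∞) < P.t (k + 1) ∧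
    P.t k ≤ (b : ℝ≥0∞) ∧ (b : ℝ≥0∞) < P.t (k + 1) ∧ r = |x b - x a|}

/-- The measure `∑_j (x_{t_{j+1}} - x_{t_j})² δ_{t_j}` on `[0,∞)`, the sum being over those `j` with
`t_{j+1} < ∞`. -/
def squareMeasure (x : ℝ≥0 → ℝ) (P : TimePartition) : Measure ℝ≥0 :=
  Measure.sum fun j : ℕ =>
    if P.t (j + 1) = ∞ then 0
    else ENNReal.ofReal ((valueAt x (P.t (j + 1)) - valueAt x (P.t j)) ^ 2) •
      Measure.dirac (P.t j).toNNReal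

/-- `μ` is the quadratic variation measure of `x` along the partitions `P n`: it is an atomless
measure, finite on compacts, and the vague limit of the measures `squareMeasure x (P n)`. The
quadratic variation `⟨x⟩` is `t ↦ μ [0,t]`, so that `∫_0^t k_s d⟨x⟩_s` is the integral of `k` over
`[0,t]` with respect to `μ`. -/
def IsQuadraticVariation (x : ℝ≥0 → ℝ) (P : ℕ → TimePartition) (μ : Measure ℝ≥0) : Prop :=
  IsLocallyFiniteMeasure μ ∧ (∀ s : ℝ≥0, μ {s} = 0) ∧
    ∀ φ : ℝ≥0 → ℝ, Continuous φ → HasCompactSupport φ →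
      Tendsto (fun n => ∫ s, φ s ∂(squareMeasure x (P n))) atTop (𝓝 (∫ s, φ s ∂μ))

/-- `x ∈ 𝒬`: the oscillations along `P n` vanish, and `x` has quadratic variation along `P n`. -/
def HasQuadraticVariation (x : ℝ≥0 → ℝ) (P : ℕ → TimePartition) : Prop :=
  (∀ T : ℝ≥0, Tendsto (fun n => osc x (P n) T) atTop (𝓝 0)) ∧
    ∃ μ : Measure ℝ≥0, IsQuadraticVariation x P μ

/-- The Riemann sum `∑_j g(x_{t_j}) (x_{t_{j+1} ∧ t} - x_{t_j ∧ t})` (only finitely many terms are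
nonzero). -/
def riemannSum (x : ℝ≥0 → ℝ) (P : TimePartition) (g : ℝ → ℝ) (t : ℝ≥0) : ℝ :=
  ∑' j : ℕ, g (valueAt x (P.t j)) * (x (capAt (P.t (j + 1)) t) - x (capAt (P.t j) t))

/-- The continuous function `I` is the pointwise limit of the Riemann sums, that is
`I t = ∫_0^t g(x_s) dx_s`. -/
def IsFollmerIntegral (x : ℝ≥0 → ℝ) (P : ℕ → TimePartition) (g : ℝ → ℝ) (I : ℝ≥0 → ℝ) : Prop :=
  Continuous I ∧ ∀ t : ℝ≥0, Tendsto (fun n => riemannSum x (P n) g t) atTop (𝓝 (I t))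

/-- The interval `⟦a, b⦆`, which is `[a, b)` if `a ≤ b` and `[b, a)` otherwise. -/
def halfOpen (a b : ℝ) : Set ℝ := if a ≤ b then Ico a b else Ico b a

/-- The discrete local time
`L_t(u) = 2 ∑_j 1_{⟦x_{t_j ∧ t}, x_{t_{j+1} ∧ t}⦆}(u) |x_{t_{j+1} ∧ t} - u|`
(only finitely many terms are nonzero). -/
def discreteLocalTime (x : ℝ≥0 → ℝ) (P : TimePartition) (t : ℝ≥0) (u : ℝ) : ℝ :=
  2 * ∑' j : ℕ, (halfOpen (x (capAt (P.t j) t)) (x (capAt (P.t (j + 1)) t))).indicator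
    (fun v => |x (capAt (P.t (j + 1)) t) - v|) u

theorem capAt_of_le {s : ℝ≥0∞} {t : ℝ≥0} (h : (t : ℝ≥0∞) ≤ s) : capAt s t = t := by
  simp [capAt, min_eq_right h]

theorem halfOpen_self (a : ℝ) : halfOpen a a = ∅ := by simp [halfOpen]

theorem memLp_halfOpen (a b : ℝ) (p : ℝ≥0∞) :
    MemLp ((halfOpen a b).indicator (fun v => |b - v|)) p (volume : Measure ℝ) := by
  have key : ∀ c d : ℝ, MemLp ((Ico c d).indicator (fun v => |b - v|)) p
      (volume : Measure ℝ) := by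
    intro c d
    rw [memLp_indicator_iff_restrict measurableSet_Ico]
    refine MemLp.of_bound (C := |b| + |c| + |d|) (by fun_prop) ?_
    refine (ae_restrict_mem measurableSet_Ico).mono fun v hv => ?_
    rw [Real.norm_eq_abs, abs_abs]
    have h1 := neg_abs_le c
    have h2 := le_abs_self d
    have h3 := neg_abs_le b
    have h4 := le_abs_self b
    have h5 := abs_nonneg c
    have h6 := abs_nonneg d
    have h7 := hv.1
    have h8 := hv.2
    rw [abs_le]
    constructor <;> linarith
  unfold halfOpen
  split_ifs <;> exact key _ _

theorem memLp_discreteLocalTime (x : ℝ≥0 → ℝ) (P : TimePartition) (t : ℝ≥0) (p : ℝ≥0∞) :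
    MemLp (discreteLocalTime x P t) p (volume : Measure ℝ) := by
  obtain ⟨N, hN⟩ := eventually_atTop.1
    (P.tendsto_t.eventually (lt_mem_nhds (ENNReal.coe_lt_top (r := t))))
  have h : discreteLocalTime x P t = fun u => 2 * ∑ j ∈ Finset.range N,
      (halfOpen (x (capAt (P.t j) t)) (x (capAt (P.t (j + 1)) t))).indicator
        (fun v => |x (capAt (P.t (j + 1)) t) - v|) u := by
    funext u
    unfold discreteLocalTime
    rw [tsum_eq_sum (s := Finset.range N)]
    intro j hj
    have hj' : N ≤ j := by simpa using hj
    rw [capAt_of_le (hN j hj').le, capAt_of_le (hN (j + 1) (by omega)).le, halfOpen_self]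
    simp
  rw [h]
  exact (memLp_finsetSum (Finset.range N) fun j _ => memLp_halfOpen _ _ p).const_mul 2

/-- The discrete local time as an element of `L^p(ℝ, du)`. -/
def localTimeLp (x : ℝ≥0 → ℝ) (P : TimePartition) (p : ℝ≥0∞) (t : ℝ≥0) :
    Lp ℝ p (volume : Measure ℝ) :=
  (memLp_discreteLocalTime x P t p).toLp

/-- `W^{1,q}`: the (locally) absolutely continuous functions whose derivative, which exists almost
everywhere, belongs to `L^q`; the function itself need not belong to `L^q`. -/
def MemW1 (q : ℝ≥0∞) (g : ℝ → ℝ) : Prop :=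
  (∀ a b : ℝ, AbsolutelyContinuousOnInterval g a b) ∧ MemLp (deriv g) q (volume : Measure ℝ)

/-- `W^{2,q}`: the `C¹` functions whose derivative belongs to `W^{1,q}`. -/
def MemW2 (q : ℝ≥0∞) (f : ℝ → ℝ) : Prop := ContDiff ℝ 1 f ∧ MemW1 q (deriv f)

/-- The weak topology of `L^p(ℝ, du)` if `p < ∞`, and the weak* topology (given by the pairing with
`L¹(ℝ, du)`) if `p = ∞`. -/
abbrev lpTopology (p : ℝ≥0∞) [Fact (1 ≤ p)] : TopologicalSpace (Lp ℝ p (volume : Measure ℝ)) :=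
  if p = ∞ then
    ⨅ h : Lp ℝ 1 (volume : Measure ℝ), TopologicalSpace.induced
      (fun f : Lp ℝ p (volume : Measure ℝ) => ∫ u, f u * h u) inferInstance
  else
    TopologicalSpace.induced (toWeakSpace ℝ (Lp ℝ p (volume : Measure ℝ))) inferInstance

/-- For every `t` the discrete local times converge to `L t` in the weak (for `p = ∞`: weak*)
topology of `L^p`, and `t ↦ L t` is continuous for this topology. -/
def IsLocalTime (x : ℝ≥0 → ℝ) (P : ℕ → TimePartition) (p : ℝ≥0∞) [Fact (1 ≤ p)]
    (L : ℝ≥0 → Lp ℝ p (volume : Measure ℝ)) : Prop :=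
  (∀ t : ℝ≥0, Tendsto (fun n => localTimeLp x (P n) p t) atTop (@nhds _ (lpTopology p) (L t))) ∧
    @Continuous _ _ _ (lpTopology p) L

/-- For every `h ∈ L^q` the integrals of the discrete local times against `h` converge to those
of `L`, uniformly on compacts in time. -/
def IsUniformLocalTime (x : ℝ≥0 → ℝ) (P : ℕ → TimePartition) (p q : ℝ≥0∞)
    (L : ℝ≥0 → Lp ℝ p (volume : Measure ℝ)) : Prop :=
  ∀ h : ℝ → ℝ, MemLp h q (volume : Measure ℝ) → ∀ K : Set ℝ≥0, IsCompact K →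
    TendstoUniformlyOn (fun (n : ℕ) (t : ℝ≥0) => ∫ u, discreteLocalTime x (P n) t u * h u)
      (fun t => ∫ u, L t u * h u) atTop K

/-- The sequence `F` is bounded in `L^p(ℝ, du)`. -/
def BoundedInLp (p : ℝ≥0∞) (F : ℕ → ℝ → ℝ) : Prop :=
  ∃ C : ℝ≥0, ∀ n, eLpNorm (F n) p (volume : Measure ℝ) ≤ C

/-- The sequence `F` is equi-integrable in `L¹(ℝ, du)`: the integrals of `|F n|` are uniformly small
over sets of small measure, and over the complement of some set of finite measure. -/
def EquiIntegrable (F : ℕ → ℝ → ℝ) : Prop :=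
  UnifIntegrable F 1 (volume : Measure ℝ) ∧ UnifTight F 1 (volume : Measure ℝ)

end PathwiseLocalTime

end

/-! Taylor's formula with integral remainder, applied to a primitive of g on each partition interval
and summed, is a discrete Itô formula (`riemannSum_eq_sub`): the Riemann sum of g up to t is
∫_{x_0}^{x_t} g minus half of ∫ L^π_t g'. Every h in L^q is a.e. the derivative of some g in
W^{1,q}, so item 1 says exactly that ∫ L^{π_n}_t h converges, for each h in L^q, to a continuous
function of t. This property, `ConvergesWeakly`, is the hub of the proof.

Uniformity in time comes for free. L^π_t increases in t up to an error of the size of the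
oscillation (`discreteLocalTime_le_add`), and almost monotone functions converging pointwise to a
continuous limit converge locally uniformly (`tendstoLocallyUniformly_of_almost_monotone`); a
general h is split into positive and negative parts. Conversely, locally uniform limits of
continuous functions are continuous.

The limit L_t is produced by `exists_weak_limit`. For q < ∞ it represents a limit functional on L^q
(Banach–Steinhaus and Riesz); for q = ∞ it is the density of a limit set function (Vitali–Hahn–Saks
and Radon–Nikodym). Up to a fixed time all functions involved vanish outside one interval [-R,R], so
Riesz representation over a set of finite measure suffices to pass between integrals against L^q and
the weak or weak* topology.

Quadratic variation enters because L^π_t du is close to the image under x of the measure of squared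
increments on [0,t], with total mass the sum of squares. Weak convergence therefore makes the
distribution functions of these measures converge to a continuous increasing function, which gives
the measure in item 5 (`ConvergesWeakly.exists_isQuadraticVariation`). Conversely, vague convergence
gives the limit of ∫ L^{π_n}_t φ for continuous φ. A bound (or equi-integrability) at one large time
T controls all t ≤ T by almost monotonicity, so h in L^q may be replaced by a continuous φ uniformly
in n and t (`convergesWeakly_of_isQuadraticVariation`). The occupation formula holds because two
finite measures that agree on bounded continuous functions are equal. -/

noncomputable section

namespace PathwiseLocalTime

/-! ### Partitions -/

/-- The function `1_{⟦a, b⦆}(u) |b - u|`, of which discrete local times are sums. -/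
def tent (a b u : ℝ) : ℝ := (halfOpen a b).indicator (fun v => |b - v|) u

theorem measurableSet_halfOpen (a b : ℝ) : MeasurableSet (halfOpen a b) := by
  unfold halfOpen
  split_ifs <;> exact measurableSet_Ico

theorem tent_nonneg (a b u : ℝ) : 0 ≤ tent a b u :=
  indicator_nonneg (fun _ _ => abs_nonneg _) u

theorem tent_self (a u : ℝ) : tent a a u = 0 := by simp [tent, halfOpen_self]

theorem measurable_tent (a b : ℝ) : Measurable (tent a b) :=
  Measurable.indicator (by fun_prop) (measurableSet_halfOpen a b)

theorem tent_le {a b R : ℝ} (ha : |a| ≤ R) (hb : |b| ≤ R) (u : ℝ) :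
    tent a b u ≤ |b - a| * (Icc (-R) R).indicator 1 u := by
  rw [abs_le] at ha hb
  unfold tent
  by_cases hu : u ∈ halfOpen a b
  · rw [indicator_of_mem hu]
    unfold halfOpen at hu
    split_ifs at hu with h
    · rw [indicator_of_mem (show u ∈ Icc (-R) R from ⟨by linarith [hu.1], by linarith [hu.2]⟩)]
      rw [abs_of_nonneg (by linarith [hu.2]), abs_of_nonneg (by linarith)]
      simp only [Pi.one_apply]
      linarith [hu.1]
    · rw [indicator_of_mem (show u ∈ Icc (-R) R from ⟨by linarith [hu.1], by linarith [hu.2]⟩)]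
      rw [abs_of_nonpos (by linarith [hu.1]), abs_of_nonpos (by linarith)]
      simp only [Pi.one_apply]
      linarith [hu.2]
  · rw [indicator_of_notMem hu]
    exact mul_nonneg (abs_nonneg _) (indicator_nonneg (fun _ _ => zero_le_one) u)

theorem tent_ne_zero {a b u : ℝ} (h : tent a b u ≠ 0) : |u - a| ≤ |b - a| := by
  have hu : u ∈ halfOpen a b := by
    by_contra hu
    exact h (indicator_of_notMem hu _)
  unfold halfOpen at hu
  split_ifs at hu with h
  · rw [abs_of_nonneg (by linarith [hu.1]), abs_of_nonneg (by linarith)]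
    linarith [hu.2]
  · rw [abs_of_nonpos (by linarith [hu.2]), abs_of_nonpos (by linarith)]
    linarith [hu.1]

theorem integral_tent_mul (a b : ℝ) (h : ℝ → ℝ) :
    ∫ u, tent a b u * h u = ∫ u in a..b, (b - u) * h u := by
  have h1 : (fun u => tent a b u * h u) = (halfOpen a b).indicator (fun u => |b - u| * h u) := by
    ext u
    unfold tent
    by_cases hu : u ∈ halfOpen a b <;> simp [hu]
  rw [h1, integral_indicator (measurableSet_halfOpen a b)]
  unfold halfOpen
  split_ifs with hab
  · rw [intervalIntegral.integral_of_le hab, ← integral_Ico_eq_integral_Ioc]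
    refine setIntegral_congr_fun measurableSet_Ico fun u hu => ?_
    rw [abs_of_nonneg (by linarith [hu.2])]
  · rw [intervalIntegral.integral_of_ge (not_le.1 hab).le, ← integral_Ico_eq_integral_Ioc,
      ← integral_neg]
    refine setIntegral_congr_fun measurableSet_Ico fun u hu => ?_
    rw [abs_of_nonpos (by linarith [hu.1])]
    ring

theorem integral_tent (a b : ℝ) : ∫ u, tent a b u = (b - a) ^ 2 / 2 := by
  have h := integral_tent_mul a b (fun _ => 1)
  simp only [mul_one] at h
  rw [h, intervalIntegral.integral_sub (by simp) (by simp)]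
  simp
  ring

namespace TimePartition

theorem mono (P : TimePartition) : Monotone P.t := by
  refine monotone_nat_of_le_succ fun k => ?_
  rcases eq_or_ne (P.t (k + 1)) ∞ with h | h
  · rw [h]
    exact le_top
  · exact (P.t_lt_succ k h.lt_top).le

theorem exists_index (P : TimePartition) (t : ℝ≥0) : ∃ k, P.t k ≤ t ∧ (t : ℝ≥0∞) < P.t (k + 1) := by
  have h : ∃ N, (t : ℝ≥0∞) < P.t (N + 1) := by
    obtain ⟨N, hN⟩ := eventually_atTop.1
      (P.tendsto_t.eventually (lt_mem_nhds (ENNReal.coe_lt_top (r := t))))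
    exact ⟨N, hN _ (by omega)⟩
  classical
  refine ⟨Nat.find h, ?_, Nat.find_spec h⟩
  rcases Nat.eq_zero_or_pos (Nat.find h) with h0 | h0
  · rw [h0, P.t_zero]
    exact zero_le
  · have := Nat.find_min h (m := Nat.find h - 1) (by omega)
    rw [not_lt] at this
    rwa [Nat.sub_add_cancel h0] at this

/-- The index `k` with `t_k ≤ t < t_{k+1}`. -/
def index (P : TimePartition) (t : ℝ≥0) : ℕ := (P.exists_index t).choose

theorem t_index_le (P : TimePartition) (t : ℝ≥0) : P.t (P.index t) ≤ t :=
  (P.exists_index t).choose_spec.1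

theorem lt_t_index (P : TimePartition) (t : ℝ≥0) : (t : ℝ≥0∞) < P.t (P.index t + 1) :=
  (P.exists_index t).choose_spec.2

theorem t_le_of_le_index (P : TimePartition) {t : ℝ≥0} {j : ℕ} (h : j ≤ P.index t) : P.t j ≤ t :=
  (P.mono h).trans (P.t_index_le t)

theorem lt_t_of_index_lt (P : TimePartition) {t : ℝ≥0} {j : ℕ} (h : P.index t < j) :
    (t : ℝ≥0∞) < P.t j :=
  (P.lt_t_index t).trans_le (P.mono h)

theorem t_le_iff (P : TimePartition) {t : ℝ≥0} {j : ℕ} : P.t j ≤ t ↔ j ≤ P.index t := by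
  refine ⟨fun h => ?_, P.t_le_of_le_index⟩
  by_contra hj
  exact absurd h (not_le.2 (P.lt_t_of_index_lt (not_le.1 hj)))

theorem index_mono (P : TimePartition) : Monotone P.index := fun s t h =>
  P.t_le_iff.1 ((P.t_index_le s).trans (by exact_mod_cast h))

/-- The finite partition time `t_j` as an element of `[0,∞)`. -/
def node (P : TimePartition) (j : ℕ) : ℝ≥0 := (P.t j).toNNReal

theorem t_ne_top (P : TimePartition) {t : ℝ≥0} {j : ℕ} (h : P.t j ≤ t) : P.t j ≠ ∞ :=
  (h.trans_lt ENNReal.coe_lt_top).ne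

theorem coe_node (P : TimePartition) {j : ℕ} (h : P.t j ≠ ∞) : (P.node j : ℝ≥0∞) = P.t j :=
  ENNReal.coe_toNNReal h

theorem node_le (P : TimePartition) {t : ℝ≥0} {j : ℕ} (h : P.t j ≤ t) : P.node j ≤ t := by
  have := P.coe_node (P.t_ne_top h)
  rw [← this] at h
  exact_mod_cast h

end TimePartition

theorem valueAt_eq (x : ℝ≥0 → ℝ) (P : TimePartition) {j : ℕ} (h : P.t j ≠ ∞) :
    valueAt x (P.t j) = x (P.node j) := by
  rw [valueAt, if_neg h]
  rfl

theorem capAt_eq_node (P : TimePartition) {t : ℝ≥0} {j : ℕ} (h : P.t j ≤ t) :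
    capAt (P.t j) t = P.node j := by
  simp [capAt, min_eq_left h, TimePartition.node]

/-- A sum over the intervals of a partition of terms which vanish on degenerate intervals. -/
theorem tsum_capAt (P : TimePartition) (t : ℝ≥0) (Φ : ℕ → ℝ≥0 → ℝ≥0 → ℝ)
    (hΦ : ∀ j, Φ j t t = 0) :
    ∑' j, Φ j (capAt (P.t j) t) (capAt (P.t (j + 1)) t) =
      ∑ j ∈ Finset.range (P.index t), Φ j (P.node j) (P.node (j + 1)) +
        Φ (P.index t) (P.node (P.index t)) t := by
  rw [tsum_eq_sum (s := Finset.range (P.index t + 1)), Finset.sum_range_succ]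
  · rw [capAt_eq_node P (P.t_index_le t), capAt_of_le (P.lt_t_index t).le]
    congr 1
    refine Finset.sum_congr rfl fun j hj => ?_
    have hj' := Finset.mem_range.1 hj
    rw [capAt_eq_node P (P.t_le_of_le_index hj'.le),
      capAt_eq_node P (P.t_le_of_le_index (show j + 1 ≤ _ by omega))]
  · intro j hj
    have hj' : P.index t < j := by simpa [Nat.lt_succ_iff] using hj
    rw [capAt_of_le (P.lt_t_of_index_lt hj').le,
      capAt_of_le (P.lt_t_of_index_lt (show P.index t < j + 1 by omega)).le, hΦ]

theorem discreteLocalTime_eq (x : ℝ≥0 → ℝ) (P : TimePartition) (t : ℝ≥0) (u : ℝ) :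
    discreteLocalTime x P t u =
      2 * (∑ j ∈ Finset.range (P.index t), tent (x (P.node j)) (x (P.node (j + 1))) u +
        tent (x (P.node (P.index t))) (x t) u) := by
  rw [← tsum_capAt P t (fun _ a b => tent (x a) (x b) u) (fun _ => tent_self _ _)]
  rfl

theorem riemannSum_eq (x : ℝ≥0 → ℝ) (P : TimePartition) (g : ℝ → ℝ) (t : ℝ≥0) :
    riemannSum x P g t =
      ∑ j ∈ Finset.range (P.index t),
        g (x (P.node j)) * (x (P.node (j + 1)) - x (P.node j)) +
        g (x (P.node (P.index t))) * (x t - x (P.node (P.index t))) := by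
  have h := tsum_capAt P t (fun j a b => g (valueAt x (P.t j)) * (x b - x a)) (fun _ => by simp)
  rw [riemannSum, h]
  rw [valueAt_eq x P (P.t_ne_top (P.t_index_le t))]
  congr 1
  refine Finset.sum_congr rfl fun j hj => ?_
  rw [valueAt_eq x P (P.t_ne_top (P.t_le_of_le_index (Finset.mem_range.1 hj).le))]

theorem telescope_index (x : ℝ≥0 → ℝ) (P : TimePartition) (G : ℝ → ℝ) (t : ℝ≥0) :
    ∑ j ∈ Finset.range (P.index t), (G (x (P.node (j + 1))) - G (x (P.node j))) +
      (G (x t) - G (x (P.node (P.index t)))) = G (x t) - G (x 0) := by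
  rw [Finset.sum_range_sub (fun j => G (x (P.node j)))]
  simp [TimePartition.node, P.t_zero]

/-! ### Bounds and oscillations -/

theorem exists_bound (x : ℝ≥0 → ℝ) (hx : Continuous x) (T : ℝ≥0) :
    ∃ R : ℝ, 0 ≤ R ∧ ∀ s ≤ T, |x s| ≤ R := by
  obtain ⟨C, hC⟩ := (isCompact_Icc (a := (0 : ℝ≥0)) (b := T)).exists_bound_of_continuousOn
    hx.continuousOn
  exact ⟨max C 0, le_max_right _ _, fun s hs => (hC s ⟨zero_le, hs⟩).trans (le_max_left _ _)⟩

theorem le_osc {x : ℝ≥0 → ℝ} (hx : Continuous x) (P : TimePartition) {T a b : ℝ≥0} {k : ℕ}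
    (ha : a ≤ T) (hb : b ≤ T) (hka : P.t k ≤ a) (hak : (a : ℝ≥0∞) < P.t (k + 1))
    (hkb : P.t k ≤ b) (hbk : (b : ℝ≥0∞) < P.t (k + 1)) : |x b - x a| ≤ osc x P T := by
  obtain ⟨R, hR0, hR⟩ := exists_bound x hx T
  refine le_csSup ⟨R + R, ?_⟩ ⟨k, a, b, ha, hb, hka, hak, hkb, hbk, rfl⟩
  rintro r ⟨k, a, b, ha, hb, -, -, -, -, rfl⟩
  exact (abs_sub _ _).trans (add_le_add (hR b hb) (hR a ha))

theorem osc_nonneg {x : ℝ≥0 → ℝ} (hx : Continuous x) (P : TimePartition) (T : ℝ≥0) :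
    0 ≤ osc x P T :=
  (abs_nonneg _).trans (le_osc hx P le_rfl le_rfl (P.t_index_le T) (P.lt_t_index T)
    (P.t_index_le T) (P.lt_t_index T))

theorem abs_sub_node_index_le {x : ℝ≥0 → ℝ} (hx : Continuous x) (P : TimePartition) {T s : ℝ≥0}
    (hs : s ≤ T) : |x s - x (P.node (P.index s))| ≤ osc x P T := by
  have h := P.coe_node (P.t_ne_top (P.t_index_le s))
  refine le_osc hx P ((P.node_le (P.t_index_le s)).trans hs) hs h.ge ?_ (P.t_index_le s)
    (P.lt_t_index s)
  rw [h]
  exact (P.t_index_le s).trans_lt (P.lt_t_index s)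

/-- The oscillation only sees the half-open interval; its right endpoint is reached by continuity of
the path. -/
theorem abs_sub_node_succ_le {x : ℝ≥0 → ℝ} (hx : Continuous x) (P : TimePartition) {T : ℝ≥0}
    {k : ℕ} (hk : P.t (k + 1) ≤ T) : |x (P.node (k + 1)) - x (P.node k)| ≤ osc x P T := by
  have htop := P.t_ne_top hk
  have hlt : P.t k < P.t (k + 1) := P.t_lt_succ k htop.lt_top
  have hk' : P.node k < P.node (k + 1) := by
    have := hlt
    rw [← P.coe_node htop, ← P.coe_node (hlt.trans htop.lt_top).ne] at this
    exact_mod_cast this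
  have hcl : P.node (k + 1) ∈ closure (Ico (P.node k) (P.node (k + 1))) := by
    rw [closure_Ico hk'.ne]
    exact ⟨hk'.le, le_rfl⟩
  have hclosed : IsClosed {s : ℝ≥0 | |x s - x (P.node k)| ≤ osc x P T} :=
    isClosed_le (by fun_prop) continuous_const
  refine closure_minimal (fun s hs => ?_) hclosed hcl
  have hkn := P.coe_node (hlt.trans htop.lt_top).ne
  refine le_osc hx P (k := k) ((hk'.le.trans (P.node_le hk))) (hs.2.le.trans (P.node_le hk))
    hkn.ge (hkn.trans_lt hlt) ?_ ?_
  · rw [← hkn]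
    exact_mod_cast hs.1
  · rw [← P.coe_node htop]
    exact_mod_cast hs.2

/-- If the oscillations vanish, then so do the increments over the intervals that start before a
given time, whether or not they end before that time. -/
theorem eventually_abs_sub_node_succ_le {x : ℝ≥0 → ℝ} (hx : Continuous x) {P : ℕ → TimePartition}
    (hP : ∀ t : ℝ≥0, Tendsto (fun n => osc x (P n) t) atTop (𝓝 0)) (T : ℝ≥0) {ε : ℝ} (hε : 0 < ε) :
    ∀ᶠ n in atTop, ∀ k, (P n).t k ≤ T → (P n).t (k + 1) ≠ ∞ →
      |x ((P n).node (k + 1)) - x ((P n).node k)| ≤ ε := by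
  -- An interval starting before T may end far beyond T, where no oscillation bound is available
  -- yet. If x is constant after T, its increment is already seen at time T.
  by_cases hconst : ∀ s, T ≤ s → x s = x T
  · filter_upwards [(hP T).eventually (gt_mem_nhds hε)] with n hn k hk htop
    rcases le_or_gt ((P n).t (k + 1)) T with h | h
    · exact (abs_sub_node_succ_le hx (P n) h).trans hn.le
    · have h1 : T ≤ (P n).node (k + 1) := by
        rw [← (P n).coe_node htop] at h
        exact_mod_cast h.le
      have hkn := (P n).coe_node ((P n).t_ne_top hk)
      rw [hconst _ h1]
      refine (le_osc hx (P n) (k := k) ((P n).node_le hk) le_rfl hkn.ge ?_ hk h).trans hn.le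
      rw [hkn]
      exact hk.trans_lt h
  · push Not at hconst
    obtain ⟨S, hTS, hS⟩ := hconst
    -- Otherwise x moves after T: an interval containing both T and S would have oscillation at
    -- least |x_S - x_T|, so eventually every interval starting before T ends by time S.
    have hpos : 0 < |x S - x T| := abs_pos.2 (sub_ne_zero.2 hS)
    filter_upwards [(hP S).eventually (gt_mem_nhds hε), (hP S).eventually (gt_mem_nhds hpos)]
      with n hn hn' k hk htop
    have h : (P n).t (k + 1) ≤ S := by
      by_contra h
      rw [not_le] at h
      have hST : (T : ℝ≥0∞) ≤ S := by exact_mod_cast hTS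
      exact absurd (le_osc hx (P n) hTS le_rfl hk (hST.trans_lt h) (hk.trans hST) h)
        (not_le.2 hn')
    exact (abs_sub_node_succ_le hx (P n) h).trans hn.le

/-! ### Elementary properties of discrete local times -/

theorem discreteLocalTime_nonneg (x : ℝ≥0 → ℝ) (P : TimePartition) (t : ℝ≥0) (u : ℝ) :
    0 ≤ discreteLocalTime x P t u := by
  rw [discreteLocalTime_eq]
  exact mul_nonneg zero_le_two
    (add_nonneg (Finset.sum_nonneg fun _ _ => tent_nonneg _ _ _) (tent_nonneg _ _ _))

theorem measurable_discreteLocalTime (x : ℝ≥0 → ℝ) (P : TimePartition) (t : ℝ≥0) :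
    Measurable (discreteLocalTime x P t) := by
  rw [funext (discreteLocalTime_eq x P t)]
  exact ((Finset.measurable_fun_sum _ fun _ _ => measurable_tent _ _).add
    (measurable_tent _ _)).const_mul 2

theorem discreteLocalTime_le {x : ℝ≥0 → ℝ} {T : ℝ≥0} {R : ℝ} (hR : ∀ s ≤ T, |x s| ≤ R)
    (P : TimePartition) :
    ∃ C : ℝ, 0 ≤ C ∧ ∀ u, discreteLocalTime x P T u ≤ C * (Icc (-R) R).indicator 1 u := by
  have hnode : ∀ j ≤ P.index T, |x (P.node j)| ≤ R := fun j hj =>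
    hR _ (P.node_le (P.t_le_of_le_index hj))
  refine ⟨2 * (∑ j ∈ Finset.range (P.index T), |x (P.node (j + 1)) - x (P.node j)| +
    |x T - x (P.node (P.index T))|), by positivity, fun u => ?_⟩
  rw [discreteLocalTime_eq, mul_assoc, add_mul, Finset.sum_mul]
  refine mul_le_mul_of_nonneg_left (add_le_add (Finset.sum_le_sum fun j hj => ?_) ?_) zero_le_two
  · have hj' := Finset.mem_range.1 hj
    exact tent_le (hnode j hj'.le) (hnode (j + 1) hj') u
  · exact tent_le (hnode _ le_rfl) (hR _ le_rfl) u

theorem discreteLocalTime_eq_zero {x : ℝ≥0 → ℝ} {T : ℝ≥0} {R : ℝ} (hR : ∀ s ≤ T, |x s| ≤ R)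
    (P : TimePartition) {t : ℝ≥0} (ht : t ≤ T) {u : ℝ} (hu : u ∉ Icc (-R) R) :
    discreteLocalTime x P t u = 0 := by
  obtain ⟨C, -, hC⟩ := discreteLocalTime_le (fun s hs => hR s (hs.trans ht)) P
  refine le_antisymm ((hC u).trans_eq ?_) (discreteLocalTime_nonneg x P t u)
  rw [indicator_of_notMem hu, mul_zero]

/-- Discrete local times increase in time up to an error bounded by the oscillation. -/
theorem discreteLocalTime_le_add {x : ℝ≥0 → ℝ} (hx : Continuous x) {T : ℝ≥0} {R : ℝ}
    (hR : ∀ s ≤ T, |x s| ≤ R) (P : TimePartition) {s t : ℝ≥0} (hst : s ≤ t) (ht : t ≤ T) (u : ℝ) :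
    discreteLocalTime x P s u ≤
      discreteLocalTime x P t u + 2 * osc x P T * (Icc (-R) R).indicator 1 u := by
  -- Between s and t complete intervals are only added. The one term that may be lost is the tent of
  -- the interval unfinished at s, whose height is at most the oscillation.
  have h1 : tent (x (P.node (P.index s))) (x s) u ≤ osc x P T * (Icc (-R) R).indicator 1 u :=
    (tent_le (hR _ ((P.node_le (P.t_index_le s)).trans (hst.trans ht))) (hR _ (hst.trans ht)) u).trans
      (mul_le_mul_of_nonneg_right (abs_sub_node_index_le hx P (hst.trans ht))
        (indicator_nonneg (fun _ _ => zero_le_one) u))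
  have h2 : ∑ j ∈ Finset.range (P.index s), tent (x (P.node j)) (x (P.node (j + 1))) u ≤
      ∑ j ∈ Finset.range (P.index t), tent (x (P.node j)) (x (P.node (j + 1))) u :=
    Finset.sum_le_sum_of_subset_of_nonneg
      (Finset.range_mono (P.index_mono hst)) fun _ _ _ => tent_nonneg _ _ _
  have h3 := tent_nonneg (x (P.node (P.index t))) (x t) u
  rw [discreteLocalTime_eq, discreteLocalTime_eq]
  linarith

theorem integrable_tent_mul (a b : ℝ) {h : ℝ → ℝ} (hh : LocallyIntegrable h volume) :
    Integrable (fun u => tent a b u * h u) := by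
  set R := max |a| |b| with hR
  have h1 : IntegrableOn h (Icc (-R) R) := hh.integrableOn_isCompact isCompact_Icc
  have h2 : Integrable ((Icc (-R) R).indicator h) := h1.integrable_indicator measurableSet_Icc
  have h3 : (fun u => tent a b u * h u) = fun u => tent a b u * (Icc (-R) R).indicator h u := by
    ext u
    by_cases hu : u ∈ Icc (-R) R
    · rw [indicator_of_mem hu]
    · have := tent_le (le_max_left |a| |b|) (le_max_right |a| |b|) u
      rw [← hR, indicator_of_notMem hu, mul_zero] at this
      rw [le_antisymm this (tent_nonneg _ _ _), zero_mul, zero_mul]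
  rw [h3]
  refine h2.bdd_mul (c := |b - a|) (measurable_tent a b).aestronglyMeasurable (.of_forall fun u => ?_)
  rw [Real.norm_eq_abs, abs_of_nonneg (tent_nonneg _ _ _)]
  refine (tent_le (le_max_left |a| |b|) (le_max_right |a| |b|) u).trans ?_
  refine mul_le_of_le_one_right (abs_nonneg _) ?_
  exact indicator_le_self' (fun _ _ => zero_le_one) u

theorem discreteLocalTime_mul_eq (x : ℝ≥0 → ℝ) (P : TimePartition) (t : ℝ≥0) (h : ℝ → ℝ) :
    (fun u => discreteLocalTime x P t u * h u) = fun u =>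
      2 * (∑ j ∈ Finset.range (P.index t), tent (x (P.node j)) (x (P.node (j + 1))) u * h u +
        tent (x (P.node (P.index t))) (x t) u * h u) := by
  ext u
  rw [discreteLocalTime_eq, mul_assoc, add_mul, Finset.sum_mul]

theorem integrable_discreteLocalTime_mul (x : ℝ≥0 → ℝ) (P : TimePartition) (t : ℝ≥0) {h : ℝ → ℝ}
    (hh : LocallyIntegrable h volume) : Integrable (fun u => discreteLocalTime x P t u * h u) := by
  rw [discreteLocalTime_mul_eq]
  exact ((integrable_finsetSum _ fun _ _ => integrable_tent_mul _ _ hh).add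
    (integrable_tent_mul _ _ hh)).const_mul 2

theorem integral_discreteLocalTime_mul (x : ℝ≥0 → ℝ) (P : TimePartition) (t : ℝ≥0) {h : ℝ → ℝ}
    (hh : LocallyIntegrable h volume) :
    ∫ u, discreteLocalTime x P t u * h u =
      2 * (∑ j ∈ Finset.range (P.index t),
        (∫ u, tent (x (P.node j)) (x (P.node (j + 1))) u * h u) +
        ∫ u, tent (x (P.node (P.index t))) (x t) u * h u) := by
  rw [discreteLocalTime_mul_eq, integral_const_mul, integral_add
    (integrable_finsetSum _ fun _ _ => integrable_tent_mul _ _ hh) (integrable_tent_mul _ _ hh),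
    integral_finsetSum _ fun _ _ => integrable_tent_mul _ _ hh]

/-- The integral of the discrete local time is the sum of the squared increments. -/
theorem integral_discreteLocalTime (x : ℝ≥0 → ℝ) (P : TimePartition) (t : ℝ≥0) :
    ∫ u, discreteLocalTime x P t u =
      ∑ j ∈ Finset.range (P.index t), (x (P.node (j + 1)) - x (P.node j)) ^ 2 +
        (x t - x (P.node (P.index t))) ^ 2 := by
  have h := integral_discreteLocalTime_mul x P t (h := fun _ => 1) (locallyIntegrable_const 1)
  simp only [mul_one, integral_tent] at h
  rw [h, ← Finset.sum_div]
  ring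

theorem integrable_discreteLocalTime (x : ℝ≥0 → ℝ) (P : TimePartition) (t : ℝ≥0) :
    Integrable (discreteLocalTime x P t) :=
  memLp_one_iff_integrable.1 (memLp_discreteLocalTime x P t 1)

/-! ### The discrete Itô formula -/

/-- Taylor's formula for a primitive of g: integrate by parts against b - u, which vanishes at b. -/
theorem integral_sub_eq_integral_tent {g : ℝ → ℝ}
    (hg : ∀ a b : ℝ, AbsolutelyContinuousOnInterval g a b) (a b : ℝ) :
    ∫ u in a..b, g u = g a * (b - a) + ∫ u, tent a b u * deriv g u := by
  have hlip : AbsolutelyContinuousOnInterval (fun u => b - u) a b :=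
    (ContDiff.contDiffOn (by fun_prop)).absolutelyContinuousOnInterval
  have h := hlip.integral_mul_deriv_eq_deriv_mul (hg a b)
  have hd : deriv (fun u : ℝ => b - u) = fun _ => -1 := by
    ext u
    simp
  rw [integral_tent_mul, h, hd]
  simp
  ring

theorem intervalIntegrable_of_ac {g : ℝ → ℝ}
    (hg : ∀ a b : ℝ, AbsolutelyContinuousOnInterval g a b) (a b : ℝ) :
    IntervalIntegrable g volume a b :=
  (hg a b).continuousOn.intervalIntegrable

theorem continuous_of_ac {g : ℝ → ℝ}
    (hg : ∀ a b : ℝ, AbsolutelyContinuousOnInterval g a b) : Continuous g :=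
  continuous_iff_continuousAt.2 fun a => (hg (a - 1) (a + 1)).continuousOn.continuousAt (by
    rw [uIcc_of_le (by linarith)]
    exact Icc_mem_nhds (by linarith) (by linarith))

/-- The Taylor expansion of a primitive of g is summed over the intervals; the primitive telescopes
and the remainders assemble to the discrete local time. -/
theorem riemannSum_eq_sub {x : ℝ≥0 → ℝ} (P : TimePartition) {g : ℝ → ℝ}
    (hg : ∀ a b : ℝ, AbsolutelyContinuousOnInterval g a b)
    (hg' : LocallyIntegrable (deriv g) volume) (t : ℝ≥0) :
    riemannSum x P g t =
      (∫ u in x 0..x t, g u) - 1 / 2 * ∫ u, discreteLocalTime x P t u * deriv g u := by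
  have hint := intervalIntegrable_of_ac hg
  have hG : ∀ a b, (∫ u in (0 : ℝ)..b, g u) - (∫ u in (0 : ℝ)..a, g u) =
      g a * (b - a) + ∫ u, tent a b u * deriv g u := fun a b => by
    rw [intervalIntegral.integral_interval_sub_left (hint _ _) (hint _ _),
      integral_sub_eq_integral_tent hg]
  have h := telescope_index x P (fun v => ∫ u in (0 : ℝ)..v, g u) t
  simp only [hG, Finset.sum_add_distrib] at h
  rw [riemannSum_eq, integral_discreteLocalTime_mul x P t hg', integral_sub_eq_integral_tent hg]
  linarith

/-- This turns statements about integrands g in W^{1,q} into statements about arbitrary test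
functions h in L^q. -/
theorem memW1_integral {q : ℝ≥0∞} (hq : 1 ≤ q) {h : ℝ → ℝ} (hh : MemLp h q volume) :
    MemW1 q (fun v => ∫ u in (0 : ℝ)..v, h u) ∧
      deriv (fun v => ∫ u in (0 : ℝ)..v, h u) =ᵐ[volume] h := by
  have hloc := hh.locallyIntegrable hq
  have hii : ∀ a b, IntervalIntegrable h volume a b := fun a b =>
    intervalIntegrable_iff.2
      ((hloc.integrableOn_isCompact isCompact_uIcc).mono_set uIoc_subset_uIcc)
  have hae : deriv (fun v => ∫ u in (0 : ℝ)..v, h u) =ᵐ[volume] h := by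
    filter_upwards [LocallyIntegrable.ae_hasDerivAt_integral hloc] with u hu
    exact (hu 0).deriv
  refine ⟨⟨fun a b => ?_, (memLp_congr_ae hae).2 hh⟩, hae⟩
  -- Absolute continuity of the primitive is available on intervals containing its base point, hence
  -- the detour through an interval containing 0, a and b.
  have h0 := (hii (min 0 (min a b)) (max 0 (max a b))).absolutelyContinuousOnInterval_intervalIntegral
    (c := 0) (by
      rw [uIcc_of_le ((min_le_left _ _).trans (le_max_left _ _))]
      exact ⟨min_le_left _ _, le_max_left _ _⟩)
  refine h0.mono ?_
  rw [uIcc_of_le (a := min 0 (min a b)) (b := max 0 (max a b))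
    ((min_le_left _ _).trans (le_max_left _ _))]
  exact Icc_subset_Icc (min_le_right _ _) (le_max_right _ _)

/-! ### Continuity in time of Riemann sums and local times -/

theorem continuous_capAt (s : ℝ≥0∞) : Continuous (capAt s) := by
  rcases eq_or_ne s ∞ with rfl | hs
  · have : capAt ∞ = id := by
      ext t
      simp [capAt]
    rw [this]
    exact continuous_id
  · lift s to ℝ≥0 using hs
    have : capAt s = fun t => min s t := by
      ext t
      simp [capAt, ← ENNReal.coe_min]
    rw [this]
    fun_prop

theorem continuous_riemannSum {x : ℝ≥0 → ℝ} (hx : Continuous x) (P : TimePartition) (g : ℝ → ℝ) :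
    Continuous (riemannSum x P g) := by
  refine continuous_iff_continuousAt.2 fun t₀ => ?_
  -- The number of nonzero terms depends on t, but before time t₀ + 1 a fixed number of terms is
  -- enough.
  have h : ∀ᶠ t in 𝓝 t₀, riemannSum x P g t = ∑ j ∈ Finset.range (P.index (t₀ + 1) + 1),
      g (valueAt x (P.t j)) * (x (capAt (P.t (j + 1)) t) - x (capAt (P.t j) t)) := by
    filter_upwards [gt_mem_nhds (show t₀ < t₀ + 1 by simp)] with t ht
    refine tsum_eq_sum fun j hj => ?_
    have hj' : P.index (t₀ + 1) < j := by simpa [Nat.lt_succ_iff] using hj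
    have ht' : (t : ℝ≥0∞) ≤ (t₀ + 1 : ℝ≥0) := by exact_mod_cast ht.le
    rw [capAt_of_le (ht'.trans (P.lt_t_of_index_lt hj').le),
      capAt_of_le (ht'.trans (P.lt_t_of_index_lt (hj'.trans (Nat.lt_succ_self j))).le)]
    simp
  have hc : Continuous fun t => ∑ j ∈ Finset.range (P.index (t₀ + 1) + 1),
      g (valueAt x (P.t j)) * (x (capAt (P.t (j + 1)) t) - x (capAt (P.t j) t)) :=
    continuous_finsetSum _ fun j _ => continuous_const.mul
      ((hx.comp (continuous_capAt _)).sub (hx.comp (continuous_capAt _)))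
  exact (hc.continuousAt).congr (h.mono fun t ht => ht.symm)

/-- Continuity in t is read off the discrete Itô formula, where t enters only through x_t and a
finite sum. -/
theorem continuous_integral_discreteLocalTime_mul {x : ℝ≥0 → ℝ} (hx : Continuous x)
    (P : TimePartition) {q : ℝ≥0∞} (hq : 1 ≤ q) {h : ℝ → ℝ} (hh : MemLp h q volume) :
    Continuous fun t => ∫ u, discreteLocalTime x P t u * h u := by
  obtain ⟨hg, hae⟩ := memW1_integral hq hh
  set g := fun v => ∫ u in (0 : ℝ)..v, h u with hgdef
  have hgc := continuous_of_ac hg.1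
  have h1 : ∀ t, ∫ u, discreteLocalTime x P t u * h u =
      2 * ((∫ u in x 0..x t, g u) - riemannSum x P g t) := fun t => by
    rw [riemannSum_eq_sub P hg.1 (hg.2.locallyIntegrable hq)]
    have : ∫ u, discreteLocalTime x P t u * deriv g u = ∫ u, discreteLocalTime x P t u * h u :=
      integral_congr_ae (hae.mono fun u hu => by simp only [hu])
    rw [this]
    ring
  simp only [h1]
  have h2 : Continuous fun v => ∫ u in x 0..v, g u :=
    intervalIntegral.continuous_primitive (fun a b => hgc.intervalIntegrable a b) _
  exact ((h2.comp hx).sub (continuous_riemannSum hx P g)).const_mul 2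

/-! ### Uniform convergence of almost monotone functions -/

/-- If functions which are monotone up to a vanishing error converge pointwise to a continuous
function, then they converge locally uniformly. -/
theorem tendstoLocallyUniformly_of_almost_monotone {f : ℕ → ℝ≥0 → ℝ} {F : ℝ≥0 → ℝ}
    (hF : Continuous F) (hlim : ∀ t, Tendsto (fun n => f n t) atTop (𝓝 (F t)))
    (hmono : ∀ T : ℝ≥0, ∃ e : ℕ → ℝ, Tendsto e atTop (𝓝 0) ∧
      ∀ n s t, s ≤ t → t ≤ T → f n s ≤ f n t + e n) :
    TendstoLocallyUniformly f F atTop := by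
  rw [Metric.tendstoLocallyUniformly_iff]
  intro ε hε t₀
  obtain ⟨δ, hδ, hFδ⟩ := Metric.continuousAt_iff.1 (hF.continuousAt (x := t₀)) (ε / 5) (by positivity)
  set d : ℝ≥0 := (δ / 2).toNNReal with hd
  have hd' : (d : ℝ) = δ / 2 := Real.coe_toNNReal _ (by positivity)
  have hd0 : 0 < d := by
    rw [← NNReal.coe_pos, hd']
    positivity
  obtain ⟨e, he, hfe⟩ := hmono (t₀ + d)
  have hnear : ∀ t, t₀ - d ≤ t → t ≤ t₀ + d → |F t - F t₀| < ε / 5 := by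
    intro t h1 h2
    refine hFδ ?_
    rw [NNReal.dist_eq, abs_lt]
    rw [tsub_le_iff_right] at h1
    have h1' : (t₀ : ℝ) ≤ t + d := by exact_mod_cast h1
    have h2' : (t : ℝ) ≤ t₀ + d := by exact_mod_cast h2
    constructor <;> linarith
  have ha := hnear (t₀ - d) le_rfl (tsub_le_self.trans le_self_add)
  have hb := hnear (t₀ + d) (tsub_le_self.trans le_self_add) le_rfl
  -- Subtraction is truncated at 0: when t₀ ≤ d the left end is 0, and the open interval would miss
  -- t₀ = 0. The second set repairs this.
  refine ⟨Ioo (t₀ - d) (t₀ + d) ∪ Iio (t₀ + d) ∩ {t | t₀ - d = 0}, ?_, ?_⟩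
  · rcases eq_or_ne (t₀ - d) 0 with h | h
    · refine mem_of_superset (gt_mem_nhds (show t₀ < t₀ + d from lt_add_of_pos_right _ hd0)) ?_
      exact fun t ht => Or.inr ⟨ht, h⟩
    · refine mem_of_superset (Ioo_mem_nhds ?_ (lt_add_of_pos_right _ hd0)) subset_union_left
      exact tsub_lt_self (lt_of_lt_of_le (pos_iff_ne_zero.2 h) tsub_le_self) hd0
  · filter_upwards [Metric.tendsto_nhds.1 (hlim (t₀ - d)) (ε / 5) (by positivity),
      Metric.tendsto_nhds.1 (hlim (t₀ + d)) (ε / 5) (by positivity),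
      Metric.tendsto_nhds.1 he (ε / 5) (by positivity)] with n h1 h2 h3 t ht
    have ht1 : t₀ - d ≤ t := by
      rcases ht with ht | ht
      · exact ht.1.le
      · rw [show t₀ - d = 0 from ht.2]
        exact zero_le
    have ht2 : t ≤ t₀ + d := by
      rcases ht with ht | ht
      · exact ht.2.le
      · exact le_of_lt ht.1
    have h4 := hnear t ht1 ht2
    have h5 := hfe n _ _ ht1 ht2
    have h6 := hfe n _ _ ht2 le_rfl
    rw [Real.dist_eq] at h1 h2 h3 ⊢
    rw [sub_zero] at h3
    rw [abs_lt] at *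
    constructor <;> linarith

/-! ### The measures of squared increments -/

/-- The mass which `squareMeasure x P` gives to the partition time `t_j`. -/
def sqIncrement (x : ℝ≥0 → ℝ) (P : TimePartition) (j : ℕ) : ℝ :=
  if P.t (j + 1) = ∞ then 0 else (x (P.node (j + 1)) - x (P.node j)) ^ 2

theorem sqIncrement_nonneg (x : ℝ≥0 → ℝ) (P : TimePartition) (j : ℕ) : 0 ≤ sqIncrement x P j := by
  unfold sqIncrement
  split_ifs
  · exact le_rfl
  · exact sq_nonneg _

theorem squareMeasure_eq (x : ℝ≥0 → ℝ) (P : TimePartition) :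
    squareMeasure x P = Measure.sum fun j =>
      ENNReal.ofReal (sqIncrement x P j) • Measure.dirac (P.node j) := by
  unfold squareMeasure sqIncrement
  congr 1
  ext1 j
  split_ifs with h
  · simp
  · have h' : P.t j ≠ ∞ := ((P.mono (Nat.le_succ j)).trans_lt (lt_top_iff_ne_top.2 h)).ne
    rw [valueAt_eq x P h, valueAt_eq x P h']
    rfl

/-- The atom of the interval straddling t sits at its left end, so it is counted in full on [0,t]
(hence `index t + 1`), whereas the local time sees that interval only up to t. -/
theorem squareMeasure_restrict_Iic (x : ℝ≥0 → ℝ) (P : TimePartition) (t : ℝ≥0) :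
    (squareMeasure x P).restrict (Iic t) = ∑ j ∈ Finset.range (P.index t + 1),
      ENNReal.ofReal (sqIncrement x P j) • Measure.dirac (P.node j) := by
  classical
  rw [squareMeasure_eq, Measure.restrict_sum _ measurableSet_Iic]
  ext s hs
  rw [Measure.sum_apply _ hs, Measure.finsetSum_apply, tsum_eq_sum
    (s := Finset.range (P.index t + 1))]
  · refine Finset.sum_congr rfl fun j hj => ?_
    have hj' : j ≤ P.index t := Nat.lt_succ_iff.1 (Finset.mem_range.1 hj)
    rw [Measure.restrict_smul, restrict_dirac,
      if_pos (show P.node j ∈ Iic t from P.node_le (P.t_le_of_le_index hj'))]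
  · intro j hj
    have hj' : P.index t < j := by simpa [Nat.lt_succ_iff] using hj
    by_cases htop : P.t (j + 1) = ∞
    · simp [sqIncrement, htop]
    · have h' : P.t j ≠ ∞ := ((P.mono (Nat.le_succ j)).trans_lt (lt_top_iff_ne_top.2 htop)).ne
      have hlt := P.lt_t_of_index_lt hj'
      rw [← P.coe_node h'] at hlt
      have hlt' : ¬ P.node j ∈ Iic t := by
        rw [mem_Iic, not_le]
        exact_mod_cast hlt
      rw [Measure.restrict_smul, restrict_dirac, if_neg hlt']
      simp

theorem squareMeasure_Iic_lt_top (x : ℝ≥0 → ℝ) (P : TimePartition) (t : ℝ≥0) :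
    squareMeasure x P (Iic t) < ∞ := by
  have h : squareMeasure x P (Iic t) = (squareMeasure x P).restrict (Iic t) univ := by simp
  rw [h, squareMeasure_restrict_Iic, Measure.finsetSum_apply]
  refine ENNReal.sum_lt_top.2 fun j _ => ?_
  simp

theorem setIntegral_squareMeasure (x : ℝ≥0 → ℝ) (P : TimePartition) (t : ℝ≥0) (ψ : ℝ≥0 → ℝ) :
    ∫ s in Iic t, ψ s ∂(squareMeasure x P) =
      ∑ j ∈ Finset.range (P.index t + 1), sqIncrement x P j * ψ (P.node j) := by
  rw [squareMeasure_restrict_Iic, integral_finsetSum_measure]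
  · refine Finset.sum_congr rfl fun j _ => ?_
    rw [integral_smul_measure, integral_dirac, ENNReal.toReal_ofReal (sqIncrement_nonneg x P j),
      smul_eq_mul]
  · exact fun j _ => (integrable_dirac (by simp)).smul_measure (by simp)

/-- The tent has mass (b - a)²/2 and lives within distance |b - a| of a, so doubled it acts on φ
like (b - a)² times evaluation at a. -/
theorem abs_integral_tent_mul_sub_le {a b R η ω : ℝ} (ha : |a| ≤ R) (hb : |b| ≤ R)
    (hab : |b - a| ≤ η) {φ : ℝ → ℝ} (hφ : Continuous φ)
    (hω : ∀ u ∈ Icc (-R) R, |u - a| ≤ η → |φ u - φ a| ≤ ω) :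
    |2 * (∫ u, tent a b u * φ u) - (b - a) ^ 2 * φ a| ≤ ω * (b - a) ^ 2 := by
  have hint := integrable_tent_mul a b hφ.locallyIntegrable
  have hint' := integrable_tent_mul a b (h := fun _ => φ a) (locallyIntegrable_const _)
  have h1 : (b - a) ^ 2 * φ a = 2 * ∫ u, tent a b u * φ a := by
    rw [integral_mul_const, integral_tent]
    ring
  have h2 : ω * (b - a) ^ 2 = 2 * ∫ u, tent a b u * ω := by
    rw [integral_mul_const, integral_tent]
    ring
  rw [h1, h2, ← mul_sub, ← integral_sub hint hint', abs_mul, abs_two]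
  refine mul_le_mul_of_nonneg_left ((abs_integral_le_integral_abs).trans
    (integral_mono_of_nonneg (.of_forall fun u => abs_nonneg _)
      (integrable_tent_mul a b (h := fun _ => ω) (locallyIntegrable_const _))
      (.of_forall fun u => ?_))) zero_le_two
  simp only
  rw [← mul_sub, abs_mul, abs_of_nonneg (tent_nonneg a b u)]
  rcases eq_or_ne (tent a b u) 0 with h | h
  · rw [h, zero_mul, zero_mul]
  · refine mul_le_mul_of_nonneg_left (hω u ?_ ((tent_ne_zero h).trans hab)) (tent_nonneg a b u)
    by_contra hu
    have := tent_le ha hb u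
    rw [indicator_of_notMem hu, mul_zero] at this
    exact h (le_antisymm this (tent_nonneg a b u))

/-- The integral of `φ` against the discrete local time compares with the integral of `φ(x)`
against the measure of squared increments. -/
theorem abs_integral_sub_setIntegral_le {x : ℝ≥0 → ℝ} (hx : Continuous x) (P : TimePartition)
    {t : ℝ≥0} {R η ω M : ℝ} (hR : ∀ s ≤ t, |x s| ≤ R)
    (hη : ∀ k, P.t k ≤ t → P.t (k + 1) ≠ ∞ → |x (P.node (k + 1)) - x (P.node k)| ≤ η)
    (hη' : osc x P t ≤ η) {φ : ℝ → ℝ} (hφ : Continuous φ)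
    (hω : ∀ u ∈ Icc (-R) R, ∀ v ∈ Icc (-R) R, |u - v| ≤ η → |φ u - φ v| ≤ ω)
    (hM : ∀ u ∈ Icc (-R) R, |φ u| ≤ M) :
    |(∫ u, discreteLocalTime x P t u * φ u) - ∫ s in Iic t, φ (x s) ∂(squareMeasure x P)| ≤
      ω * (∫ u, discreteLocalTime x P t u) + 2 * M * η ^ 2 := by
  have hRt := hR t le_rfl
  have hnode : ∀ j ≤ P.index t, |x (P.node j)| ≤ R := fun j hj =>
    hR _ (P.node_le (P.t_le_of_le_index hj))
  have hη0 : 0 ≤ η := (osc_nonneg hx P t).trans hη'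
  have hlast : |x t - x (P.node (P.index t))| ≤ η :=
    (abs_sub_node_index_le hx P le_rfl).trans hη'
  have hM0 : |φ (x (P.node (P.index t)))| ≤ M := hM _ (abs_le.1 (hnode _ le_rfl))
  rw [integral_discreteLocalTime_mul x P t hφ.locallyIntegrable, setIntegral_squareMeasure,
    integral_discreteLocalTime, Finset.sum_range_succ, mul_add, Finset.mul_sum, mul_add,
    Finset.mul_sum]
  have h1 : |∑ j ∈ Finset.range (P.index t),
        2 * (∫ u, tent (x (P.node j)) (x (P.node (j + 1))) u * φ u) -
      ∑ j ∈ Finset.range (P.index t), sqIncrement x P j * φ (x (P.node j))| ≤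
      ∑ j ∈ Finset.range (P.index t), ω * (x (P.node (j + 1)) - x (P.node j)) ^ 2 := by
    rw [← Finset.sum_sub_distrib]
    refine (Finset.abs_sum_le_sum_abs _ _).trans (Finset.sum_le_sum fun j hj => ?_)
    have hj' := Finset.mem_range.1 hj
    have htop := P.t_ne_top (P.t_le_of_le_index (show j + 1 ≤ _ from hj'))
    rw [sqIncrement, if_neg htop]
    exact abs_integral_tent_mul_sub_le (hnode j hj'.le) (hnode _ hj')
      (hη j (P.t_le_of_le_index hj'.le) htop) hφ
      fun u hu h => hω u hu _ (abs_le.1 (hnode j hj'.le)) h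
  have h2 := abs_integral_tent_mul_sub_le (hnode _ le_rfl) hRt hlast hφ
      fun u hu h => hω u hu _ (abs_le.1 (hnode _ le_rfl)) h
  -- The straddling interval is treated differently on the two sides. Each of its two contributions
  -- is at most Mη², which is the origin of 2Mη².
  have h3 : |(x t - x (P.node (P.index t))) ^ 2 * φ (x (P.node (P.index t)))| ≤ η ^ 2 * M := by
    rw [abs_mul, abs_pow]
    exact mul_le_mul (pow_le_pow_left₀ (abs_nonneg _) hlast 2) hM0 (abs_nonneg _) (by positivity)
  have h4 : |sqIncrement x P (P.index t) * φ (x (P.node (P.index t)))| ≤ η ^ 2 * M := by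
    rw [abs_mul, abs_of_nonneg (sqIncrement_nonneg _ _ _)]
    refine mul_le_mul ?_ hM0 (abs_nonneg _) (by positivity)
    unfold sqIncrement
    split_ifs with htop
    · positivity
    · rw [← sq_abs]
      exact pow_le_pow_left₀ (abs_nonneg _) (hη _ (P.t_index_le t) htop) 2
  rw [abs_le] at *
  constructor <;> linarith

/-- For φ = 1 the modulus of continuity is 0, so no prior bound on the mass is needed; such a bound
for general φ can be obtained from this case. -/
theorem tendsto_integral_sub_squareMeasure {x : ℝ≥0 → ℝ} (hx : Continuous x)
    {P : ℕ → TimePartition} (hP : ∀ t : ℝ≥0, Tendsto (fun n => osc x (P n) t) atTop (𝓝 0))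
    (t : ℝ≥0) :
    Tendsto (fun n => (∫ u, discreteLocalTime x (P n) t u) - (squareMeasure x (P n)).real (Iic t))
      atTop (𝓝 0) := by
  obtain ⟨R, hR0, hR⟩ := exists_bound x hx t
  rw [Metric.tendsto_nhds]
  intro ε hε
  set η := min 1 (ε / 4) with hη
  have hη0 : 0 < η := by positivity
  filter_upwards [eventually_abs_sub_node_succ_le hx hP t hη0,
    (hP t).eventually (gt_mem_nhds hη0)] with n h1 h2
  have h := abs_integral_sub_setIntegral_le hx (P n) hR h1 h2.le (φ := fun _ => 1) (ω := 0) (M := 1)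
    continuous_const (fun _ _ _ _ _ => by simp) (fun _ _ => by simp)
  simp only [mul_one, setIntegral_const, smul_eq_mul, zero_mul, zero_add] at h
  rw [Real.dist_eq, sub_zero]
  have h3 : η ^ 2 ≤ ε / 4 := by
    rw [sq]
    exact (mul_le_of_le_one_left hη0.le (min_le_left _ _)).trans (min_le_right _ _)
  linarith

theorem tendsto_integral_sub_setIntegral {x : ℝ≥0 → ℝ} (hx : Continuous x)
    {P : ℕ → TimePartition} (hP : ∀ t : ℝ≥0, Tendsto (fun n => osc x (P n) t) atTop (𝓝 0))
    (t : ℝ≥0) {C : ℝ} (hC : ∀ᶠ n in atTop, ∫ u, discreteLocalTime x (P n) t u ≤ C)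
    {φ : ℝ → ℝ} (hφ : Continuous φ) :
    Tendsto (fun n => (∫ u, discreteLocalTime x (P n) t u * φ u) -
      ∫ s in Iic t, φ (x s) ∂(squareMeasure x (P n))) atTop (𝓝 0) := by
  obtain ⟨R, hR0, hR⟩ := exists_bound x hx t
  obtain ⟨M, hM⟩ := (isCompact_Icc (a := -R) (b := R)).exists_bound_of_continuousOn hφ.continuousOn
  have hM0 : 0 ≤ M := (norm_nonneg _).trans (hM 0 ⟨by linarith, hR0⟩)
  have huc := (isCompact_Icc (a := -R) (b := R)).uniformContinuousOn_of_continuous hφ.continuousOn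
  rw [Metric.tendsto_nhds]
  intro ε hε
  -- ω is multiplied by the mass, at most C; η is below 1, so that η² ≤ η, and small enough for both
  -- the modulus of continuity and the 2Mη² term.
  set ω := ε / (4 * (|C| + 1)) with hω
  have hω0 : 0 < ω := by positivity
  obtain ⟨δ, hδ, hδ'⟩ := Metric.uniformContinuousOn_iff.1 huc ω hω0
  set η := min (min 1 (δ / 2)) (ε / (8 * (M + 1))) with hη
  have hη0 : 0 < η := by positivity
  have hη1 : η ≤ 1 := (min_le_left _ _).trans (min_le_left _ _)
  have hη2 : η ≤ δ / 2 := (min_le_left _ _).trans (min_le_right _ _)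
  have hη3 : η ≤ ε / (8 * (M + 1)) := min_le_right _ _
  filter_upwards [eventually_abs_sub_node_succ_le hx hP t hη0,
    (hP t).eventually (gt_mem_nhds hη0), hC] with n h1 h2 h3
  have h := abs_integral_sub_setIntegral_le hx (P n) hR h1 h2.le hφ (ω := ω) (M := M)
    (fun u hu v hv huv => (hδ' u hu v hv (by
      rw [Real.dist_eq]
      linarith)).le) hM
  rw [Real.dist_eq, sub_zero]
  have h4 : ω * ∫ u, discreteLocalTime x (P n) t u ≤ ε / 4 := by
    have : ω * (|C| + 1) = ε / 4 := by
      rw [hω]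
      field_simp
    rw [← this]
    exact mul_le_mul_of_nonneg_left (h3.trans ((le_abs_self C).trans (by linarith))) hω0.le
  have h5 : 2 * M * η ^ 2 ≤ ε / 4 := by
    have h6 : η ^ 2 ≤ ε / (8 * (M + 1)) := by
      rw [sq]
      exact (mul_le_of_le_one_left hη0.le hη1).trans hη3
    have h7 : 2 * (M + 1) * (ε / (8 * (M + 1))) = ε / 4 := by
      field_simp
      ring
    rw [← h7]
    exact mul_le_mul (by linarith) h6 (by positivity) (by positivity)
  linarith

/-! ### Convergence of measures on the half line -/

theorem integrableOn_Iic {ν : Measure ℝ≥0} {T : ℝ≥0} (hν : ν (Iic T) < ∞) {φ : ℝ≥0 → ℝ}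
    (hφ : Continuous φ) : IntegrableOn φ (Iic T) ν := by
  have hI : Iic T = Icc 0 T := by
    ext s
    simp
  obtain ⟨C, hC⟩ := (isCompact_Icc (a := (0 : ℝ≥0)) (b := T)).exists_bound_of_continuousOn
    hφ.continuousOn
  rw [← hI] at hC
  exact Measure.integrableOn_of_bounded hν.ne hφ.aestronglyMeasurable (M := C)
    ((ae_restrict_mem measurableSet_Iic).mono hC)

/-- Convergence of the distribution functions implies convergence of the integrals of continuous
functions over bounded intervals. -/
theorem tendsto_setIntegral_of_tendsto_Iic {ν : ℕ → Measure ℝ≥0} {μ : Measure ℝ≥0}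
    (hν : ∀ n T, ν n (Iic T) < ∞) (hμ : ∀ T, μ (Iic T) < ∞)
    (hlim : ∀ T, Tendsto (fun n => (ν n).real (Iic T)) atTop (𝓝 (μ.real (Iic T))))
    {φ : ℝ≥0 → ℝ} (hφ : Continuous φ) (T : ℝ≥0) :
    Tendsto (fun n => ∫ s in Iic T, φ s ∂(ν n)) atTop (𝓝 (∫ s in Iic T, φ s ∂μ)) := by
  set D : ℕ → ℝ≥0 → ℝ := fun n t => (∫ s in Iic t, φ s ∂(ν n)) - ∫ s in Iic t, φ s ∂μ with hD
  have hsplit : ∀ (m : Measure ℝ≥0) (_ : ∀ T, m (Iic T) < ∞) (a b : ℝ≥0) (_ : a ≤ b) (ε : ℝ)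
      (_ : ∀ s ∈ Ioc a b, |φ s - φ a| ≤ ε),
      |(∫ s in Iic b, φ s ∂m) - (∫ s in Iic a, φ s ∂m) -
        φ a * (m.real (Iic b) - m.real (Iic a))| ≤ ε * (m.real (Iic b) - m.real (Iic a)) := by
    intro m hm a b hab ε hε
    have hfin : m (Ioc a b) < ∞ := (measure_mono Ioc_subset_Iic_self).trans_lt (hm b)
    have h1 : ∫ s in Iic b, φ s ∂m = (∫ s in Iic a, φ s ∂m) + ∫ s in Ioc a b, φ s ∂m := by
      rw [← setIntegral_union (Iic_disjoint_Ioc le_rfl) measurableSet_Ioc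
        (integrableOn_Iic (hm a) hφ) ((integrableOn_Iic (hm b) hφ).mono_set Ioc_subset_Iic_self),
        Iic_union_Ioc_eq_Iic hab]
    have h2 : m.real (Iic b) = m.real (Iic a) + m.real (Ioc a b) := by
      rw [← measureReal_union (Iic_disjoint_Ioc le_rfl) measurableSet_Ioc (hm a).ne hfin.ne,
        Iic_union_Ioc_eq_Iic hab]
    have h3 : φ a * m.real (Ioc a b) = ∫ _ in Ioc a b, φ a ∂m := by
      rw [setIntegral_const, smul_eq_mul, mul_comm]
    have h4 : IntegrableOn (fun _ => φ a) (Ioc a b) m := integrableOn_const hfin.ne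
    rw [h1, h2, add_sub_cancel_left, add_sub_cancel_left, h3,
      ← integral_sub ((integrableOn_Iic (hm b) hφ).mono_set Ioc_subset_Iic_self) h4]
    exact norm_setIntegral_le_of_norm_le_const (f := fun s => φ s - φ a) hfin hε
  -- Induction over a grid of mesh d: on each cell φ is frozen at the left end, at a cost of ε times
  -- the mass of the cell for ν n and again for μ. This explains the factor 2ε; ζ absorbs the
  -- convergence of the finitely many masses.
  have key : ∀ ε > 0, ∀ ζ > 0, ∀ᶠ n in atTop, |D n T| ≤ 2 * ε * μ.real (Iic T) + ζ := by
    intro ε hε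
    have huc := (isCompact_Icc (a := (0 : ℝ≥0)) (b := T)).uniformContinuousOn_of_continuous
      hφ.continuousOn
    obtain ⟨δ, hδ, hδ'⟩ := Metric.uniformContinuousOn_iff.1 huc ε hε
    set d : ℝ≥0 := (δ / 2).toNNReal with hd
    have hd' : (d : ℝ) = δ / 2 := Real.coe_toNNReal _ (by positivity)
    have hstep : ∀ i : ℕ, ∀ ζ > 0, ∀ᶠ n in atTop,
        |D n (min (i * d) T)| ≤ 2 * ε * μ.real (Iic (min (i * d) T)) + ζ := by
      intro i
      induction i with
      | zero =>
        intro ζ hζ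
        -- The grid starts at a possible atom at 0, where the two integrals are compared directly.
        have h0 : Iic (0 : ℝ≥0) = {0} := by
          ext s
          simp
        have hφ0 : ∀ m : Measure ℝ≥0, ∫ s in Iic (0 : ℝ≥0), φ s ∂m = m.real (Iic 0) * φ 0 := by
          intro m
          rw [h0, integral_singleton, smul_eq_mul]
        have h1 : Tendsto (fun n => D n 0) atTop (𝓝 0) := by
          simp only [hD, hφ0]
          have := ((hlim 0).mul_const (φ 0)).sub_const (μ.real (Iic 0) * φ 0)
          rwa [sub_self] at this
        filter_upwards [Metric.tendsto_nhds.1 h1 ζ hζ] with n hn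
        rw [Real.dist_eq, sub_zero] at hn
        rw [Nat.cast_zero, zero_mul, min_eq_left zero_le]
        have : 0 ≤ 2 * ε * μ.real (Iic 0) := by positivity
        linarith
      | succ i ih =>
        intro ζ hζ
        set a := min ((i : ℝ≥0) * d) T with ha
        set b := min (((i + 1 : ℕ) : ℝ≥0) * d) T with hb
        have hab : a ≤ b := min_le_min_right _ (by gcongr; simp)
        have hba : b ≤ a + d := by
          rw [ha, hb, min_add, Nat.cast_succ, add_one_mul]
          exact min_le_min_left _ le_self_add
        have hbT : b ≤ T := min_le_right _ _
        have hε' : ∀ s ∈ Ioc a b, |φ s - φ a| ≤ ε := fun s hs => by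
          refine (hδ' s ⟨zero_le, hs.2.trans hbT⟩ a ⟨zero_le, hab.trans hbT⟩ ?_).le
          have h1 : (a : ℝ) < s := by exact_mod_cast hs.1
          have h2 : (s : ℝ) ≤ a + d := by exact_mod_cast hs.2.trans hba
          rw [NNReal.dist_eq, abs_of_nonneg (by linarith)]
          linarith
        have h1 : Tendsto (fun n => |φ a| * |(ν n).real (Iic b) - (ν n).real (Iic a) -
            (μ.real (Iic b) - μ.real (Iic a))| + ε * ((ν n).real (Iic b) - (ν n).real (Iic a)))
            atTop (𝓝 (ε * (μ.real (Iic b) - μ.real (Iic a)))) := by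
          have h2 := (hlim b).sub (hlim a)
          have h3 := (h2.sub_const (μ.real (Iic b) - μ.real (Iic a))).abs.const_mul |φ a|
          have h4 := h3.add (h2.const_mul ε)
          rwa [sub_self, abs_zero, mul_zero, zero_add] at h4
        filter_upwards [ih (ζ / 2) (by positivity),
          h1.eventually (gt_mem_nhds (lt_add_of_pos_right _ (half_pos hζ)))] with n h2 h3
        have h4 := hsplit (ν n) (hν n) a b hab ε hε'
        have h5 := hsplit μ hμ a b hab ε hε'
        have h6 := neg_abs_le (φ a * ((ν n).real (Iic b) - (ν n).real (Iic a) -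
            (μ.real (Iic b) - μ.real (Iic a))))
        have h7 := le_abs_self (φ a * ((ν n).real (Iic b) - (ν n).real (Iic a) -
            (μ.real (Iic b) - μ.real (Iic a))))
        rw [abs_mul] at h6 h7
        simp only [hD] at h2 ⊢
        rw [abs_le] at h2 h4 h5 ⊢
        constructor <;> nlinarith
    intro ζ hζ
    obtain ⟨i, hi⟩ := exists_nat_gt ((T : ℝ) / d)
    have hd0 : 0 < (d : ℝ) := by
      rw [hd']
      positivity
    have hi' : T ≤ i * d := by
      rw [div_lt_iff₀ hd0] at hi
      exact_mod_cast hi.le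
    have := hstep i ζ hζ
    rwa [min_eq_right hi'] at this
  rw [Metric.tendsto_nhds]
  intro ε hε
  have hm : 0 ≤ μ.real (Iic T) := measureReal_nonneg
  filter_upwards [key (ε / (4 * (μ.real (Iic T) + 1))) (by positivity) (ε / 4) (by positivity)]
    with n hn
  rw [Real.dist_eq]
  have h1 : 2 * (ε / (4 * (μ.real (Iic T) + 1))) * μ.real (Iic T) ≤ ε / 2 := by
    have h2 : 2 * (ε / (4 * (μ.real (Iic T) + 1))) * (μ.real (Iic T) + 1) = ε / 2 := by
      field_simp
      ring
    rw [← h2]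
    exact mul_le_mul_of_nonneg_left (by linarith) (by positivity)
  exact hn.trans_lt (by linarith)

/-- Vague convergence to an atomless measure implies convergence of the integrals of continuous
functions over bounded intervals. -/
theorem tendsto_setIntegral_of_vague {ν : ℕ → Measure ℝ≥0} {μ : Measure ℝ≥0}
    [IsLocallyFiniteMeasure μ] (hν : ∀ n T, ν n (Iic T) < ∞) (hμ : ∀ s, μ {s} = 0)
    (hlim : ∀ φ : ℝ≥0 → ℝ, Continuous φ → HasCompactSupport φ →
      Tendsto (fun n => ∫ s, φ s ∂(ν n)) atTop (𝓝 (∫ s, φ s ∂μ)))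
    {k : ℝ≥0 → ℝ} (hk : Continuous k) (t : ℝ≥0) :
    Tendsto (fun n => ∫ s in Iic t, k s ∂(ν n)) atTop (𝓝 (∫ s in Iic t, k s ∂μ)) := by
  have hI : ∀ T : ℝ≥0, Iic T = Icc 0 T := fun T => by
    ext s
    simp
  have hμfin : ∀ T : ℝ≥0, μ (Iic T) < ∞ := fun T => by
    rw [hI]
    exact isCompact_Icc.measure_lt_top
  obtain ⟨M, hM⟩ := (isCompact_Icc (a := (0 : ℝ≥0)) (b := t + 2)).exists_bound_of_continuousOn
    hk.continuousOn
  have hM0 : 0 ≤ M := (norm_nonneg _).trans (hM 0 ⟨le_rfl, zero_le⟩)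
  -- χ is a continuous cutoff, 1 on [0,t] and 0 beyond t + δ. The tent ψ around t dominates the
  -- difference between χ and the indicator of [0,t]. Its μ-integral vanishes as δ → 0 because t is
  -- not an atom, and for fixed δ vague convergence carries this smallness over to ν n.
  set ψ : ℝ → ℝ≥0 → ℝ := fun δ s => max 0 (2 - |(s : ℝ) - t| / δ) with hψ
  set χ : ℝ → ℝ≥0 → ℝ := fun δ s => max 0 (min 1 (1 - ((s : ℝ) - t) / δ)) with hχ
  have hψc : ∀ δ, Continuous (ψ δ) := fun δ => by fun_prop
  have hχc : ∀ δ, Continuous (χ δ) := fun δ => by fun_prop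
  have hψ0 : ∀ δ ∈ Ioc (0 : ℝ) 1, ∀ s, t + 2 < s → ψ δ s = 0 := by
    intro δ hδ s hs
    have hs' : (t : ℝ) + 2 < s := by exact_mod_cast hs
    refine max_eq_left ?_
    rw [abs_of_nonneg (by linarith), sub_nonpos, le_div_iff₀ hδ.1]
    linarith [hδ.2]
  have hχ0 : ∀ δ ∈ Ioc (0 : ℝ) 1, ∀ s, t + 2 < s → χ δ s = 0 := by
    intro δ hδ s hs
    have hs' : (t : ℝ) + 2 < s := by exact_mod_cast hs
    refine max_eq_left ((min_le_right _ _).trans ?_)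
    rw [sub_nonpos, le_div_iff₀ hδ.1]
    linarith [hδ.2]
  have hsupp : ∀ f : ℝ≥0 → ℝ, (∀ s, t + 2 < s → f s = 0) → HasCompactSupport f := fun f hf =>
    HasCompactSupport.intro (isCompact_Icc (a := (0 : ℝ≥0)) (b := t + 2)) fun s hs => hf s (by
      by_contra h
      exact hs ⟨zero_le, not_lt.1 h⟩)
  have hcut : ∀ (m : Measure ℝ≥0) (_ : ∀ T, m (Iic T) < ∞), ∀ δ ∈ Ioc (0 : ℝ) 1,
      |(∫ s in Iic t, k s ∂m) - ∫ s, k s * χ δ s ∂m| ≤ M * ∫ s, ψ δ s ∂m := by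
    intro m hm δ hδ
    have h1 : ∫ s, k s * χ δ s ∂m = ∫ s in Iic (t + 2), k s * χ δ s ∂m :=
      (setIntegral_eq_integral_of_forall_compl_eq_zero fun s hs => by
        rw [hχ0 δ hδ s (not_le.1 hs), mul_zero]).symm
    have h2 : ∫ s, ψ δ s ∂m = ∫ s in Iic (t + 2), ψ δ s ∂m :=
      (setIntegral_eq_integral_of_forall_compl_eq_zero fun s hs =>
        hψ0 δ hδ s (not_le.1 hs)).symm
    have h3 : ∫ s in Iic t, k s ∂m = ∫ s in Iic (t + 2), (Iic t).indicator k s ∂m := by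
      rw [setIntegral_indicator measurableSet_Iic,
        inter_eq_self_of_subset_right (Iic_subset_Iic.2 le_self_add)]
    rw [h1, h2, h3, ← integral_sub ((integrableOn_Iic (hm _) hk).indicator measurableSet_Iic)
      (integrableOn_Iic (hm _) (show Continuous fun s => k s * χ δ s from hk.mul (hχc δ))), ← integral_const_mul]
    refine (abs_integral_le_integral_abs).trans (integral_mono_of_nonneg
      (.of_forall fun _ => abs_nonneg _) ((integrableOn_Iic (hm _) (hψc δ)).const_mul M) ?_)
    filter_upwards [ae_restrict_mem measurableSet_Iic] with s hs
    have hks : |k s| ≤ M := hM s ⟨zero_le, hs⟩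
    have hψs : 0 ≤ ψ δ s := le_max_left _ _
    rcases le_or_gt s t with hst | hst
    · have hst' : (s : ℝ) ≤ t := by exact_mod_cast hst
      have : χ δ s = 1 := by
        simp only [hχ]
        rw [min_eq_left, max_eq_right zero_le_one]
        have : ((s : ℝ) - t) / δ ≤ 0 := div_nonpos_of_nonpos_of_nonneg (by linarith) hδ.1.le
        linarith
      rw [indicator_of_mem (show s ∈ Iic t from hst), this, mul_one, sub_self, abs_zero]
      positivity
    · have hst' : (t : ℝ) < s := by exact_mod_cast hst
      rw [indicator_of_notMem (show s ∉ Iic t from not_le.2 hst), zero_sub, abs_neg, abs_mul]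
      refine mul_le_mul hks ?_ (abs_nonneg _) hM0
      rw [abs_of_nonneg (le_max_left _ _)]
      simp only [hχ, hψ]
      refine max_le_max le_rfl ((min_le_right _ _).trans ?_)
      rw [abs_of_pos (by linarith)]
      linarith
  have hψlim : Tendsto (fun i : ℕ => ∫ s, ψ (1 / ((i : ℝ) + 1)) s ∂μ) atTop (𝓝 0) := by
    have hδ : ∀ i : ℕ, 1 / ((i : ℝ) + 1) ∈ Ioc (0 : ℝ) 1 := fun i =>
      ⟨by positivity, by rw [div_le_one (by positivity)]; simp⟩
    have h := tendsto_integral_of_dominated_convergence (μ := μ)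
      (F := fun (i : ℕ) s => ψ (1 / ((i : ℝ) + 1)) s) (f := fun _ => 0)
      ((Iic (t + 2)).indicator fun _ => (2 : ℝ))
      (fun i => (hψc _).aestronglyMeasurable)
      ((integrable_indicator_iff measurableSet_Iic).2 (integrableOn_const (hμfin _).ne))
      (fun i => .of_forall fun s => by
        by_cases hs : s ∈ Iic (t + 2)
        · rw [indicator_of_mem hs, Real.norm_eq_abs, abs_of_nonneg (le_max_left _ _)]
          refine max_le zero_le_two ?_
          have : 0 ≤ |(s : ℝ) - t| / (1 / ((i : ℝ) + 1)) := by positivity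
          linarith
        · rw [indicator_of_notMem hs, hψ0 _ (hδ i) s (not_le.1 hs), norm_zero]) (by
      filter_upwards [measure_eq_zero_iff_ae_notMem.1 (hμ t)] with s hs
      have hs' : 0 < |(s : ℝ) - t| := abs_pos.2 (sub_ne_zero.2 (by exact_mod_cast hs))
      obtain ⟨N, hN⟩ := exists_nat_gt (2 / |(s : ℝ) - t|)
      refine tendsto_const_nhds.congr' ?_
      filter_upwards [eventually_ge_atTop N] with i hi
      refine (max_eq_left ?_).symm
      have hi' : (N : ℝ) ≤ i := by exact_mod_cast hi
      rw [div_lt_iff₀ hs'] at hN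
      rw [div_div_eq_mul_div, div_one]
      nlinarith)
    simpa using h
  rw [Metric.tendsto_nhds]
  intro ε hε
  obtain ⟨i, hi⟩ := (hψlim.eventually (gt_mem_nhds
    (show 0 < ε / (8 * (M + 1)) by positivity))).exists
  set δ := 1 / ((i : ℝ) + 1) with hδ
  have hδ' : δ ∈ Ioc (0 : ℝ) 1 :=
    ⟨by positivity, by rw [hδ, div_le_one (by positivity)]; simp⟩
  filter_upwards [(hlim (ψ δ) (hψc δ) (hsupp _ (hψ0 δ hδ'))).eventually (gt_mem_nhds hi),
    Metric.tendsto_nhds.1 (hlim (fun s => k s * χ δ s) (hk.mul (hχc δ)) (hsupp _ fun s hs => by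
      rw [hχ0 δ hδ' s hs, mul_zero])) (ε / 4) (by positivity)] with n h1 h2
  have h3 := hcut (ν n) (hν n) δ hδ'
  have h4 := hcut μ hμfin δ hδ'
  have h5 : M * (ε / (8 * (M + 1))) ≤ ε / 8 := by
    have h6 : (M + 1) * (ε / (8 * (M + 1))) = ε / 8 := by
      field_simp
    rw [← h6]
    exact mul_le_mul_of_nonneg_right (by linarith) (by positivity)
  have h7 := mul_le_mul_of_nonneg_left h1.le hM0
  have h8 := mul_le_mul_of_nonneg_left hi.le hM0
  rw [Real.dist_eq] at h2 ⊢
  rw [abs_lt] at h2 ⊢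
  rw [abs_le] at h3 h4
  constructor <;> linarith

/-- A continuous increasing function which vanishes at `0` is the distribution function of an
atomless measure. -/
theorem exists_measure_Iic_eq {V : ℝ≥0 → ℝ} (hV : Continuous V) (hmono : Monotone V)
    (h0 : V 0 = 0) :
    ∃ μ : Measure ℝ≥0, IsLocallyFiniteMeasure μ ∧ (∀ s, μ {s} = 0) ∧
      ∀ t, μ (Iic t) < ∞ ∧ μ.real (Iic t) = V t := by
  set f : StieltjesFunction ℝ≥0 := ⟨V, hmono, fun t => hV.continuousWithinAt⟩ with hf
  have hIic : ∀ t, f.measure (Iic t) = ENNReal.ofReal (V t) := fun t => by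
    have h : Tendsto f atBot (𝓝 0) := by
      -- The half line has a least element, so the limit at `atBot` is the value at 0 and V 0 = 0
      -- means that 0 carries no mass.
      have hbot : (atBot : Filter ℝ≥0) = pure 0 := by
        rw [OrderBot.atBot_eq]
        rfl
      rw [hbot, tendsto_pure_left]
      intro s hs
      have : f 0 = 0 := h0
      rw [this]
      exact mem_of_mem_nhds hs
    rw [f.measure_Iic h, sub_zero]
  refine ⟨f.measure, inferInstance, fun s => ?_, fun t => ⟨?_, ?_⟩⟩
  · rw [f.measure_singleton, ENNReal.ofReal_eq_zero,
      ContinuousWithinAt.leftLim_eq (f := f) hV.continuousWithinAt, sub_self]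
  · rw [hIic]
    exact ENNReal.ofReal_lt_top
  · rw [measureReal_def, hIic, ENNReal.toReal_ofReal]
    exact h0.symm.le.trans (hmono zero_le)

/-! ### Duality of the `L^p` spaces -/

section Duality

variable {α : Type*} [MeasurableSpace α] {μ : Measure α}

theorem memLp_of_bounded_of_support {K : Set α} (hK : MeasurableSet K) (hμK : μ K ≠ ∞) {f : α → ℝ}
    (hf : AEStronglyMeasurable f μ) {C : ℝ} (hC : ∀ u, |f u| ≤ C) (hsupp : ∀ u, u ∉ K → f u = 0)
    (r : ℝ≥0∞) : MemLp f r μ := by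
  have h : K.indicator f = f := indicator_eq_self.2 fun u hu => by
    by_contra h
    exact hu (hsupp u h)
  have : IsFiniteMeasure (μ.restrict K) := ⟨by simpa using hμK.lt_top⟩
  rw [← h, memLp_indicator_iff_restrict hK]
  exact MemLp.of_bound hf.restrict C (.of_forall hC)

theorem memLp_indicator_one {S : Set α} (hS : MeasurableSet S) (hμS : μ S ≠ ∞) (r : ℝ≥0∞) :
    MemLp (S.indicator (1 : α → ℝ)) r μ :=
  memLp_indicator_const r hS 1 (Or.inr hμS)

theorem integral_abs_mul_abs_le {p q : ℝ≥0∞} (hpq : p.HolderConjugate q) {f g : α → ℝ}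
    (hf : MemLp f p μ) (hg : MemLp g q μ) :
    ∫ u, |f u| * |g u| ∂μ ≤ (eLpNorm f p μ).toReal * (eLpNorm g q μ).toReal := by
  have h1 := eLpNorm_smul_le_mul_eLpNorm (p := p) (q := q) (r := 1) hg.1 hf.1
  have h2 : eLpNorm (f • g) 1 μ = ENNReal.ofReal (∫ u, |f u| * |g u| ∂μ) := by
    rw [eLpNorm_one_eq_lintegral_enorm, ← ofReal_integral_norm_eq_lintegral_enorm
      (show Integrable (f • g) μ from hf.integrable_mul hg)]
    simp
  rw [← ENNReal.toReal_mul, ← ENNReal.ofReal_le_iff_le_toReal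
    (ENNReal.mul_ne_top hf.2.ne hg.2.ne), ← h2]
  exact h1

/-- The `L^p` norm of a function is bounded by its norm as a functional on `L^q`. -/
theorem eLpNorm_le_of_forall_abs_integral_mul_le {p q : ℝ≥0∞} (hpq : p.HolderConjugate q)
    {K : Set α} (hK : MeasurableSet K) (hμK : μ K ≠ ∞) {g : α → ℝ} (hg : Measurable g) {B : ℝ}
    (hB : ∀ u, |g u| ≤ B) (hsupp : ∀ u, u ∉ K → g u = 0) {C : ℝ} (hC : 0 ≤ C)
    (h : ∀ f : α → ℝ, Measurable f → MemLp f q μ →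
      |∫ u, g u * f u ∂μ| ≤ C * (eLpNorm f q μ).toReal) :
    eLpNorm g p μ ≤ ENNReal.ofReal C := by
  -- A sign of g taking the value 1 where g = 0, so that |σ| = 1 everywhere.
  set σ : α → ℝ := fun u => if 0 ≤ g u then 1 else -1 with hσ
  have hσm : Measurable σ := Measurable.ite (measurableSet_le measurable_const hg)
    measurable_const measurable_const
  have hσg : ∀ u, g u * σ u = |g u| := fun u => by
    simp only [hσ]
    split_ifs with h0
    · rw [mul_one, abs_of_nonneg h0]
    · rw [abs_of_neg (not_le.1 h0)]
      ring
  have hσ1 : ∀ u, |σ u| = 1 := fun u => by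
    simp only [hσ]
    split_ifs <;> simp
  have hgmem : ∀ r, MemLp g r μ :=
    memLp_of_bounded_of_support hK hμK hg.aestronglyMeasurable hB hsupp
  rcases eq_or_ne p ∞ with rfl | hp
  · obtain rfl : q = 1 := (ENNReal.HolderConjugate.eq_top_iff_eq_one ∞ q).1 rfl
    rw [eLpNorm_exponent_top]
    refine eLpNormEssSup_le_of_ae_bound ?_
    -- Testing with the sign of g on the set where |g| exceeds C gives ∫_A (|g| - C) ≤ 0, so A is
    -- null.
    set A := {u | C < |g u|} with hA
    have hAm : MeasurableSet A := measurableSet_lt measurable_const hg.norm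
    have hAK : A ⊆ K := fun u hu => by
      by_contra hu'
      rw [hA, mem_ofPred_eq, hsupp u hu', abs_zero] at hu
      exact absurd hu (not_lt.2 hC)
    have hμA : μ A ≠ ∞ := ((measure_mono hAK).trans_lt hμK.lt_top).ne
    have h1 := h (A.indicator σ) (hσm.indicator hAm)
      (memLp_of_bounded_of_support hAm hμA (hσm.indicator hAm).aestronglyMeasurable (C := 1)
        (fun u => by
          by_cases hu : u ∈ A
          · rw [indicator_of_mem hu, hσ1]
          · rw [indicator_of_notMem hu, abs_zero]
            exact zero_le_one) (fun u hu => indicator_of_notMem hu _) 1)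
    have h2 : ∫ u, g u * A.indicator σ u ∂μ = ∫ u in A, |g u| ∂μ := by
      rw [← integral_indicator hAm]
      congr 1
      ext u
      by_cases hu : u ∈ A <;> simp [hu, hσg]
    have h3 : (eLpNorm (A.indicator σ) 1 μ).toReal = ∫ _ in A, (1 : ℝ) ∂μ := by
      rw [eLpNorm_one_eq_lintegral_enorm, ← integral_norm_eq_lintegral_enorm
        (hσm.indicator hAm).aestronglyMeasurable, ← integral_indicator hAm]
      congr 1
      ext u
      by_cases hu : u ∈ A <;> simp [hu, hσ1]
    rw [h2, h3] at h1
    have hgi : IntegrableOn (fun u => |g u|) A μ :=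
      (memLp_one_iff_integrable.1 (hgmem 1)).abs.integrableOn
    have hci : IntegrableOn (fun _ => C) A μ := integrableOn_const hμA
    have h4 : ∫ u in A, (|g u| - C) ∂μ = 0 := by
      refine le_antisymm ?_ (setIntegral_nonneg hAm fun u hu => sub_nonneg.2 (le_of_lt hu))
      rw [integral_sub hgi hci]
      have : ∫ _ in A, C ∂μ = C * ∫ _ in A, (1 : ℝ) ∂μ := by
        rw [← integral_const_mul]
        simp
      rw [this]
      linarith [le_abs_self (∫ u in A, |g u| ∂μ)]
    rw [setIntegral_eq_zero_iff_of_nonneg_ae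
      ((ae_restrict_mem hAm).mono fun u hu => sub_nonneg.2 (le_of_lt hu)) (hgi.sub hci)] at h4
    filter_upwards [(ae_restrict_iff' hAm).1 h4] with u hu
    by_contra hlt
    have hlt' : u ∈ A := not_le.1 hlt
    have h5 : |g u| - C = 0 := hu hlt'
    have h6 : C < |g u| := hlt'
    linarith
  rcases eq_or_ne q ∞ with rfl | hq
  · obtain rfl : p = 1 := (ENNReal.HolderConjugate.eq_top_iff_eq_one ∞ p).1 rfl
    have hσmem : MemLp σ ∞ μ :=
      memLp_top_of_bound hσm.aestronglyMeasurable 1 (.of_forall fun u => (hσ1 u).le)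
    have h1 := h σ hσm hσmem
    have h2 : (eLpNorm σ ∞ μ).toReal ≤ 1 := by
      refine ENNReal.toReal_le_of_le_ofReal zero_le_one ?_
      rw [eLpNorm_exponent_top]
      exact eLpNormEssSup_le_of_ae_bound (.of_forall fun u => (hσ1 u).le)
    simp only [hσg] at h1
    rw [eLpNorm_one_eq_lintegral_enorm, ← ofReal_integral_norm_eq_lintegral_enorm
      (memLp_one_iff_integrable.1 (hgmem 1))]
    refine ENNReal.ofReal_le_ofReal ?_
    exact (le_abs_self _).trans (h1.trans (mul_le_of_le_one_right hC h2))
  · have hconj := ENNReal.HolderConjugate.toReal_of_ne_top hp hq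
    set P := p.toReal with hP
    set Q := q.toReal with hQ
    have hP1 : 1 < P := hconj.lt
    -- The extremal function in Hölder's inequality: g f = |g|^P = |f|^Q. Boundedness and support in
    -- K make the integral finite, so I^{1/Q} can be divided out.
    set f : α → ℝ := fun u => σ u * |g u| ^ (P - 1) with hf
    have hfm : Measurable f := hσm.mul (hg.norm.pow_const _)
    have hfabs : ∀ u, |f u| = |g u| ^ (P - 1) := fun u => by
      simp only [hf]
      rw [abs_mul, hσ1, one_mul, abs_of_nonneg (by positivity)]
    have hfmem : MemLp f q μ := memLp_of_bounded_of_support hK hμK hfm.aestronglyMeasurable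
      (C := B ^ (P - 1)) (fun u => by
        rw [hfabs]
        exact Real.rpow_le_rpow (abs_nonneg _) (hB u) (by linarith)) (fun u hu => by
        simp only [hf]
        rw [hsupp u hu, abs_zero, Real.zero_rpow (by linarith), mul_zero]) q
    have h1 := h f hfm hfmem
    have hgf : ∀ u, g u * f u = |g u| ^ P := fun u => by
      simp only [hf]
      rw [← mul_assoc, hσg]
      rcases eq_or_ne (|g u|) 0 with h0 | h0
      · rw [h0, Real.zero_rpow (by linarith), zero_mul, Real.zero_rpow (by linarith)]
      · have h0' : 0 < |g u| := lt_of_le_of_ne (abs_nonneg _) h0.symm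
        rw [mul_comm, ← Real.rpow_add_one h0, sub_add_cancel]
    set I := ∫ u, |g u| ^ P ∂μ with hI
    have hI0 : 0 ≤ I := integral_nonneg fun u => by positivity
    have hp0 : p ≠ 0 := ENNReal.HolderConjugate.ne_zero p q
    have hq0 : q ≠ 0 := ENNReal.HolderConjugate.ne_zero q p
    have h2 : eLpNorm g p μ = ENNReal.ofReal (I ^ P⁻¹) :=
      (hgmem p).eLpNorm_eq_integral_rpow_norm hp0 hp
    have h3 : (eLpNorm f q μ).toReal = I ^ Q⁻¹ := by
      rw [hfmem.eLpNorm_eq_integral_rpow_norm hq0 hq, ENNReal.toReal_ofReal (by positivity)]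
      simp only [Real.norm_eq_abs, hfabs, ← hQ]
      congr 2
      ext u
      rw [← Real.rpow_mul (abs_nonneg _), hconj.sub_one_mul_conj]
    simp only [hgf] at h1
    rw [h3, ← hI, abs_of_nonneg hI0] at h1
    rw [h2]
    refine ENNReal.ofReal_le_ofReal ?_
    rcases eq_or_lt_of_le hI0 with h0 | h0
    · rw [← h0, Real.zero_rpow (inv_ne_zero (by linarith))]
      exact hC
    · have h4 : I = I ^ P⁻¹ * I ^ Q⁻¹ := by
        rw [← Real.rpow_add h0, hconj.inv_add_inv_eq_one, Real.rpow_one]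
      exact le_of_mul_le_mul_right (h4.symm.le.trans h1) (by positivity)

/-- An additive set function which is small on sets of small measure has a density. -/
theorem exists_density_of_additive [IsFiniteMeasure μ] (ν : Set α → ℝ)
    (hadd : ∀ A B, MeasurableSet A → MeasurableSet B → Disjoint A B → ν (A ∪ B) = ν A + ν B)
    (hcont : ∀ ε > 0, ∃ δ > 0, ∀ A, MeasurableSet A → μ A ≤ ENNReal.ofReal δ → |ν A| ≤ ε) :
    ∃ h : α → ℝ, Measurable h ∧ Integrable h μ ∧
      ∀ A, MeasurableSet A → ν A = ∫ u in A, h u ∂μ := by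
  classical
  have hempty : ν ∅ = 0 := by
    have := hadd ∅ ∅ .empty .empty (disjoint_empty _)
    rw [empty_union] at this
    linarith
  have hnull : ∀ A, MeasurableSet A → μ A = 0 → ν A = 0 := fun A hA h0 => by
    rw [← abs_eq_zero]
    refine le_antisymm (le_of_forall_pos_le_add fun ε hε => ?_) (abs_nonneg _)
    obtain ⟨δ, -, h⟩ := hcont ε hε
    rw [zero_add]
    exact h A hA (by simp [h0])
  have hsum : ∀ (f : ℕ → Set α) (_ : ∀ i, MeasurableSet (f i))
      (_ : Pairwise (Function.onFun Disjoint f)) (s : Finset ℕ),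
      ν (⋃ i ∈ s, f i) = ∑ i ∈ s, ν (f i) := by
    intro f hf hd s
    induction s using Finset.induction_on with
    | empty => simpa using hempty
    | insert a s ha ih =>
      rw [Finset.set_biUnion_insert, hadd _ _ (hf a) (Finset.measurableSet_biUnion _ fun i _ => hf i),
        ih, Finset.sum_insert ha]
      rw [disjoint_iUnion₂_right]
      exact fun i hi => hd (fun h => ha (h ▸ hi))
  set s : SignedMeasure α :=
    { measureOf' := fun A => if MeasurableSet A then ν A else 0
      empty' := by simp [hempty]
      not_measurable' := fun A hA => if_neg hA
      m_iUnion' := by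
        intro f hf hd
        simp only [hf, if_true, MeasurableSet.iUnion hf]
        rw [HasSum, SummationFilter.unconditional_filter, Metric.tendsto_nhds]
        intro ε hε
        -- The measures of the disjoint sets are summable, so the union of a tail has small measure
        -- and ν is small on it. Finite additivity thereby becomes countable additivity.
        obtain ⟨δ, hδ, hδ'⟩ := hcont (ε / 2) (by positivity)
        have hfin : ∑' i, μ (f i) ≠ ∞ := by
          rw [← measure_iUnion hd hf]
          exact measure_ne_top _ _
        filter_upwards [(ENNReal.tendsto_tsum_compl_atTop_zero hfin).eventually
          (ge_mem_nhds (ENNReal.ofReal_pos.2 hδ))] with t ht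
        have h1 : ⋃ i, f i = (⋃ i ∈ t, f i) ∪ ⋃ i : {i // i ∉ t}, f i := by
          ext u
          simp only [mem_union, mem_iUnion, Subtype.exists, exists_prop]
          constructor
          · rintro ⟨i, hi⟩
            by_cases h : i ∈ t
            · exact Or.inl ⟨i, h, hi⟩
            · exact Or.inr ⟨i, h, hi⟩
          · rintro (⟨i, -, hi⟩ | ⟨i, -, hi⟩) <;> exact ⟨i, hi⟩
        have hm : MeasurableSet (⋃ i : {i // i ∉ t}, f i) := .iUnion fun i => hf i
        have h2 : Disjoint (⋃ i ∈ t, f i) (⋃ i : {i // i ∉ t}, f i) := by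
          rw [disjoint_iUnion₂_left]
          intro i hi
          rw [disjoint_iUnion_right]
          exact fun j => hd fun h => j.2 (h ▸ hi)
        rw [h1, hadd _ _ (Finset.measurableSet_biUnion _ fun i _ => hf i) hm h2, hsum f hf hd t,
          Real.dist_eq, sub_add_cancel_left, abs_neg]
        refine (hδ' _ hm ?_).trans_lt (by linarith)
        exact (measure_iUnion (f := fun i : {i // i ∉ t} => f i)
          (fun i j hij => hd fun h => hij (Subtype.ext h)) fun i => hf i).trans_le ht }
    with hs
  have hsν : ∀ A, MeasurableSet A → s A = ν A := fun A hA => if_pos hA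
  have hac : s ≪ᵥ μ.toENNRealVectorMeasure := by
    refine VectorMeasure.AbsolutelyContinuous.mk fun A hA h0 => ?_
    rw [Measure.toENNRealVectorMeasure_apply_measurable hA] at h0
    rw [hsν A hA, hnull A hA h0]
  rw [SignedMeasure.absolutelyContinuous_iff_withDensityᵥ_rnDeriv_eq] at hac
  refine ⟨s.rnDeriv μ, s.measurable_rnDeriv μ, s.integrable_rnDeriv μ, fun A hA => ?_⟩
  rw [← withDensityᵥ_apply (s.integrable_rnDeriv μ) hA, hac, hsν A hA]

/-- Multiplication by the indicator function of a set, as an operator on `L^p`. -/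
def indicatorCLM (p : ℝ≥0∞) [Fact (1 ≤ p)] (μ : Measure α) {S : Set α} (hS : MeasurableSet S) :
    Lp ℝ p μ →L[ℝ] Lp ℝ p μ :=
  LinearMap.mkContinuous
    { toFun := fun f => ((Lp.memLp f).indicator hS).toLp
      map_add' := fun f g => by
        rw [← MemLp.toLp_add]
        refine MemLp.toLp_congr _ _ ?_
        filter_upwards [Lp.coeFn_add f g] with u hu
        by_cases h : u ∈ S
        · simp only [Pi.add_apply, indicator_of_mem h]
          exact hu
        · simp [h]
      map_smul' := fun c f => by
        rw [RingHom.id_apply, ← MemLp.toLp_const_smul]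
        refine MemLp.toLp_congr _ _ ?_
        filter_upwards [Lp.coeFn_smul c f] with u hu
        by_cases h : u ∈ S
        · simp only [Pi.smul_apply, indicator_of_mem h]
          exact hu
        · simp [h] }
    1 (fun f => by
      rw [one_mul]
      change ‖((Lp.memLp f).indicator hS).toLp‖ ≤ ‖f‖
      rw [Lp.norm_toLp, Lp.norm_def]
      exact ENNReal.toReal_mono (Lp.memLp f).2.ne (eLpNorm_indicator_le _))

theorem indicatorCLM_apply {p : ℝ≥0∞} [Fact (1 ≤ p)] {S : Set α} (hS : MeasurableSet S)
    (f : Lp ℝ p μ) :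
    indicatorCLM p μ hS f = MemLp.toLp (S.indicator f) ((Lp.memLp f).indicator hS) := rfl

theorem coeFn_indicatorCLM {p : ℝ≥0∞} [Fact (1 ≤ p)] {S : Set α} (hS : MeasurableSet S)
    (f : Lp ℝ p μ) : ((indicatorCLM p μ hS f : Lp ℝ p μ) : α → ℝ) =ᵐ[μ] S.indicator f := by
  have key : ∀ (g : Lp ℝ p μ) (F : α → ℝ) (hF : MemLp F p μ), g = MemLp.toLp F hF → g =ᵐ[μ] F := by
    rintro _ F hF rfl
    exact hF.coeFn_toLp
  exact key _ _ _ (indicatorCLM_apply hS f)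

theorem norm_indicatorCLM_le {p : ℝ≥0∞} [Fact (1 ≤ p)] {S : Set α} (hS : MeasurableSet S)
    (f : Lp ℝ p μ) : ‖indicatorCLM p μ hS f‖ ≤ ‖f‖ := by
  have := (indicatorCLM p μ hS).le_of_opNorm_le (LinearMap.mkContinuous_norm_le _ zero_le_one _) f
  rwa [one_mul] at this

/-- The functional on `L^q` given by a function in `L^p`. -/
def pairing {p q : ℝ≥0∞} (hpq : p.HolderConjugate q) [Fact (1 ≤ p)] [Fact (1 ≤ q)] {f : α → ℝ}
    (hf : MemLp f p μ) : Lp ℝ q μ →L[ℝ] ℝ :=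
  haveI := hpq
  (ContinuousLinearMap.mul ℝ ℝ).lpPairing μ p q hf.toLp

theorem pairing_apply {p q : ℝ≥0∞} (hpq : p.HolderConjugate q) [Fact (1 ≤ p)] [Fact (1 ≤ q)]
    {f : α → ℝ} (hf : MemLp f p μ) (g : Lp ℝ q μ) :
    pairing hpq hf g = ∫ u, f u * g u ∂μ := by
  have := hpq
  rw [pairing, ContinuousLinearMap.lpPairing_eq_integral]
  refine integral_congr_ae ?_
  filter_upwards [hf.coeFn_toLp] with u hu
  simp [hu]

/-- Both sides are linear and continuous in f, the right one because h is in L^q. As p < ∞, simple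
functions are dense and indicators suffice. -/
theorem clm_indicatorCLM_eq_integral {p q : ℝ≥0∞} (hpq : p.HolderConjugate q) [Fact (1 ≤ p)]
    (hp : p ≠ ∞) (ℓ : Lp ℝ p μ →L[ℝ] ℝ) {S : Set α} (hS : MeasurableSet S) {h : α → ℝ}
    (hh : MemLp h q μ)
    (hℓ : ∀ (c : ℝ) (A : Set α) (hA : MeasurableSet A) (hμA : μ A ≠ ∞),
      ℓ (indicatorCLM p μ hS (indicatorConstLp p hA hμA c)) = c * ∫ u in A, h u ∂μ)
    (f : Lp ℝ p μ) : ℓ (indicatorCLM p μ hS f) = ∫ u, h u * f u ∂μ := by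
  have : Fact (1 ≤ q) := ⟨ENNReal.HolderConjugate.one_le q p⟩
  rw [← pairing_apply hpq.symm hh]
  refine Lp.induction hp (fun f => ℓ (indicatorCLM p μ hS f) = pairing hpq.symm hh f) ?_ ?_ ?_ f
  · intro c A hA hμA
    rw [Lp.simpleFunc.coe_indicatorConst, hℓ, pairing_apply, ← integral_const_mul,
      ← integral_indicator hA]
    refine integral_congr_ae ?_
    filter_upwards [indicatorConstLp_coeFn (p := p) (hs := hA) (hμs := hμA.ne) (c := c)] with u hu
    rw [hu]
    by_cases hu' : u ∈ A <;> simp [hu', mul_comm]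
  · intro f g hf hg _ h1 h2
    rw [map_add, map_add, map_add, h1, h2]
  · exact isClosed_eq (ℓ.continuous.comp (indicatorCLM p μ hS).continuous)
      (pairing hpq.symm hh).continuous

/-- **Riesz representation**: for `p < ∞`, a continuous functional on `L^p` is given on the
functions which vanish outside a set of finite measure by a function in `L^q`. -/
theorem exists_eq_integral_of_clm {p q : ℝ≥0∞} (hpq : p.HolderConjugate q) [Fact (1 ≤ p)]
    (hp : p ≠ ∞) {K : Set α} (hK : MeasurableSet K) (hμK : μ K ≠ ∞) (ℓ : Lp ℝ p μ →L[ℝ] ℝ) :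
    ∃ h : α → ℝ, MemLp h q μ ∧ ∀ f : Lp ℝ p μ, (∀ᵐ u ∂μ, u ∉ K → f u = 0) →
      ℓ f = ∫ u, h u * f u ∂μ := by
  classical
  have hp0 : p ≠ 0 := ENNReal.HolderConjugate.ne_zero p q
  have hfin : ∀ A, μ (A ∩ K) ≠ ∞ := fun A =>
    ((measure_mono inter_subset_right).trans_lt hμK.lt_top).ne
  have : IsFiniteMeasure (μ.restrict K) := ⟨by simpa using hμK.lt_top⟩
  set ν : Set α → ℝ := fun A =>
    if hA : MeasurableSet A then ℓ (indicatorConstLp p (hA.inter hK) (hfin A) 1) else 0 with hν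
  have hνA : ∀ A (hA : MeasurableSet A),
      ν A = ℓ (indicatorConstLp p (hA.inter hK) (hfin A) 1) := fun A hA => dif_pos hA
  obtain ⟨h₀, hm₀, hi₀, hν₀⟩ := exists_density_of_additive (μ := μ.restrict K) ν
    (fun A B hA hB hAB => by
      rw [hνA A hA, hνA B hB, hνA _ (hA.union hB), ← map_add, ← indicatorConstLp_disjoint_union
        _ _ _ _ (hAB.mono inter_subset_left inter_subset_left)]
      congr 2
      exact union_inter_distrib_right A B K)
    (fun ε hε => by
      have hP : 0 < 1 / p.toReal := one_div_pos.2 (ENNReal.toReal_pos hp0 hp)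
      -- The norm of an indicator in L^p is the measure of the set to the power 1/p.
      set δ := (ε / (‖ℓ‖ + 1)) ^ p.toReal with hδ
      have hδ0 : 0 < δ := by positivity
      refine ⟨δ, hδ0, fun A hA hμA => ?_⟩
      rw [hνA A hA]
      refine (ℓ.le_opNorm _).trans ?_
      rw [norm_indicatorConstLp hp0 hp, norm_one, one_mul]
      rw [Measure.restrict_apply hA] at hμA
      have h1 : μ.real (A ∩ K) ≤ δ := ENNReal.toReal_le_of_le_ofReal hδ0.le hμA
      have h2 : μ.real (A ∩ K) ^ (1 / p.toReal) ≤ ε / (‖ℓ‖ + 1) := by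
        refine (Real.rpow_le_rpow measureReal_nonneg h1 hP.le).trans_eq ?_
        rw [hδ, ← Real.rpow_mul (by positivity), mul_one_div_cancel
          (ENNReal.toReal_pos hp0 hp).ne', Real.rpow_one]
      calc ‖ℓ‖ * μ.real (A ∩ K) ^ (1 / p.toReal) ≤ (‖ℓ‖ + 1) * (ε / (‖ℓ‖ + 1)) := by
            refine mul_le_mul (by linarith) h2 (by positivity) (by positivity)
        _ = ε := by field_simp)
  -- The auxiliary set B serves twice: the level sets of h₀ for the norm bound, and the whole space
  -- for the final representation.
  have key : ∀ B (hB : MeasurableSet B) (c : ℝ) (A : Set α) (hA : MeasurableSet A) (hμA : μ A ≠ ∞),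
      ℓ (indicatorCLM p μ (hB.inter hK) (indicatorConstLp p hA hμA c)) =
        c * ∫ u in A, (B ∩ K).indicator h₀ u ∂μ := by
    intro B hB c A hA hμA
    have h1 : indicatorCLM p μ (hB.inter hK) (indicatorConstLp p hA hμA c) =
        c • indicatorConstLp p ((hA.inter hB).inter hK) (hfin _) 1 := by
      refine Lp.ext ?_
      filter_upwards [coeFn_indicatorCLM (hB.inter hK) (indicatorConstLp p hA hμA c),
        indicatorConstLp_coeFn (p := p) (hs := hA) (hμs := hμA) (c := c),
        Lp.coeFn_smul c (indicatorConstLp p ((hA.inter hB).inter hK) (hfin _) (1 : ℝ)),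
        indicatorConstLp_coeFn (p := p) (hs := (hA.inter hB).inter hK) (hμs := hfin _)
          (c := (1 : ℝ))] with u h1 h2 h3 h4
      rw [h1, h3, Pi.smul_apply, h4]
      by_cases hu1 : u ∈ A <;> by_cases hu2 : u ∈ B <;> by_cases hu3 : u ∈ K <;>
        simp [hu1, hu2, hu3, h2]
    rw [h1, map_smul, smul_eq_mul, ← hνA _ (hA.inter hB), hν₀ _ (hA.inter hB),
      setIntegral_indicator (hB.inter hK), Measure.restrict_restrict (hA.inter hB), inter_assoc]
  -- The density h₀ is so far only integrable. Its truncations represent restrictions of ℓ and so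
  -- have L^q norm at most ‖ℓ‖; Fatou's lemma transfers the bound to h₀.
  set S : ℕ → Set α := fun k => {u | |h₀ u| ≤ k} with hS
  have hSm : ∀ k, MeasurableSet (S k) := fun k => measurableSet_le hm₀.norm measurable_const
  set hk : ℕ → α → ℝ := fun k => (S k ∩ K).indicator h₀ with hhk
  have hkm : ∀ k, Measurable (hk k) := fun k => hm₀.indicator ((hSm k).inter hK)
  have hkb : ∀ k u, |hk k u| ≤ k := fun k u => by
    simp only [hhk]
    by_cases hu : u ∈ S k ∩ K
    · rw [indicator_of_mem hu]
      exact hu.1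
    · rw [indicator_of_notMem hu, abs_zero]
      exact Nat.cast_nonneg k
  have hks : ∀ k u, u ∉ K → hk k u = 0 := fun k u hu => indicator_of_notMem (fun h => hu h.2) _
  have hkn : ∀ k, eLpNorm (hk k) q μ ≤ ENNReal.ofReal ‖ℓ‖ := fun k => by
    refine eLpNorm_le_of_forall_abs_integral_mul_le hpq.symm hK hμK (hkm k) (hkb k) (hks k)
      (norm_nonneg ℓ) fun f hf hfp => ?_
    have h1 := clm_indicatorCLM_eq_integral hpq hp ℓ ((hSm k).inter hK)
      (memLp_of_bounded_of_support hK hμK (hkm k).aestronglyMeasurable (hkb k) (hks k) q)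
      (key (S k) (hSm k)) (MemLp.toLp f hfp)
    have h2 : ∫ u, hk k u * MemLp.toLp f hfp u ∂μ = ∫ u, hk k u * f u ∂μ :=
      integral_congr_ae (hfp.coeFn_toLp.mono fun u hu => by simp only [hu])
    rw [← h2, ← h1, ← Lp.norm_toLp f hfp]
    exact (ℓ.le_opNorm _).trans
      (mul_le_mul_of_nonneg_left (norm_indicatorCLM_le _ _) (norm_nonneg ℓ))
  have hlim : ∀ u, Tendsto (fun k => hk k u) atTop (𝓝 (K.indicator h₀ u)) := fun u => by
    obtain ⟨N, hN⟩ := exists_nat_ge |h₀ u|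
    refine tendsto_const_nhds.congr' ?_
    filter_upwards [eventually_ge_atTop N] with k hNk
    have : u ∈ S k := hN.trans (by exact_mod_cast hNk)
    simp only [hhk]
    by_cases hu : u ∈ K <;> simp [hu, this]
  have hmem : MemLp (K.indicator h₀) q μ := by
    refine ⟨(hm₀.indicator hK).aestronglyMeasurable, ?_⟩
    refine (Lp.eLpNorm_lim_le_liminf_eLpNorm (fun k => (hkm k).aestronglyMeasurable) _
      (.of_forall hlim)).trans_lt ?_
    refine (liminf_le_of_frequently_le' (.of_forall hkn)).trans_lt ENNReal.ofReal_lt_top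
  refine ⟨K.indicator h₀, hmem, fun f hf => ?_⟩
  have h1 := clm_indicatorCLM_eq_integral hpq hp ℓ (MeasurableSet.univ.inter hK) hmem
    (fun c A hA hμA => by
      rw [key univ .univ c A hA hμA]
      simp only [univ_inter]) f
  rw [← h1]
  congr 1
  refine Lp.ext ?_
  filter_upwards [coeFn_indicatorCLM (MeasurableSet.univ.inter hK) f, hf] with u hu1 hu2
  rw [hu1]
  by_cases hu : u ∈ K
  · simp [hu]
  · simp [hu, hu2 hu]

end Duality

/-! ### Weakly convergent sequences of functions -/

section WeakConvergence

variable {α : Type*} [MeasurableSpace α] {μ : Measure α}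

theorem exists_forall_abs_sub_le {a : ℕ → ℝ} {l : ℝ} (h : Tendsto a atTop (𝓝 l)) {ε : ℝ}
    (hε : 0 < ε) : ∃ N, ∀ n ≥ N, ∀ m ≥ N, |a n - a m| ≤ ε := by
  obtain ⟨N, hN⟩ := Metric.cauchySeq_iff.1 h.cauchySeq ε hε
  exact ⟨N, fun n hn m hm => (hN n hn m hm).le⟩

/-- **Vitali–Hahn–Saks** for nonnegative densities: if the integrals against all measurable
functions between `0` and `1_K` converge, then the functions are uniformly integrable on `K`. -/
theorem exists_forall_setIntegral_le {K : Set α} (hK : MeasurableSet K) (hμK : μ K ≠ ∞)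
    {F : ℕ → α → ℝ} (hF : ∀ n, Measurable (F n)) (hF0 : ∀ n u, 0 ≤ F n u)
    (hFb : ∀ n, ∃ C, ∀ u, F n u ≤ C)
    (hconv : ∀ h : α → ℝ, Measurable h → (∀ u, 0 ≤ h u) → (∀ u, h u ≤ K.indicator 1 u) →
      ∃ l, Tendsto (fun n => ∫ u, F n u * h u ∂μ) atTop (𝓝 l)) {ε : ℝ} (hε : 0 < ε) :
    ∃ δ > 0, ∀ n A, MeasurableSet A → A ⊆ K → μ A ≤ ENNReal.ofReal δ →
      ∫ u in A, F n u ∂μ ≤ ε := by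
  choose C hC using hFb
  have hFtop : ∀ n, MemLp (F n) ∞ μ := fun n =>
    memLp_top_of_bound (hF n).aestronglyMeasurable (C n)
      (.of_forall fun u => by rw [Real.norm_eq_abs, abs_of_nonneg (hF0 n u)]; exact hC n u)
  have hconj : (∞ : ℝ≥0∞).HolderConjugate 1 := inferInstance
  have : Fact ((1 : ℝ≥0∞) ≤ ∞) := ⟨le_top⟩
  set Λ : ℕ → Lp ℝ 1 μ →L[ℝ] ℝ := fun n => pairing hconj (hFtop n) with hΛ
  have hΛA : ∀ n A (hA : MeasurableSet A) (hμA : μ A ≠ ∞),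
      Λ n (indicatorConstLp 1 hA hμA 1) = ∫ u in A, F n u ∂μ := by
    intro n A hA hμA
    rw [hΛ, pairing_apply, ← integral_indicator hA]
    refine integral_congr_ae ?_
    filter_upwards [indicatorConstLp_coeFn (p := 1) (hs := hA) (hμs := hμA) (c := (1 : ℝ))]
      with u hu
    rw [hu]
    by_cases h : u ∈ A <;> simp [h]
  -- Baire's theorem is applied in the order interval [0, 1_K] of L¹, a complete metric space in
  -- which the distance between indicators is the measure of the symmetric difference.
  set X : Set (Lp ℝ 1 μ) := Icc 0 (indicatorConstLp 1 hK hμK 1) with hX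
  have hXc : IsClosed X := isClosed_Icc
  have : CompleteSpace X := hXc.completeSpace_coe
  have hXmem : ∀ f : Lp ℝ 1 μ, f ∈ X ↔ ∀ᵐ u ∂μ, 0 ≤ f u ∧ f u ≤ K.indicator 1 u := by
    intro f
    have h1 : (indicatorConstLp 1 hK hμK (1 : ℝ) : Lp ℝ 1 μ) =ᵐ[μ] K.indicator 1 :=
      indicatorConstLp_coeFn
    rw [hX, mem_Icc, ← Lp.coeFn_nonneg, ← Lp.coeFn_le, eventually_and]
    refine and_congr Iff.rfl ⟨fun h => ?_, fun h => ?_⟩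
    · filter_upwards [h, h1] with u h2 h3
      rwa [← h3]
    · filter_upwards [h, h1] with u h2 h3
      rwa [h3]
  have : Nonempty X := ⟨⟨0, (hXmem 0).2 (by
    filter_upwards [Lp.coeFn_zero ℝ 1 μ] with u hu
    rw [hu]
    exact ⟨le_rfl, indicator_nonneg (fun _ _ => zero_le_one) u⟩)⟩⟩
  have hη : 0 < ε / 3 := by positivity
  -- By convergence, these closed sets of functions on which the integrals are Cauchy from N on
  -- cover X, so one of them contains a ball.
  set E : ℕ → Set X := fun N => {f | ∀ n ≥ N, ∀ m ≥ N, |Λ n f - Λ m f| ≤ ε / 3} with hE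
  have hEc : ∀ N, IsClosed (E N) := fun N => by
    simp only [hE, ofPred_forall]
    refine isClosed_iInter fun n => isClosed_iInter fun _ => isClosed_iInter fun m =>
      isClosed_iInter fun _ => isClosed_le ?_ continuous_const
    exact ((((Λ n).continuous.comp continuous_subtype_val).sub
      ((Λ m).continuous.comp continuous_subtype_val))).abs
  have hEu : ⋃ N, E N = univ := by
    refine eq_univ_of_forall fun f => mem_iUnion.2 ?_
    have hf := (hXmem f).1 f.2
    obtain ⟨l, hl⟩ := hconv (fun u => max 0 (min ((f : Lp ℝ 1 μ) u) (K.indicator 1 u)))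
      (measurable_const.max ((Lp.stronglyMeasurable _).measurable.min
        (measurable_one.indicator hK))) (fun u => le_max_left _ _)
      (fun u => max_le (indicator_nonneg (fun _ _ => zero_le_one) u) (min_le_right _ _))
    have h1 : ∀ n, Λ n f = ∫ u, F n u * max 0 (min ((f : Lp ℝ 1 μ) u) (K.indicator 1 u)) ∂μ := by
      intro n
      rw [hΛ, pairing_apply]
      refine integral_congr_ae ?_
      filter_upwards [hf] with u hu
      rw [min_eq_left hu.2, max_eq_right hu.1]
    obtain ⟨N, hN⟩ := exists_forall_abs_sub_le hl hη
    refine ⟨N, fun n hn m hm => ?_⟩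
    rw [h1, h1]
    exact hN n hn m hm
  obtain ⟨N, f₀, hf₀⟩ := nonempty_interior_of_iUnion_of_closed hEc hEu
  obtain ⟨r, hr, hball⟩ := Metric.mem_nhds_iff.1 (mem_interior_iff_mem_nhds.1 hf₀)
  have hf₀X := (hXmem f₀).1 f₀.2
  -- For a small set A, resetting the centre f₀ of the ball on A to 0 or to 1 stays in the ball. The
  -- difference of the two functions is 1_A, so the Cauchy estimate holds for 1_A with twice the
  -- error.
  have hcauchy : ∀ A, MeasurableSet A → A ⊆ K → μ A < ENNReal.ofReal r → ∀ n ≥ N, ∀ m ≥ N,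
      |(∫ u in A, F n u ∂μ) - ∫ u in A, F m u ∂μ| ≤ 2 * (ε / 3) := by
    intro A hA hAK hμA n hn m hm
    have hAfin : μ A ≠ ∞ := (hμA.trans ENNReal.ofReal_lt_top).ne
    have hAr : μ.real A < r := by
      rw [measureReal_def]
      exact (ENNReal.lt_ofReal_iff_toReal_lt hAfin).1 hμA
    set e : Lp ℝ 1 μ := indicatorConstLp 1 hA hAfin 1 with he
    have hec : e =ᵐ[μ] A.indicator 1 := indicatorConstLp_coeFn
    set f₂ : Lp ℝ 1 μ := indicatorCLM 1 μ hA.compl f₀ with hf₂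
    have hf₂c : f₂ =ᵐ[μ] Aᶜ.indicator (f₀ : Lp ℝ 1 μ) := coeFn_indicatorCLM hA.compl _
    have hsum := Lp.coeFn_add f₂ e
    have hnorm : ‖e‖ < r := by
      rw [he, norm_indicatorConstLp one_ne_zero ENNReal.one_ne_top]
      simpa using hAr
    have hmem : ∀ f : Lp ℝ 1 μ, (∀ᵐ u ∂μ, u ∈ A → 0 ≤ f u ∧ f u ≤ 1) →
        (∀ᵐ u ∂μ, u ∉ A → f u = (f₀ : Lp ℝ 1 μ) u) →
        |Λ n f - Λ m f| ≤ ε / 3 := by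
      intro f h1 h2
      have hfX : f ∈ X := (hXmem f).2 (by
        filter_upwards [h1, h2, hf₀X] with u h1 h2 h3
        by_cases hu : u ∈ A
        · rw [indicator_of_mem (hAK hu)]
          exact h1 hu
        · rw [h2 hu]
          exact h3)
      have hfE : (⟨f, hfX⟩ : X) ∈ E N := by
        refine hball ?_
        rw [Metric.mem_ball, Subtype.dist_eq, dist_eq_norm]
        refine lt_of_le_of_lt (Lp.norm_le_norm_of_ae_le ?_) hnorm
        filter_upwards [h1, h2, hf₀X, Lp.coeFn_sub f f₀, hec] with u h1 h2 h3 h4 h5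
        rw [h4, h5, Pi.sub_apply]
        by_cases hu : u ∈ A
        · have h6 := h1 hu
          rw [indicator_of_mem (hAK hu)] at h3
          rw [indicator_of_mem hu, Pi.one_apply, norm_one, Real.norm_eq_abs, abs_le]
          have h7 : (f₀ : Lp ℝ 1 μ) u ≤ 1 := h3.2
          constructor <;> linarith
        · rw [h2 hu]
          simp [hu]
      exact hfE n hn m hm
    have h1 := hmem f₂ (by
      filter_upwards [hf₂c] with u h hu
      rw [h, indicator_of_notMem (by simpa using hu)]
      exact ⟨le_rfl, zero_le_one⟩) (by
      filter_upwards [hf₂c] with u h hu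
      rw [h, indicator_of_mem (by simpa using hu)])
    have h2 := hmem (f₂ + e) (by
      filter_upwards [hf₂c, hsum, hec] with u h h' h'' hu
      rw [h', Pi.add_apply, h, h'', indicator_of_notMem (by simpa using hu), indicator_of_mem hu]
      simp) (by
      filter_upwards [hf₂c, hsum, hec] with u h h' h'' hu
      rw [h', Pi.add_apply, h, h'', indicator_of_mem (by simpa using hu), indicator_of_notMem hu,
        add_zero])
    rw [map_add, map_add] at h2
    rw [← hΛA n A hA hAfin, ← hΛA m A hA hAfin]
    rw [abs_le] at h1 h2 ⊢
    constructor <;> linarith [h1.1, h1.2, h2.1, h2.2]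
  -- The functions up to index N are bounded and are handled directly; later ones are compared with
  -- the N-th.
  set D := ∑ n ∈ Finset.range (N + 1), |C n| with hD
  have hD0 : 0 ≤ D := Finset.sum_nonneg fun _ _ => abs_nonneg _
  refine ⟨min (r / 2) (ε / 3 / (D + 1)), by positivity, fun n A hA hAK hμA => ?_⟩
  have hAfin : μ A ≠ ∞ := (hμA.trans_lt ENNReal.ofReal_lt_top).ne
  have hAreal : μ.real A ≤ ε / 3 / (D + 1) :=
    (ENNReal.toReal_le_of_le_ofReal (by positivity) hμA).trans (min_le_right _ _)
  have hsmall : ∀ n ≤ N, ∫ u in A, F n u ∂μ ≤ ε / 3 := by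
    intro n hn
    have h1 : ∫ u in A, F n u ∂μ ≤ ∫ _ in A, |C n| ∂μ := by
      refine integral_mono_of_nonneg (.of_forall (hF0 n)) (integrableOn_const hAfin)
        (.of_forall fun u => (hC n u).trans (le_abs_self _))
    rw [setIntegral_const, smul_eq_mul] at h1
    have h2 : |C n| ≤ D := Finset.single_le_sum (f := fun n => |C n|) (fun _ _ => abs_nonneg _)
      (Finset.mem_range.2 (by omega))
    calc ∫ u in A, F n u ∂μ ≤ μ.real A * |C n| := h1
      _ ≤ ε / 3 / (D + 1) * (D + 1) :=
        mul_le_mul hAreal (by linarith) (abs_nonneg _) (by positivity)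
      _ = ε / 3 := by field_simp
  rcases le_total n N with hn | hn
  · exact (hsmall n hn).trans (by linarith)
  · have h1 := hcauchy A hA hAK (hμA.trans_lt (ENNReal.ofReal_lt_ofReal_iff hr |>.2
      ((min_le_left _ _).trans_lt (by linarith)))) n hn N le_rfl
    linarith [hsmall N le_rfl, (abs_le.1 h1).2]

/-- Rounding h down to multiples of ε takes finitely many values because h is bounded. -/
theorem exists_simpleFunc_abs_sub_le {h : α → ℝ} (hh : Measurable h) {C : ℝ} (hC : ∀ u, |h u| ≤ C)
    {ε : ℝ} (hε : 0 < ε) : ∃ s : SimpleFunc α ℝ, ∀ u, |h u - s u| ≤ ε := by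
  refine ⟨⟨fun u => ε * (⌊h u / ε⌋ : ℤ), fun c => ?_, ?_⟩, fun u => ?_⟩
  · exact (measurable_const.mul
      (measurable_from_top.comp ((hh.div_const ε).floor))) (measurableSet_singleton c)
  · refine ((finite_Icc ⌊-C / ε⌋ ⌊C / ε⌋).image fun k : ℤ => ε * (k : ℝ)).subset ?_
    rintro _ ⟨u, rfl⟩
    refine ⟨⌊h u / ε⌋, ⟨Int.floor_mono ?_, Int.floor_mono ?_⟩, rfl⟩
    · exact div_le_div_of_nonneg_right (abs_le.1 (hC u)).1 hε.le
    · exact div_le_div_of_nonneg_right (abs_le.1 (hC u)).2 hε.le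
  · change |h u - ε * (⌊h u / ε⌋ : ℤ)| ≤ ε
    have h1 := Int.floor_le (h u / ε)
    have h2 := (Int.lt_floor_add_one (h u / ε)).le
    rw [le_div_iff₀ hε] at h1
    rw [div_le_iff₀ hε] at h2
    rw [abs_le]
    constructor <;> linarith

theorem ae_abs_le_eLpNorm_top {h : α → ℝ} (hh : MemLp h ∞ μ) :
    ∀ᵐ u ∂μ, |h u| ≤ (eLpNorm h ∞ μ).toReal := by
  filter_upwards [ae_le_eLpNormEssSup (f := h) (μ := μ)] with u hu
  rw [← eLpNorm_exponent_top] at hu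
  have h1 := ENNReal.toReal_mono hh.2.ne hu
  rwa [toReal_enorm] at h1

/-- Convergence of the integrals over all measurable sets implies convergence of the integrals
against all bounded functions. -/
theorem tendsto_integral_mul_of_tendsto_setIntegral {F : ℕ → α → ℝ} {L : α → ℝ}
    (hF : ∀ n, Integrable (F n) μ) (hL : Integrable L μ) {B : ℝ} (hB : ∀ n, ∫ u, |F n u| ∂μ ≤ B)
    (hconv : ∀ A, MeasurableSet A →
      Tendsto (fun n => ∫ u in A, F n u ∂μ) atTop (𝓝 (∫ u in A, L u ∂μ)))
    {h : α → ℝ} (hh : MemLp h ∞ μ) :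
    Tendsto (fun n => ∫ u, F n u * h u ∂μ) atTop (𝓝 (∫ u, L u * h u ∂μ)) := by
  set C := (eLpNorm h ∞ μ).toReal with hCdef
  have hC := ae_abs_le_eLpNorm_top hh
  -- A version of h that is measurable and bounded by C everywhere.
  set h' : α → ℝ := fun u => max (-C) (min C (hh.1.mk h u)) with hh'
  have hC0 : 0 ≤ C := ENNReal.toReal_nonneg
  have hm : Measurable h' :=
    measurable_const.max (measurable_const.min hh.1.stronglyMeasurable_mk.measurable)
  have hb : ∀ u, |h' u| ≤ C := fun u =>
    abs_le.2 ⟨le_max_left _ _, max_le (by linarith) (min_le_left _ _)⟩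
  have hae : h =ᵐ[μ] h' := by
    filter_upwards [hh.1.ae_eq_mk, hC] with u h1 h2
    simp only [hh']
    rw [← h1, min_eq_right (abs_le.1 h2).2, max_eq_right (abs_le.1 h2).1]
  have hcongr : ∀ f : α → ℝ, ∫ u, f u * h u ∂μ = ∫ u, f u * h' u ∂μ := fun f =>
    integral_congr_ae (hae.mono fun u hu => by simp only [hu])
  simp only [hcongr]
  have hmulb : ∀ (f : α → ℝ) (s : SimpleFunc α ℝ), Integrable f μ →
      Integrable (fun u => f u * s u) μ := fun f s hf => by
    obtain ⟨c, hc⟩ := s.exists_forall_norm_le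
    exact hf.mul_bdd s.aestronglyMeasurable (.of_forall hc)
  have hmulh : ∀ f : α → ℝ, Integrable f μ → Integrable (fun u => f u * h' u) μ := fun f hf =>
    hf.mul_bdd hm.aestronglyMeasurable (.of_forall hb)
  have hsimple : ∀ s : SimpleFunc α ℝ,
      Tendsto (fun n => ∫ u, F n u * s u ∂μ) atTop (𝓝 (∫ u, L u * s u ∂μ)) := by
    intro s
    induction s using SimpleFunc.induction with
    | @const c A hA =>
      have h1 : ∀ f : α → ℝ, ∫ u, f u * (SimpleFunc.piecewise A hA (SimpleFunc.const α c)
          (SimpleFunc.const α 0)) u ∂μ = (∫ u in A, f u ∂μ) * c := fun f => by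
        rw [← integral_indicator hA, ← integral_mul_const]
        congr 1
        ext u
        by_cases hu : u ∈ A <;> simp [hu]
      have h2 := ((hconv A hA).mul_const c).congr fun n => (h1 (F n)).symm
      rw [← h1 L] at h2
      exact h2
    | @add f g _ hf hg =>
      have h1 : ∀ k : α → ℝ, Integrable k μ → (∫ u, k u * f u ∂μ) + ∫ u, k u * g u ∂μ =
          ∫ u, k u * (f + g) u ∂μ := fun k hk => by
        rw [← integral_add (hmulb _ _ hk) (hmulb _ _ hk)]
        simp [mul_add]
      have h2 := (hf.add hg).congr fun n => h1 (F n) (hF n)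
      rw [h1 L hL] at h2
      exact h2
  rw [Metric.tendsto_nhds]
  intro ε hε
  set B' := |B| + ∫ u, |L u| ∂μ with hB'
  have hL0 : 0 ≤ ∫ u, |L u| ∂μ := integral_nonneg fun u => abs_nonneg _
  have hB'0 : 0 ≤ B' := by positivity
  set η := ε / (3 * (B' + 1)) with hη
  have hη0 : 0 < η := by positivity
  have hηB : η * B' ≤ ε / 3 := by
    have : η * (B' + 1) = ε / 3 := by
      rw [hη]
      field_simp
    nlinarith
  obtain ⟨s, hs⟩ := exists_simpleFunc_abs_sub_le hm hb hη0
  have hdiff : ∀ f : α → ℝ, Integrable f μ → ∫ u, |f u| ∂μ ≤ B' →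
      |(∫ u, f u * h' u ∂μ) - ∫ u, f u * s u ∂μ| ≤ ε / 3 := by
    intro f hf hfB
    rw [← integral_sub (hmulh f hf) (hmulb f s hf)]
    refine abs_integral_le_integral_abs.trans ?_
    refine (integral_mono_of_nonneg (.of_forall fun u => abs_nonneg _) (hf.abs.const_mul η)
      (.of_forall fun u => ?_)).trans ?_
    · change |f u * h' u - f u * s u| ≤ η * |f u|
      rw [← mul_sub, abs_mul, mul_comm]
      exact mul_le_mul_of_nonneg_right (hs u) (abs_nonneg _)
    · rw [integral_const_mul]
      exact (mul_le_mul_of_nonneg_left hfB hη0.le).trans hηB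
  filter_upwards [(hsimple s).eventually (Metric.ball_mem_nhds _ (by positivity : 0 < ε / 3))]
    with n hn
  have h1 := hdiff (F n) (hF n) ((hB n).trans ((le_abs_self B).trans (by linarith)))
  have h2 := hdiff L hL (by linarith [abs_nonneg B])
  rw [Real.dist_eq] at hn ⊢
  rw [abs_le] at h1 h2
  rw [abs_lt] at hn ⊢
  constructor <;> linarith [h1.1, h1.2, h2.1, h2.2, hn.1, hn.2]

variable {p q : ℝ≥0∞} {K : Set α} {F : ℕ → α → ℝ}

/-- A sequence of functions whose integrals against all functions in `L^q` converge is bounded in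
`L^p`. -/
theorem exists_eLpNorm_le_of_tendsto (hpq : p.HolderConjugate q) (hK : MeasurableSet K)
    (hμK : μ K ≠ ∞) (hF : ∀ n, Measurable (F n)) (hFb : ∀ n, ∃ C, ∀ u, |F n u| ≤ C)
    (hFK : ∀ n u, u ∉ K → F n u = 0)
    (hconv : ∀ h : α → ℝ, MemLp h q μ → ∃ l, Tendsto (fun n => ∫ u, F n u * h u ∂μ) atTop (𝓝 l)) :
    ∃ C : ℝ≥0, ∀ n, eLpNorm (F n) p μ ≤ C := by
  have : Fact (1 ≤ p) := ⟨ENNReal.HolderConjugate.one_le p q⟩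
  have : Fact (1 ≤ q) := ⟨ENNReal.HolderConjugate.one_le q p⟩
  choose C hC using hFb
  have hFp : ∀ n, MemLp (F n) p μ := fun n =>
    memLp_of_bounded_of_support hK hμK (hF n).aestronglyMeasurable (hC n) (hFK n) p
  obtain ⟨B, hB⟩ := banach_steinhaus (g := fun n => pairing hpq (hFp n)) fun h => by
    obtain ⟨l, hl⟩ := hconv h (Lp.memLp h)
    obtain ⟨b, hb⟩ := hl.norm.bddAbove_range
    refine ⟨b, fun n => ?_⟩
    rw [pairing_apply]
    exact hb ⟨n, rfl⟩
  have hB0 : 0 ≤ B := (norm_nonneg _).trans (hB 0)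
  refine ⟨B.toNNReal, fun n => ?_⟩
  refine eLpNorm_le_of_forall_abs_integral_mul_le hpq hK hμK (hF n) (hC n) (hFK n) hB0
    fun f hf hfq => ?_
  have h1 := ((pairing hpq (hFp n)).le_of_opNorm_le (hB n) (MemLp.toLp f hfq))
  rw [pairing_apply, Lp.norm_toLp] at h1
  have h2 : ∫ u, F n u * f u ∂μ = ∫ u, F n u * MemLp.toLp f hfq u ∂μ :=
    integral_congr_ae (hfq.coeFn_toLp.mono fun u hu => by simp only [hu])
  rw [h2]
  exact h1

/-- A sequence of nonnegative functions whose integrals against all functions in `L^q` converge has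
a weak limit in `L^p`. -/
theorem exists_weak_limit (hpq : p.HolderConjugate q) (hK : MeasurableSet K)
    (hμK : μ K ≠ ∞) (hF : ∀ n, Measurable (F n)) (hF0 : ∀ n u, 0 ≤ F n u)
    (hFb : ∀ n, ∃ C, ∀ u, |F n u| ≤ C) (hFK : ∀ n u, u ∉ K → F n u = 0)
    (hconv : ∀ h : α → ℝ, MemLp h q μ → ∃ l, Tendsto (fun n => ∫ u, F n u * h u ∂μ) atTop (𝓝 l)) :
    ∃ L : α → ℝ, MemLp L p μ ∧ ∀ h : α → ℝ, MemLp h q μ →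
      Tendsto (fun n => ∫ u, F n u * h u ∂μ) atTop (𝓝 (∫ u, L u * h u ∂μ)) := by
  have : Fact (1 ≤ p) := ⟨ENNReal.HolderConjugate.one_le p q⟩
  have : Fact (1 ≤ q) := ⟨ENNReal.HolderConjugate.one_le q p⟩
  obtain ⟨B, hB⟩ := exists_eLpNorm_le_of_tendsto hpq hK hμK hF hFb hFK hconv
  choose C hC using hFb
  have hFp : ∀ n r, MemLp (F n) r μ := fun n r =>
    memLp_of_bounded_of_support hK hμK (hF n).aestronglyMeasurable (hC n) (hFK n) r
  rcases eq_or_ne q ∞ with rfl | hq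
  -- L¹ is not the dual of L^∞, so Riesz representation is not available. Instead the limits of the
  -- integrals over sets form an additive set function, which Vitali–Hahn–Saks makes absolutely
  -- continuous and which therefore has a density.
  · obtain rfl : p = 1 := (ENNReal.HolderConjugate.eq_top_iff_eq_one ∞ p).1 rfl
    have : IsFiniteMeasure (μ.restrict K) := ⟨by simpa using hμK.lt_top⟩
    have hFi : ∀ n, Integrable (F n) μ := fun n => memLp_one_iff_integrable.1 (hFp n 1)
    have hconvA : ∀ A, MeasurableSet A →
        ∃ l, Tendsto (fun n => ∫ u in A, F n u ∂μ) atTop (𝓝 l) := by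
      intro A hA
      obtain ⟨l, hl⟩ := hconv (A.indicator 1) (memLp_top_of_bound
        (measurable_one.indicator hA).aestronglyMeasurable 1 (.of_forall fun u => by
          by_cases hu : u ∈ A <;> simp [hu]))
      refine ⟨l, hl.congr fun n => ?_⟩
      rw [← integral_indicator hA]
      congr 1
      ext u
      by_cases hu : u ∈ A <;> simp [hu]
    choose! ν hν using hconvA
    have hsetK : ∀ n A, MeasurableSet A → ∫ u in A, F n u ∂μ = ∫ u in A ∩ K, F n u ∂μ := by
      intro n A hA
      have : K.indicator (F n) = F n := indicator_eq_self.2 fun u hu => by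
        by_contra h
        exact hu (hFK n u h)
      rw [← setIntegral_indicator hK, this]
    obtain ⟨h₀, hm₀, hi₀, hν₀⟩ := exists_density_of_additive (μ := μ.restrict K) ν
      (fun A A' hA hA' hd => by
        refine tendsto_nhds_unique (hν _ (hA.union hA')) (((hν A hA).add (hν A' hA')).congr
          fun n => ?_)
        rw [setIntegral_union hd hA' (hFi n).integrableOn (hFi n).integrableOn])
      (fun ε hε => by
        obtain ⟨δ, hδ, h⟩ := exists_forall_setIntegral_le hK hμK hF hF0
          (fun n => ⟨C n, fun u => (le_abs_self _).trans (hC n u)⟩)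
          (fun h hm h0 h1 => hconv h (memLp_top_of_bound hm.aestronglyMeasurable 1
            (.of_forall fun u => by
              rw [Real.norm_eq_abs, abs_of_nonneg (h0 u)]
              refine (h1 u).trans ?_
              by_cases hu : u ∈ K <;> simp [hu]))) hε
        refine ⟨δ, hδ, fun A hA hμA => ?_⟩
        rw [Measure.restrict_apply hA] at hμA
        refine abs_le.2 ⟨?_, ?_⟩
        · exact (neg_nonpos.2 hε.le).trans (ge_of_tendsto' (hν A hA) fun n =>
            setIntegral_nonneg hA fun u _ => hF0 n u)
        · refine le_of_tendsto' (hν A hA) fun n => ?_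
          rw [hsetK n A hA]
          exact h n _ (hA.inter hK) inter_subset_right hμA)
    have hLi : Integrable (K.indicator h₀) μ := (integrable_indicator_iff hK).2 hi₀
    refine ⟨K.indicator h₀, memLp_one_iff_integrable.2 hLi, fun h hh => ?_⟩
    refine tendsto_integral_mul_of_tendsto_setIntegral hFi hLi (B := B) (fun n => ?_) ?_ hh
    · have h1 := hB n
      rw [eLpNorm_one_eq_lintegral_enorm, ← ofReal_integral_norm_eq_lintegral_enorm (hFi n),
        ← ENNReal.ofReal_coe_nnreal] at h1
      exact (ENNReal.ofReal_le_ofReal_iff B.2).1 h1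
    · intro A hA
      rw [setIntegral_indicator hK, ← Measure.restrict_restrict hA, ← hν₀ A hA]
      exact hν A hA
  -- Here the pointwise limit of the pairings is a continuous functional on L^q by Banach–Steinhaus,
  -- and q < ∞ allows it to be represented in L^p.
  · have hlim : ∀ f : Lp ℝ q μ, ∃ l, Tendsto (fun n => pairing hpq (hFp n p) f) atTop (𝓝 l) :=
      fun f => by
        obtain ⟨l, hl⟩ := hconv f (Lp.memLp f)
        exact ⟨l, hl.congr fun n => (pairing_apply hpq (hFp n p) f).symm⟩
    choose ℓ hℓ using hlim
    have hℓ' : Tendsto (fun n f => pairing hpq (hFp n p) f) atTop (𝓝 ℓ) := tendsto_pi_nhds.2 hℓ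
    obtain ⟨L, hL, hLℓ⟩ := exists_eq_integral_of_clm hpq.symm hq hK hμK
      (continuousLinearMapOfTendsto _ hℓ')
    refine ⟨K.indicator L, hL.indicator hK, fun h hh => ?_⟩
    have hhK := hh.indicator hK
    have h1 := hLℓ (MemLp.toLp _ hhK) (by
      filter_upwards [hhK.coeFn_toLp] with u hu hu'
      rw [hu, indicator_of_notMem hu'])
    have h2 : ∫ u, K.indicator L u * h u ∂μ = ℓ (MemLp.toLp _ hhK) := by
      refine Eq.trans ?_ h1.symm
      refine integral_congr_ae ?_
      filter_upwards [hhK.coeFn_toLp] with u hu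
      rw [hu]
      by_cases hu' : u ∈ K <;> simp [hu']
    rw [h2]
    refine (hℓ _).congr fun n => ?_
    rw [pairing_apply]
    refine integral_congr_ae ?_
    filter_upwards [hhK.coeFn_toLp] with u hu
    rw [hu]
    by_cases hu' : u ∈ K <;> simp [hu', hFK n u]

end WeakConvergence

/-! ### The weak topologies of the `L^p` spaces -/

theorem continuous_lpTopology_integral_mul {p q : ℝ≥0∞} [Fact (1 ≤ p)] (hpq : p.HolderConjugate q)
    {h : ℝ → ℝ} (hh : MemLp h q volume) :
    @Continuous _ _ (lpTopology p) _
      (fun f : Lp ℝ p (volume : Measure ℝ) => ∫ u, f u * h u) := by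
  have : Fact (1 ≤ q) := ⟨ENNReal.HolderConjugate.one_le q p⟩
  rcases eq_or_ne p ∞ with rfl | hp
  · obtain rfl : q = 1 := (ENNReal.HolderConjugate.eq_top_iff_eq_one ∞ q).1 rfl
    have e : (fun f : Lp ℝ ∞ (volume : Measure ℝ) => ∫ u, f u * h u) =
        fun f : Lp ℝ ∞ (volume : Measure ℝ) => ∫ u, f u * MemLp.toLp h hh u := by
      funext f
      exact integral_congr_ae (hh.coeFn_toLp.mono fun u hu => by simp only [hu])
    rw [e, lpTopology, if_pos rfl]
    exact continuous_iff_le_induced.2 (iInf_le _ (MemLp.toLp h hh))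
  · rw [lpTopology, if_neg hp]
    have e : (fun f : Lp ℝ p (volume : Measure ℝ) => ∫ u, f u * h u) =
        (fun f : WeakSpace ℝ (Lp ℝ p (volume : Measure ℝ)) =>
          pairing hpq.symm hh ((toWeakSpace ℝ (Lp ℝ p (volume : Measure ℝ))).symm f)) ∘
        toWeakSpace ℝ (Lp ℝ p (volume : Measure ℝ)) := by
      funext f
      simp only [Function.comp_apply, LinearEquiv.symm_apply_apply]
      rw [pairing_apply]
      simp only [mul_comm]
    rw [e]
    exact @Continuous.comp _ _ _ (TopologicalSpace.induced
      (toWeakSpace ℝ (Lp ℝ p (volume : Measure ℝ))) inferInstance) _ _ _ _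
      (WeakBilin.eval_continuous (topDualPairing ℝ (Lp ℝ p (volume : Measure ℝ))).flip
        (pairing hpq.symm hh)) continuous_induced_dom

/-- The common support K of finite measure is what lets every continuous functional be replaced by
integration against some h in L^q. For p = ∞ the topology is defined by such pairings from the
start. -/
theorem tendsto_lpTopology {ι : Type*} {l : Filter ι} {p q : ℝ≥0∞} [Fact (1 ≤ p)]
    (hpq : p.HolderConjugate q) {K : Set ℝ} (hK : MeasurableSet K) (hμK : volume K ≠ ∞)
    {f : ι → Lp ℝ p (volume : Measure ℝ)} {g : Lp ℝ p (volume : Measure ℝ)}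
    (hf : ∀ᶠ i in l, ∀ᵐ u, u ∉ K → f i u = 0) (hg : ∀ᵐ u, u ∉ K → g u = 0)
    (hlim : ∀ h : ℝ → ℝ, MemLp h q volume →
      Tendsto (fun i => ∫ u, f i u * h u) l (𝓝 (∫ u, g u * h u))) :
    Tendsto f l (@nhds _ (lpTopology p) g) := by
  rcases eq_or_ne p ∞ with rfl | hp
  · obtain rfl : q = 1 := (ENNReal.HolderConjugate.eq_top_iff_eq_one ∞ q).1 rfl
    rw [lpTopology, if_pos rfl, nhds_iInf, tendsto_iInf]
    intro h
    rw [nhds_induced, tendsto_comap_iff]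
    exact hlim h (Lp.memLp h)
  · rw [lpTopology, if_neg hp, nhds_induced, tendsto_comap_iff]
    refine (WeakBilin.tendsto_iff_forall_eval_tendsto
      (topDualPairing ℝ (Lp ℝ p (volume : Measure ℝ))).flip ?_).2 fun ℓ => ?_
    -- Functionals separate points by Hahn–Banach, as needed to test convergence in the weak
    -- topology.
    · intro a b hab
      by_contra hne
      obtain ⟨φ, hφ⟩ := SeparatingDual.exists_separating_of_ne (R := ℝ) hne
      exact hφ (DFunLike.congr_fun hab φ)
    · obtain ⟨h, hh, hℓ⟩ := exists_eq_integral_of_clm hpq hp hK hμK ℓ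
      change Tendsto (fun i => ℓ (f i)) l (𝓝 (ℓ g))
      rw [hℓ g hg]
      simp only [mul_comm (h _)]
      refine (hlim h hh).congr' ?_
      filter_upwards [hf] with i hi
      rw [hℓ _ hi]
      simp only [mul_comm]

/-! ### Approximation of test functions -/

/-- Against a uniformly integrable sequence, bounded functions are approximated by continuous
functions. -/
theorem exists_continuous_integral_mul_abs_sub_le_of_unifIntegrable {K : Set ℝ}
    (hK : MeasurableSet K) (hμK : volume K ≠ ∞) {G : ℕ → ℝ → ℝ} (hG0 : ∀ n u, 0 ≤ G n u)
    (hGi : ∀ n, Integrable (G n) volume) (hGK : ∀ n u, u ∉ K → G n u = 0)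
    (hUI : UnifIntegrable G 1 volume) {B : ℝ} (hB : ∀ n, ∫ u, G n u ≤ B) {h : ℝ → ℝ}
    (hh : MemLp h ∞ volume) {ε : ℝ} (hε : 0 < ε) :
    ∃ φ : ℝ → ℝ, Continuous φ ∧ MemLp φ ∞ volume ∧ ∀ n, ∫ u, G n u * |h u - φ u| ≤ ε := by
  set C := (eLpNorm h ∞ volume).toReal with hC
  have hC0 : 0 ≤ C := ENNReal.toReal_nonneg
  have hhC := ae_abs_le_eLpNorm_top hh
  -- θ bounds |h - φ| off an exceptional set S, and ε' bounds the integrals of G n over S, where |h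
  -- - φ| ≤ 2C.
  set θ := ε / (2 * (|B| + 1)) with hθ
  have hθ0 : 0 < θ := by positivity
  have hθB : θ * (|B| + 1) = ε / 2 := by
    rw [hθ]
    field_simp
  set ε' := ε / (2 * (2 * C + 1)) with hε'
  have hε'0 : 0 < ε' := by positivity
  have hε'C : (2 * C + 1) * ε' = ε / 2 := by
    rw [hε']
    field_simp
  obtain ⟨δ, hδ, hδ'⟩ := hUI hε'0
  have hhK : MemLp (K.indicator h) 1 volume := by
    have : IsFiniteMeasure (volume.restrict K) := ⟨by simpa using hμK.lt_top⟩
    rw [memLp_indicator_iff_restrict hK]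
    exact (hh.restrict K).mono_exponent le_top
  -- Precision θδ in L¹ makes the set where the error reaches θ have measure at most δ, by Markov's
  -- inequality.
  obtain ⟨g, -, hg, hgc, hg1⟩ := hhK.exists_hasCompactSupport_eLpNorm_sub_le ENNReal.one_ne_top
    (ENNReal.ofReal_pos.2 (mul_pos hθ0 hδ)).ne'
  -- Clipping to [-C, C] keeps continuity and does not increase the distance to h, as |h| ≤ C a.e.
  set φ : ℝ → ℝ := fun u => max (-C) (min C (g u)) with hφ
  have hφc : Continuous φ := continuous_const.max (continuous_const.min hgc)
  have hφC : ∀ u, |φ u| ≤ C := fun u =>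
    abs_le.2 ⟨le_max_left _ _, max_le (by linarith) (min_le_left _ _)⟩
  have hφmem : MemLp φ ∞ volume :=
    memLp_top_of_bound hφc.aestronglyMeasurable C (.of_forall hφC)
  refine ⟨φ, hφc, hφmem, fun n => ?_⟩
  set S₀ : Set ℝ := {u | ENNReal.ofReal θ ≤ ‖(K.indicator h - g) u‖ₑ} with hS₀
  set S := toMeasurable volume S₀ with hS
  have hSm : MeasurableSet S := measurableSet_toMeasurable _ _
  have hμS : volume S ≤ ENNReal.ofReal δ := by
    rw [hS, measure_toMeasurable]
    have h1 := mul_meas_ge_le_lintegral₀ (hhK.sub hg1).1.enorm (ENNReal.ofReal θ)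
    rw [eLpNorm_one_eq_lintegral_enorm, ENNReal.ofReal_mul hθ0.le] at hg
    exact (ENNReal.mul_le_mul_iff_right (ENNReal.ofReal_pos.2 hθ0).ne' ENNReal.ofReal_ne_top).1
      (h1.trans hg)
  have hGS : ∫ u in S, G n u ≤ ε' := by
    have h1 := hδ' n S hSm hμS
    rw [eLpNorm_one_eq_lintegral_enorm, ← ofReal_integral_norm_eq_lintegral_enorm
      ((hGi n).indicator hSm), ENNReal.ofReal_le_ofReal_iff hε'0.le] at h1
    refine le_trans (le_of_eq ?_) h1
    rw [← integral_indicator hSm]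
    congr 1
    ext u
    rw [Real.norm_eq_abs, abs_of_nonneg (indicator_nonneg (fun v _ => hG0 n v) u)]
  have hpt : ∀ᵐ u, G n u * |h u - φ u| ≤ θ * G n u + 2 * C * S.indicator (G n) u := by
    filter_upwards [hhC] with u hu
    have hSnn : 0 ≤ S.indicator (G n) u := indicator_nonneg (fun v _ => hG0 n v) u
    by_cases huK : u ∈ K
    · by_cases huS : u ∈ S
      · rw [indicator_of_mem huS]
        have h1 : |h u - φ u| ≤ 2 * C := (abs_sub _ _).trans (by linarith [hφC u])
        nlinarith [hG0 n u]
      · have h1 : ¬ ENNReal.ofReal θ ≤ ‖(K.indicator h - g) u‖ₑ := fun h =>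
          huS (subset_toMeasurable _ _ h)
        rw [not_le, Pi.sub_apply, indicator_of_mem huK, Real.enorm_eq_ofReal_abs] at h1
        have h2 : |h u - g u| < θ := (ENNReal.ofReal_lt_ofReal_iff hθ0).1 h1
        have h3 : |h u - φ u| ≤ |h u - g u| := by
          have h4 : h u = max (-C) (min C (h u)) := by
            rw [min_eq_right (abs_le.1 hu).2, max_eq_right (abs_le.1 hu).1]
          have h5 : |max (-C) (min C (h u)) - max (-C) (min C (g u))| ≤ |h u - g u| := by
            refine (abs_max_sub_max_le_max _ _ _ _).trans ?_
            rw [sub_self, abs_zero, max_eq_right (abs_nonneg _)]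
            refine (abs_min_sub_min_le_max _ _ _ _).trans ?_
            rw [sub_self, abs_zero, max_eq_right (abs_nonneg _)]
          rw [← h4] at h5
          exact h5
        have h6 : G n u * |h u - φ u| ≤ G n u * θ :=
          mul_le_mul_of_nonneg_left (h3.trans h2.le) (hG0 n u)
        have h7 : 0 ≤ 2 * C * S.indicator (G n) u := by positivity
        linarith
    · rw [hGK n u huK, zero_mul]
      positivity
  calc ∫ u, G n u * |h u - φ u| ≤ ∫ u, (θ * G n u + 2 * C * S.indicator (G n) u) :=
        integral_mono_of_nonneg (.of_forall fun u => mul_nonneg (hG0 n u) (abs_nonneg _))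
          (((hGi n).const_mul _).add (((hGi n).indicator hSm).const_mul _)) hpt
    _ = (θ * ∫ u, G n u) + 2 * C * ∫ u in S, G n u := by
        rw [integral_add ((hGi n).const_mul _) (((hGi n).indicator hSm).const_mul _),
          integral_const_mul, integral_const_mul, integral_indicator hSm]
    _ ≤ θ * (|B| + 1) + (2 * C + 1) * ε' := by
        have h1 : θ * ∫ u, G n u ≤ θ * (|B| + 1) :=
          mul_le_mul_of_nonneg_left ((hB n).trans ((le_abs_self B).trans (by linarith))) hθ0.le
        have h2 : 2 * C * ∫ u in S, G n u ≤ 2 * C * ε' :=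
          mul_le_mul_of_nonneg_left hGS (by positivity)
        linarith
    _ = ε := by
        rw [hθB, hε'C]
        ring

/-- Hölder's inequality and the density of continuous functions in L^q for q < ∞. -/
theorem exists_continuous_integral_mul_abs_sub_le_of_bounded {p q : ℝ≥0∞}
    (hpq : p.HolderConjugate q) (hq : q ≠ ∞) {G : ℕ → ℝ → ℝ} (hG0 : ∀ n u, 0 ≤ G n u)
    (hG : ∀ n, MemLp (G n) p volume) {B : ℝ≥0} (hB : ∀ n, eLpNorm (G n) p volume ≤ B) {h : ℝ → ℝ}
    (hh : MemLp h q volume) {ε : ℝ} (hε : 0 < ε) :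
    ∃ φ : ℝ → ℝ, Continuous φ ∧ MemLp φ q volume ∧ ∀ n, ∫ u, G n u * |h u - φ u| ≤ ε := by
  have hη : 0 < ε / (B + 1) := by positivity
  obtain ⟨φ, -, hφ, hφc, hφq⟩ := hh.exists_hasCompactSupport_eLpNorm_sub_le hq
    (ENNReal.ofReal_pos.2 hη).ne'
  refine ⟨φ, hφc, hφq, fun n => ?_⟩
  have h1 := integral_abs_mul_abs_le hpq (hG n) (hh.sub hφq)
  simp only [abs_of_nonneg (hG0 n _), Pi.sub_apply] at h1
  refine h1.trans ?_
  have h2 : (eLpNorm (G n) p volume).toReal ≤ B := ENNReal.toReal_mono ENNReal.coe_ne_top (hB n)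
  have h3 : (eLpNorm (h - φ) q volume).toReal ≤ ε / (B + 1) :=
    ENNReal.toReal_le_of_le_ofReal hη.le hφ
  calc _ ≤ (B + 1) * (ε / (B + 1)) :=
        mul_le_mul (h2.trans (by linarith)) h3 ENNReal.toReal_nonneg (by positivity)
    _ = ε := by field_simp

theorem osc_le {x : ℝ≥0 → ℝ} {T : ℝ≥0} {R : ℝ} (hR0 : 0 ≤ R) (hR : ∀ s ≤ T, |x s| ≤ R)
    (P : TimePartition) : osc x P T ≤ 2 * R := by
  refine Real.sSup_le ?_ (by linarith)
  rintro r ⟨k, a, b, ha, hb, -, -, -, -, rfl⟩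
  exact (abs_sub _ _).trans (by linarith [hR a ha, hR b hb])

/-- Dominated convergence: as t → t₀ the indicators of [0,t] converge except at the single point t₀,
which has measure zero. -/
theorem continuous_setIntegral_Iic {μ : Measure ℝ≥0} [IsLocallyFiniteMeasure μ]
    (hμ : ∀ s, μ {s} = 0) {k : ℝ≥0 → ℝ} (hk : Continuous k) :
    Continuous fun t => ∫ s in Iic t, k s ∂μ := by
  rw [continuous_iff_continuousAt]
  intro t₀
  have hfin : μ (Iic (t₀ + 1)) < ∞ := by
    have hI : Iic (t₀ + 1) = Icc 0 (t₀ + 1) := by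
      ext s
      simp
    rw [hI]
    exact isCompact_Icc.measure_lt_top
  have hint := integrableOn_Iic hfin hk
  have hev : ∀ᶠ t in 𝓝 t₀, t < t₀ + 1 := gt_mem_nhds (lt_add_one t₀)
  have h1 : ContinuousAt (fun t => ∫ s in Iic (t₀ + 1), (Iic t).indicator k s ∂μ) t₀ := by
    refine continuousAt_of_dominated (bound := fun s => |k s|) ?_ ?_ hint.abs ?_
    · exact .of_forall fun t => (hk.measurable.indicator measurableSet_Iic).aestronglyMeasurable
    · refine .of_forall fun t => .of_forall fun s => ?_
      by_cases hs : s ∈ Iic t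
      · rw [indicator_of_mem hs, Real.norm_eq_abs]
      · rw [indicator_of_notMem hs, norm_zero]
        exact abs_nonneg _
    · have h2 : ∀ᵐ s ∂μ, s ≠ t₀ := by
        rw [ae_iff]
        simpa using hμ t₀
      filter_upwards [ae_restrict_of_ae h2] with s hs
      rcases lt_or_gt_of_ne hs with hs | hs
      · refine ContinuousAt.congr (f := fun _ => k s) continuousAt_const ?_
        filter_upwards [lt_mem_nhds hs] with t ht
        rw [indicator_of_mem (mem_Iic.2 ht.le)]
      · refine ContinuousAt.congr (f := fun _ => 0) continuousAt_const ?_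
        filter_upwards [gt_mem_nhds hs] with t ht
        rw [indicator_of_notMem (by simpa using ht)]
  refine h1.congr ?_
  filter_upwards [hev] with t ht
  rw [setIntegral_indicator measurableSet_Iic, inter_eq_right.2 (Iic_subset_Iic.2 ht.le)]

/-- Sequences which are approximated uniformly by pointwise convergent sequences with continuous
limits converge pointwise to a continuous limit. -/
theorem exists_continuous_tendsto_of_approx {ψ : ℕ → ℝ≥0 → ℝ}
    (H : ∀ M : ℝ≥0, ∃ T ≥ M, ∀ ε > 0, ∃ (Φ : ℕ → ℝ≥0 → ℝ) (Φ' : ℝ≥0 → ℝ), Continuous Φ' ∧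
      (∀ t, Tendsto (fun n => Φ n t) atTop (𝓝 (Φ' t))) ∧ ∀ n, ∀ t ≤ T, |ψ n t - Φ n t| ≤ ε) :
    ∃ F : ℝ≥0 → ℝ, Continuous F ∧ ∀ t, Tendsto (fun n => ψ n t) atTop (𝓝 (F t)) := by
  have hlim : ∀ t, ∃ l, Tendsto (fun n => ψ n t) atTop (𝓝 l) := by
    intro t
    refine cauchySeq_tendsto_of_complete (Metric.cauchySeq_iff.2 fun ε hε => ?_)
    obtain ⟨T, hT, h⟩ := H t
    obtain ⟨Φ, Φ', -, hΦ, happ⟩ := h (ε / 4) (by positivity)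
    obtain ⟨N, hN⟩ := exists_forall_abs_sub_le (hΦ t) (show 0 < ε / 4 by positivity)
    refine ⟨N, fun n hn m hm => ?_⟩
    have h1 := abs_le.1 (hN n hn m hm)
    have h2 := abs_le.1 (happ n t hT)
    have h3 := abs_le.1 (happ m t hT)
    rw [Real.dist_eq, abs_lt]
    constructor <;> linarith
  choose F hF using hlim
  refine ⟨F, continuous_iff_continuousAt.2 fun t₀ => ?_, hF⟩
  rw [ContinuousAt, Metric.tendsto_nhds]
  intro ε hε
  obtain ⟨T, hT, h⟩ := H (t₀ + 1)
  obtain ⟨Φ, Φ', hc, hΦ, happ⟩ := h (ε / 4) (by positivity)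
  have hFΦ : ∀ t ≤ T, |F t - Φ' t| ≤ ε / 4 := fun t ht =>
    le_of_tendsto' ((hF t).sub (hΦ t)).abs fun n => happ n t ht
  have ht₀ : t₀ < t₀ + 1 := lt_add_one t₀
  filter_upwards [gt_mem_nhds ht₀,
    (hc.tendsto t₀).eventually (Metric.ball_mem_nhds _ (by positivity : 0 < ε / 4))] with t ht h1
  rw [Real.dist_eq] at h1
  have h2 := abs_le.1 (hFΦ t (ht.le.trans hT))
  have h3 := abs_le.1 (hFΦ t₀ (ht₀.le.trans hT))
  have h4 := abs_lt.1 h1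
  rw [Real.dist_eq, abs_lt]
  constructor <;> linarith

/-! ### Weak convergence of the discrete local times -/

/-- For every `h ∈ L^q` the integrals of the discrete local times against `h` converge pointwise
in time, to a continuous function of time. -/
def ConvergesWeakly (x : ℝ≥0 → ℝ) (P : ℕ → TimePartition) (q : ℝ≥0∞) : Prop :=
  ∀ h : ℝ → ℝ, MemLp h q (volume : Measure ℝ) → ∃ F : ℝ≥0 → ℝ, Continuous F ∧
    ∀ t, Tendsto (fun n => ∫ u, discreteLocalTime x (P n) t u * h u) atTop (𝓝 (F t))

/-- `L t` is the weak limit of the discrete local times, and depends continuously on `t`. -/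
structure IsWeakLimit (x : ℝ≥0 → ℝ) (P : ℕ → TimePartition) (q : ℝ≥0∞) (L : ℝ≥0 → ℝ → ℝ) :
    Prop where
  tendsto : ∀ h : ℝ → ℝ, MemLp h q (volume : Measure ℝ) → ∀ t,
    Tendsto (fun n => ∫ u, discreteLocalTime x (P n) t u * h u) atTop (𝓝 (∫ u, L t u * h u))
  continuous : ∀ h : ℝ → ℝ, MemLp h q (volume : Measure ℝ) → Continuous fun t => ∫ u, L t u * h u

variable {x : ℝ≥0 → ℝ} {P : ℕ → TimePartition} {p q : ℝ≥0∞}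

theorem IsWeakLimit.convergesWeakly {L : ℝ≥0 → ℝ → ℝ} (hL : IsWeakLimit x P q L) :
    ConvergesWeakly x P q := fun h hh =>
  ⟨fun t => ∫ u, L t u * h u, hL.continuous h hh, hL.tendsto h hh⟩

theorem tendsto_integral_discreteLocalTime (hx : Continuous x)
    (hP : ∀ t : ℝ≥0, Tendsto (fun n => osc x (P n) t) atTop (𝓝 0)) {μ : Measure ℝ≥0}
    (hμ : IsQuadraticVariation x P μ) (t : ℝ≥0) :
    Tendsto (fun n => ∫ u, discreteLocalTime x (P n) t u) atTop (𝓝 (μ.real (Iic t))) := by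
  have := hμ.1
  have h1 := tendsto_setIntegral_of_vague (fun n T => squareMeasure_Iic_lt_top x (P n) T) hμ.2.1
    hμ.2.2 (continuous_const (y := (1 : ℝ))) t
  simp only [setIntegral_const, smul_eq_mul, mul_one] at h1
  have h2 := (tendsto_integral_sub_squareMeasure hx hP t).add h1
  simpa using h2

/-- Convergence for φ = 1 supplies the mass bound needed to compare local times with squared
increments for general φ. -/
theorem tendsto_integral_discreteLocalTime_mul (hx : Continuous x)
    (hP : ∀ t : ℝ≥0, Tendsto (fun n => osc x (P n) t) atTop (𝓝 0)) {μ : Measure ℝ≥0}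
    (hμ : IsQuadraticVariation x P μ) {φ : ℝ → ℝ} (hφ : Continuous φ) (t : ℝ≥0) :
    Tendsto (fun n => ∫ u, discreteLocalTime x (P n) t u * φ u) atTop
      (𝓝 (∫ s in Iic t, φ (x s) ∂μ)) := by
  have := hμ.1
  have h1 := tendsto_setIntegral_of_vague (fun n T => squareMeasure_Iic_lt_top x (P n) T) hμ.2.1
    hμ.2.2 (hφ.comp hx) t
  have h2 : ∀ᶠ n in atTop, ∫ u, discreteLocalTime x (P n) t u ≤ μ.real (Iic t) + 1 :=
    ((tendsto_integral_discreteLocalTime hx hP hμ t).eventually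
      (gt_mem_nhds (lt_add_one _))).mono fun n hn => hn.le
  have h3 := (tendsto_integral_sub_setIntegral hx hP t h2 hφ).add h1
  simpa using h3

/-- The limit is known for continuous test functions; it extends to h in L^q because one function G
n dominates the local times at all t ≤ T, making the error of replacing h by a continuous φ uniform
in t and n. -/
theorem convergesWeakly_of_isQuadraticVariation (hx : Continuous x)
    (hP : ∀ t : ℝ≥0, Tendsto (fun n => osc x (P n) t) atTop (𝓝 0)) (hpq : p.HolderConjugate q)
    {μ : Measure ℝ≥0} (hμ : IsQuadraticVariation x P μ)
    (hb : ∀ M : ℝ≥0, ∃ t : ℝ≥0, M ≤ t ∧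
      if p = 1 then EquiIntegrable (fun n => discreteLocalTime x (P n) t)
      else BoundedInLp p (fun n => discreteLocalTime x (P n) t)) :
    ConvergesWeakly x P q := by
  have := hμ.1
  have hp1 : 1 ≤ p := ENNReal.HolderConjugate.one_le p q
  have hq1 : 1 ≤ q := ENNReal.HolderConjugate.one_le q p
  intro h hh
  refine exists_continuous_tendsto_of_approx fun M => ?_
  obtain ⟨T, hT, hcond⟩ := hb M
  refine ⟨T, hT, fun ε hε => ?_⟩
  obtain ⟨R, hR0, hR⟩ := exists_bound x hx T
  -- By almost monotonicity L_t ≤ L_T + 2 osc on [-R,R], and osc ≤ 2R; this is the origin of 4R.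
  set E : ℝ → ℝ := fun u => 4 * R * (Icc (-R) R).indicator 1 u with hE
  have hE0 : ∀ u, 0 ≤ E u := fun u =>
    mul_nonneg (by linarith) (indicator_nonneg (fun _ _ => zero_le_one) u)
  have hEmem : ∀ r, MemLp E r volume := fun r => (memLp_indicator_one measurableSet_Icc (by simp) r).const_mul (4 * R)
  set G : ℕ → ℝ → ℝ := fun n => discreteLocalTime x (P n) T + E with hG
  have hG0 : ∀ n u, 0 ≤ G n u := fun n u =>
    add_nonneg (discreteLocalTime_nonneg x (P n) T u) (hE0 u)
  have hLG : ∀ n, ∀ t ≤ T, ∀ u, discreteLocalTime x (P n) t u ≤ G n u := by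
    intro n t ht u
    refine (discreteLocalTime_le_add hx hR (P n) ht le_rfl u).trans ?_
    refine add_le_add le_rfl (mul_le_mul_of_nonneg_right ?_
      (indicator_nonneg (fun _ _ => zero_le_one) u))
    linarith [osc_le hR0 hR (P n)]
  have hGmem : ∀ n r, MemLp (G n) r volume := fun n r =>
    (memLp_discreteLocalTime x (P n) T r).add (hEmem r)
  have hφ : ∃ φ : ℝ → ℝ, Continuous φ ∧ MemLp φ q volume ∧
      ∀ n, ∫ u, G n u * |h u - φ u| ≤ ε := by
    split_ifs at hcond with hp
    · subst hp
      obtain rfl : q = ∞ := (ENNReal.HolderConjugate.eq_top_iff_eq_one q 1).2 rfl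
      obtain ⟨B, hB⟩ := (tendsto_integral_discreteLocalTime hx hP hμ T).bddAbove_range
      have hUI : UnifIntegrable G 1 volume := hcond.1.add
        (unifIntegrable_const le_rfl ENNReal.one_ne_top (hEmem 1)) le_rfl
        (fun n => (measurable_discreteLocalTime x (P n) T).aestronglyMeasurable)
        (fun n => (hEmem 1).1)
      refine exists_continuous_integral_mul_abs_sub_le_of_unifIntegrable
        (measurableSet_Icc (a := -R) (b := R)) (by simp) hG0
        (fun n => memLp_one_iff_integrable.1 (hGmem n 1)) (fun n u hu => ?_) hUI
        (B := B + ∫ u, E u) (fun n => ?_) hh hε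
      · change discreteLocalTime x (P n) T u + 4 * R * (Icc (-R) R).indicator 1 u = 0
        rw [discreteLocalTime_eq_zero hR (P n) le_rfl hu, indicator_of_notMem hu]
        simp
      · have h1 : ∫ u, G n u = (∫ u, discreteLocalTime x (P n) T u) + ∫ u, E u :=
          integral_add (integrable_discreteLocalTime x (P n) T)
            (memLp_one_iff_integrable.1 (hEmem 1))
        rw [h1]
        exact add_le_add (hB ⟨n, rfl⟩) le_rfl
    · have hq : q ≠ ∞ := fun h => hp ((ENNReal.HolderConjugate.eq_top_iff_eq_one q p).1 h)
      obtain ⟨C, hC⟩ := hcond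
      refine exists_continuous_integral_mul_abs_sub_le_of_bounded hpq hq hG0
        (fun n => hGmem n p) (B := C + (eLpNorm E p volume).toNNReal) (fun n => ?_) hh hε
      rw [ENNReal.coe_add, ENNReal.coe_toNNReal (hEmem p).2.ne]
      exact (eLpNorm_add_le (measurable_discreteLocalTime x (P n) T).aestronglyMeasurable
        (hEmem p).1 hp1).trans (add_le_add (hC n) le_rfl)
  obtain ⟨φ, hφc, hφq, hφε⟩ := hφ
  refine ⟨fun n t => ∫ u, discreteLocalTime x (P n) t u * φ u, fun t => ∫ s in Iic t, φ (x s) ∂μ,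
    continuous_setIntegral_Iic hμ.2.1 (hφc.comp hx),
    fun t => tendsto_integral_discreteLocalTime_mul hx hP hμ hφc t, fun n t ht => ?_⟩
  rw [← integral_sub (integrable_discreteLocalTime_mul x (P n) t (hh.locallyIntegrable hq1))
    (integrable_discreteLocalTime_mul x (P n) t (hφq.locallyIntegrable hq1))]
  refine abs_integral_le_integral_abs.trans ((integral_mono_of_nonneg
    (.of_forall fun u => abs_nonneg _) ?_ (.of_forall fun u => ?_)).trans (hφε n))
  · have := hpq
    exact (hGmem n p).integrable_mul (hh.sub hφq).abs
  · change |discreteLocalTime x (P n) t u * h u - discreteLocalTime x (P n) t u * φ u| ≤ _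
    rw [← mul_sub, abs_mul, abs_of_nonneg (discreteLocalTime_nonneg x (P n) t u)]
    exact mul_le_mul_of_nonneg_right (hLG n t ht u) (abs_nonneg _)

/-! ### Boundedness, equi-integrability and quadratic variation from weak convergence -/

theorem exists_abs_discreteLocalTime_le (x : ℝ≥0 → ℝ) (P : ℕ → TimePartition) (t : ℝ≥0)
    (hx : Continuous x) (n : ℕ) : ∃ C, ∀ u, |discreteLocalTime x (P n) t u| ≤ C := by
  obtain ⟨R, -, hR⟩ := exists_bound x hx t
  obtain ⟨C, hC0, hC⟩ := discreteLocalTime_le hR (P n)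
  refine ⟨C, fun u => ?_⟩
  rw [abs_of_nonneg (discreteLocalTime_nonneg x (P n) t u)]
  refine (hC u).trans (mul_le_of_le_one_right hC0 ?_)
  by_cases hu : u ∈ Icc (-R) R <;> simp only [hu, indicator_of_mem,
      indicator_of_notMem, not_false_eq_true, Pi.one_apply, le_refl, zero_le_one]

theorem ConvergesWeakly.boundedInLp (hA : ConvergesWeakly x P q) (hx : Continuous x)
    (hpq : p.HolderConjugate q) (t : ℝ≥0) :
    BoundedInLp p (fun n => discreteLocalTime x (P n) t) := by
  obtain ⟨R, -, hR⟩ := exists_bound x hx t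
  refine exists_eLpNorm_le_of_tendsto hpq (measurableSet_Icc (a := -R) (b := R)) (by simp)
    (fun n => measurable_discreteLocalTime x (P n) t)
    (exists_abs_discreteLocalTime_le x P t hx)
    (fun n u hu => discreteLocalTime_eq_zero hR (P n) le_rfl hu) fun h hh => ?_
  obtain ⟨F, -, hF⟩ := hA h hh
  exact ⟨F t, hF t⟩

/-- Smallness on small sets is Vitali–Hahn–Saks; tightness is trivial since everything vanishes
outside the range of the path up to t. -/
theorem ConvergesWeakly.equiIntegrable (hA : ConvergesWeakly x P ∞) (hx : Continuous x)
    (t : ℝ≥0) : EquiIntegrable (fun n => discreteLocalTime x (P n) t) := by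
  obtain ⟨R, -, hR⟩ := exists_bound x hx t
  set K := Icc (-R) R with hK
  have hzero : ∀ n u, u ∉ K → discreteLocalTime x (P n) t u = 0 := fun n u hu =>
    discreteLocalTime_eq_zero hR (P n) le_rfl hu
  have hKm : MeasurableSet K := measurableSet_Icc
  have hμK : volume K ≠ ∞ := by simp [hK]
  constructor
  · intro ε hε
    obtain ⟨δ, hδ, hδ'⟩ := exists_forall_setIntegral_le hKm hμK
      (fun n => measurable_discreteLocalTime x (P n) t)
      (fun n u => discreteLocalTime_nonneg x (P n) t u)
      (fun n => by
        obtain ⟨C, hC⟩ := exists_abs_discreteLocalTime_le x P t hx n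
        exact ⟨C, fun u => (le_abs_self _).trans (hC u)⟩)
      (fun h hm h0 h1 => by
        obtain ⟨F, -, hF⟩ := hA h (memLp_top_of_bound hm.aestronglyMeasurable 1
          (.of_forall fun u => by
            rw [Real.norm_eq_abs, abs_of_nonneg (h0 u)]
            refine (h1 u).trans ?_
            by_cases hu : u ∈ K <;> simp [hu]))
        exact ⟨F t, hF t⟩) hε
    refine ⟨δ, hδ, fun n s hs hμs => ?_⟩
    have hint := (integrable_discreteLocalTime x (P n) t).indicator hs
    rw [eLpNorm_one_eq_lintegral_enorm, ← ofReal_integral_norm_eq_lintegral_enorm hint]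
    refine ENNReal.ofReal_le_ofReal (le_trans (le_of_eq ?_)
      (hδ' n (s ∩ K) (hs.inter hKm) inter_subset_right ((measure_mono inter_subset_left).trans hμs)))
    rw [← integral_indicator (hs.inter hKm)]
    congr 1
    ext u
    rw [Real.norm_eq_abs, abs_of_nonneg
      (indicator_nonneg (fun v _ => discreteLocalTime_nonneg x (P n) t v) u)]
    by_cases hu : u ∈ s <;> by_cases hu' : u ∈ K <;> simp [hu, hu', hzero n u]
  · intro ε hε
    refine ⟨K, hμK, fun n => ?_⟩
    have h1 : Kᶜ.indicator (discreteLocalTime x (P n) t) = 0 := by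
      ext u
      by_cases hu : u ∈ K <;> simp [hu, hzero n u]
    rw [h1, eLpNorm_zero]
    exact zero_le

theorem discreteLocalTime_zero (x : ℝ≥0 → ℝ) (P : TimePartition) (u : ℝ) :
    discreteLocalTime x P 0 u = 0 := by
  simp [discreteLocalTime, capAt, halfOpen_self]

/-- The total mass of L^{π_n}_t is asymptotically the mass of the squared increments on [0,t]. Its
limit V is continuous, starts at 0, and is increasing because the oscillation error disappears, so V
is the distribution function of the sought measure. -/
theorem ConvergesWeakly.exists_isQuadraticVariation (hA : ConvergesWeakly x P q)
    (hx : Continuous x) (hP : ∀ t : ℝ≥0, Tendsto (fun n => osc x (P n) t) atTop (𝓝 0)) :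
    ∃ μ, IsQuadraticVariation x P μ := by
  have hloc : ∀ T : ℝ≥0, ∃ F : ℝ≥0 → ℝ, Continuous F ∧ ∀ t ≤ T,
      Tendsto (fun n => ∫ u, discreteLocalTime x (P n) t u) atTop (𝓝 (F t)) := by
    intro T
    -- The constant 1 need not lie in L^q; the indicator of [-R,R] does, and has the same effect up
    -- to time T.
    obtain ⟨R, -, hR⟩ := exists_bound x hx T
    obtain ⟨F, hFc, hF⟩ := hA _
      (memLp_indicator_one (measurableSet_Icc (a := -R) (b := R)) (by simp) q)
    refine ⟨F, hFc, fun t ht => (hF t).congr fun n => ?_⟩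
    congr 1
    ext u
    by_cases hu : u ∈ Icc (-R) R
    · rw [indicator_of_mem hu, Pi.one_apply, mul_one]
    · rw [discreteLocalTime_eq_zero hR (P n) ht hu, zero_mul]
  choose F hFc hF using hloc
  -- The limit F T is meaningful only up to T, but near t₀ the diagonal agrees with F (t₀ + 1),
  -- whence continuity.
  set V : ℝ≥0 → ℝ := fun t => F t t with hV
  have hVlim : ∀ t, Tendsto (fun n => ∫ u, discreteLocalTime x (P n) t u) atTop (𝓝 (V t)) :=
    fun t => hF t t le_rfl
  have hVc : Continuous V := by
    refine continuous_iff_continuousAt.2 fun t₀ => ?_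
    refine (hFc (t₀ + 1)).continuousAt.congr ?_
    filter_upwards [gt_mem_nhds (lt_add_one t₀)] with t ht
    exact tendsto_nhds_unique (hF (t₀ + 1) t ht.le) (hVlim t)
  have hV0 : V 0 = 0 := by
    refine tendsto_nhds_unique (hVlim 0) ?_
    simp [discreteLocalTime_zero]
  have hVm : Monotone V := by
    intro s t hst
    obtain ⟨R, -, hR⟩ := exists_bound x hx t
    have hi := memLp_one_iff_integrable.1
      (memLp_indicator_one (μ := volume) (measurableSet_Icc (a := -R) (b := R)) (by simp) 1)
    have h1 : Tendsto (fun n => (∫ u, discreteLocalTime x (P n) t u) +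
        2 * osc x (P n) t * ∫ u, (Icc (-R) R).indicator (1 : ℝ → ℝ) u) atTop (𝓝 (V t)) := by
      simpa using (hVlim t).add (((hP t).const_mul 2).mul_const
        (∫ u, (Icc (-R) R).indicator (1 : ℝ → ℝ) u))
    refine le_of_tendsto_of_tendsto' (hVlim s) h1 fun n => ?_
    rw [← integral_const_mul, ← integral_add (integrable_discreteLocalTime x (P n) t)
      (hi.const_mul _)]
    exact integral_mono (integrable_discreteLocalTime x (P n) s)
      ((integrable_discreteLocalTime x (P n) t).add (hi.const_mul _))
      fun u => discreteLocalTime_le_add hx hR (P n) hst le_rfl u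
  obtain ⟨μ, hμ1, hμ2, hμ3⟩ := exists_measure_Iic_eq hVc hVm hV0
  refine ⟨μ, hμ1, hμ2, fun φ hφ hφs => ?_⟩
  have hcdf : ∀ T, Tendsto (fun n => (squareMeasure x (P n)).real (Iic T)) atTop
      (𝓝 (μ.real (Iic T))) := fun T => by
    rw [(hμ3 T).2]
    simpa using (hVlim T).sub (tendsto_integral_sub_squareMeasure hx hP T)
  obtain ⟨T, hT⟩ := hφs.isCompact.bddAbove
  have hsupp : ∀ s ∉ Iic T, φ s = 0 := fun s hs => by
    by_contra h
    exact hs (hT (subset_tsupport φ h))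
  have h1 := tendsto_setIntegral_of_tendsto_Iic
    (fun n T => squareMeasure_Iic_lt_top x (P n) T) (fun T => (hμ3 T).1) hcdf hφ T
  rw [setIntegral_eq_integral_of_forall_compl_eq_zero hsupp] at h1
  exact h1.congr fun n => setIntegral_eq_integral_of_forall_compl_eq_zero hsupp

/-! ### Riemann sums and weak convergence, and uniformity in time -/

theorem integral_discreteLocalTime_mul_eq_riemannSum (x : ℝ≥0 → ℝ) (P : TimePartition)
    (hq : 1 ≤ q) {h : ℝ → ℝ} (hh : MemLp h q volume) (t : ℝ≥0) :
    ∫ u, discreteLocalTime x P t u * h u =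
      2 * ((∫ v in x 0..x t, ∫ u in (0 : ℝ)..v, h u) -
        riemannSum x P (fun v => ∫ u in (0 : ℝ)..v, h u) t) := by
  obtain ⟨hg, hae⟩ := memW1_integral hq hh
  rw [riemannSum_eq_sub P hg.1 (hg.2.locallyIntegrable hq)]
  have : ∫ u, discreteLocalTime x P t u * deriv (fun v => ∫ u in (0 : ℝ)..v, h u) u =
      ∫ u, discreteLocalTime x P t u * h u :=
    integral_congr_ae (hae.mono fun u hu => by simp only [hu])
  rw [this]
  ring

theorem continuous_integral_of_ac {g : ℝ → ℝ} (hg : ∀ a b : ℝ, AbsolutelyContinuousOnInterval g a b)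
    (hx : Continuous x) : Continuous fun t => ∫ u in x 0..x t, g u :=
  (intervalIntegral.continuous_primitive
    (fun a b => (continuous_of_ac hg).intervalIntegrable a b) _).comp hx

theorem convergesWeakly_of_isFollmerIntegral (hx : Continuous x) (hq : 1 ≤ q)
    (H : ∀ g : ℝ → ℝ, MemW1 q g → ∃ I : ℝ≥0 → ℝ, IsFollmerIntegral x P g I) :
    ConvergesWeakly x P q := by
  intro h hh
  obtain ⟨hg, -⟩ := memW1_integral hq hh
  obtain ⟨I, hIc, hI⟩ := H _ hg
  refine ⟨fun t => 2 * ((∫ v in x 0..x t, ∫ u in (0 : ℝ)..v, h u) - I t),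
    ((continuous_integral_of_ac hg.1 hx).sub hIc).const_mul 2, fun t => ?_⟩
  simp only [integral_discreteLocalTime_mul_eq_riemannSum x (P _) hq hh t]
  exact ((hI t).const_sub _).const_mul 2

/-- The Itô formula for discrete local times passes to the weak limit. -/
theorem isFollmerIntegral_of_tendsto (hx : Continuous x) (hq : 1 ≤ q) {g : ℝ → ℝ}
    (hg : MemW1 q g) {F : ℝ≥0 → ℝ} (hFc : Continuous F)
    (hF : ∀ t, Tendsto (fun n => ∫ u, discreteLocalTime x (P n) t u * deriv g u) atTop (𝓝 (F t))) :
    IsFollmerIntegral x P g fun t => (∫ u in x 0..x t, g u) - 1 / 2 * F t := by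
  refine ⟨(continuous_integral_of_ac hg.1 hx).sub (hFc.const_mul _), fun t => ?_⟩
  simp only [riemannSum_eq_sub (P _) hg.1 (hg.2.locallyIntegrable hq) t]
  exact ((hF t).const_mul _).const_sub _

/-- For h ≥ 0 the integrals inherit almost monotonicity, with error 2 osc times the integral of h
over [-R,R]. -/
theorem tendstoLocallyUniformly_of_nonneg (hx : Continuous x)
    (hP : ∀ t : ℝ≥0, Tendsto (fun n => osc x (P n) t) atTop (𝓝 0)) {h : ℝ → ℝ}
    (hh : LocallyIntegrable h volume) (h0 : ∀ u, 0 ≤ h u) {F : ℝ≥0 → ℝ} (hFc : Continuous F)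
    (hF : ∀ t, Tendsto (fun n => ∫ u, discreteLocalTime x (P n) t u * h u) atTop (𝓝 (F t))) :
    TendstoLocallyUniformly (fun n t => ∫ u, discreteLocalTime x (P n) t u * h u) F atTop := by
  refine tendstoLocallyUniformly_of_almost_monotone hFc hF fun T => ?_
  obtain ⟨R, -, hR⟩ := exists_bound x hx T
  have hi : Integrable ((Icc (-R) R).indicator h) volume :=
    (integrable_indicator_iff measurableSet_Icc).2 (hh.integrableOn_isCompact isCompact_Icc)
  refine ⟨fun n => 2 * osc x (P n) T * ∫ u, (Icc (-R) R).indicator h u, ?_, ?_⟩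
  · simpa using ((hP T).const_mul 2).mul_const (∫ u, (Icc (-R) R).indicator h u)
  · intro n s t hst ht
    have hit := integrable_discreteLocalTime_mul x (P n) t hh
    beta_reduce
    rw [← integral_const_mul, ← integral_add hit (hi.const_mul _)]
    refine integral_mono (integrable_discreteLocalTime_mul x (P n) s hh)
      (hit.add (hi.const_mul _)) fun u => ?_
    have h1 := mul_le_mul_of_nonneg_right
      (discreteLocalTime_le_add hx hR (P n) hst ht u) (h0 u)
    refine h1.trans_eq ?_
    by_cases hu : u ∈ Icc (-R) R
    · rw [indicator_of_mem hu, indicator_of_mem hu, Pi.one_apply]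
      ring
    · rw [indicator_of_notMem hu, indicator_of_notMem hu]
      ring

/-- Monotonicity needs a sign, so h is split into positive and negative parts; weak convergence
applies to each and provides the continuous limits. -/
theorem ConvergesWeakly.tendstoUniformlyOn (hA : ConvergesWeakly x P q) (hx : Continuous x)
    (hP : ∀ t : ℝ≥0, Tendsto (fun n => osc x (P n) t) atTop (𝓝 0)) (hq : 1 ≤ q) {h : ℝ → ℝ}
    (hh : MemLp h q volume) {F : ℝ≥0 → ℝ}
    (hF : ∀ t, Tendsto (fun n => ∫ u, discreteLocalTime x (P n) t u * h u) atTop (𝓝 (F t)))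
    {K : Set ℝ≥0} (hK : IsCompact K) :
    TendstoUniformlyOn (fun n t => ∫ u, discreteLocalTime x (P n) t u * h u) F atTop K := by
  obtain ⟨F₁, hc₁, hF₁⟩ := hA _ hh.pos_part
  obtain ⟨F₂, hc₂, hF₂⟩ := hA _ hh.neg_part
  have hl₁ := hh.pos_part.locallyIntegrable hq
  have hl₂ := hh.neg_part.locallyIntegrable hq
  have hsub : ∀ n t, (∫ u, discreteLocalTime x (P n) t u * max (h u) 0) -
      ∫ u, discreteLocalTime x (P n) t u * max (-h u) 0 =
      ∫ u, discreteLocalTime x (P n) t u * h u := fun n t => by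
    rw [← integral_sub (integrable_discreteLocalTime_mul x (P n) t hl₁)
      (integrable_discreteLocalTime_mul x (P n) t hl₂)]
    congr 1
    ext u
    rw [← mul_sub, max_zero_sub_max_neg_zero_eq_self]
  have h1 := tendstoLocallyUniformly_iff_forall_isCompact.1
    (tendstoLocallyUniformly_of_nonneg hx hP hl₁ (fun u => le_max_right _ _) hc₁ hF₁) K hK
  have h2 := tendstoLocallyUniformly_iff_forall_isCompact.1
    (tendstoLocallyUniformly_of_nonneg hx hP hl₂ (fun u => le_max_right _ _) hc₂ hF₂) K hK
  have hFeq : F = F₁ - F₂ := by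
    funext t
    exact tendsto_nhds_unique (hF t) (((hF₁ t).sub (hF₂ t)).congr fun n => hsub n t)
  rw [hFeq]
  exact (h1.sub h2).congr (.of_forall fun n t _ => hsub n t)

theorem ConvergesWeakly.exists_tendstoUniformlyOn_riemannSum (hA : ConvergesWeakly x P q)
    (hx : Continuous x) (hP : ∀ t : ℝ≥0, Tendsto (fun n => osc x (P n) t) atTop (𝓝 0))
    (hq : 1 ≤ q) {g : ℝ → ℝ} (hg : MemW1 q g) :
    ∃ I : ℝ≥0 → ℝ, ∀ K : Set ℝ≥0, IsCompact K →
      TendstoUniformlyOn (fun n t => riemannSum x (P n) g t) I atTop K := by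
  obtain ⟨F, -, hF⟩ := hA _ hg.2
  refine ⟨fun t => (∫ u in x 0..x t, g u) - 1 / 2 * F t, fun K hK => ?_⟩
  have h1 := hA.tendstoUniformlyOn hx hP hq hg.2 hF hK
  rw [Metric.tendstoUniformlyOn_iff] at h1 ⊢
  intro ε hε
  filter_upwards [h1 ε hε] with n hn t ht
  have h2 := abs_lt.1 (hn t ht)
  rw [riemannSum_eq_sub (P n) hg.1 (hg.2.locallyIntegrable hq), Real.dist_eq, abs_lt]
  constructor <;> linarith

theorem ConvergesWeakly.exists_isWeakLimit (hA : ConvergesWeakly x P q) (hx : Continuous x)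
    [Fact (1 ≤ p)] (hpq : p.HolderConjugate q) :
    ∃ L : ℝ≥0 → Lp ℝ p (volume : Measure ℝ), IsWeakLimit x P q fun t => L t := by
  have h : ∀ t, ∃ L : ℝ → ℝ, MemLp L p volume ∧ ∀ h : ℝ → ℝ, MemLp h q volume →
      Tendsto (fun n => ∫ u, discreteLocalTime x (P n) t u * h u) atTop (𝓝 (∫ u, L u * h u)) := by
    intro t
    obtain ⟨R, -, hR⟩ := exists_bound x hx t
    refine exists_weak_limit hpq (measurableSet_Icc (a := -R) (b := R)) (by simp)
      (fun n => measurable_discreteLocalTime x (P n) t)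
      (fun n u => discreteLocalTime_nonneg x (P n) t u)
      (exists_abs_discreteLocalTime_le x P t hx)
      (fun n u hu => discreteLocalTime_eq_zero hR (P n) le_rfl hu) fun h hh => ?_
    obtain ⟨F, -, hF⟩ := hA h hh
    exact ⟨F t, hF t⟩
  choose L hL hlim using h
  have hlim' : ∀ h : ℝ → ℝ, MemLp h q volume → ∀ t,
      Tendsto (fun n => ∫ u, discreteLocalTime x (P n) t u * h u) atTop
        (𝓝 (∫ u, MemLp.toLp (L t) (hL t) u * h u)) := fun h hh t => by
    have e : ∫ u, MemLp.toLp (L t) (hL t) u * h u = ∫ u, L t u * h u :=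
      integral_congr_ae ((hL t).coeFn_toLp.mono fun u hu => by simp only [hu])
    rw [e]
    exact hlim t h hh
  refine ⟨fun t => MemLp.toLp (L t) (hL t), hlim', fun h hh => ?_⟩
  obtain ⟨F, hFc, hF⟩ := hA h hh
  convert hFc using 2 with t
  exact tendsto_nhds_unique (hlim' h hh t) (hF t)

/-- Continuity in t is not assumed: it passes to the limit from the discrete integrals by uniform
convergence. -/
theorem isWeakLimit_of_isUniformLocalTime (hx : Continuous x) (hq : 1 ≤ q)
    {L : ℝ≥0 → Lp ℝ p (volume : Measure ℝ)} (hL : IsUniformLocalTime x P p q L) :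
    IsWeakLimit x P q fun t => L t := by
  refine ⟨fun h hh t => (hL h hh {t} isCompact_singleton).tendsto_at rfl, fun h hh => ?_⟩
  have h1 := tendstoLocallyUniformly_iff_forall_isCompact.2 (hL h hh)
  exact h1.continuous (.of_forall fun n => continuous_integral_discreteLocalTime_mul hx (P n) hq hh)

theorem IsWeakLimit.isUniformLocalTime (hx : Continuous x)
    (hP : ∀ t : ℝ≥0, Tendsto (fun n => osc x (P n) t) atTop (𝓝 0)) (hq : 1 ≤ q)
    {L : ℝ≥0 → Lp ℝ p (volume : Measure ℝ)} (hL : IsWeakLimit x P q fun t => L t) :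
    IsUniformLocalTime x P p q L := fun h hh _ hK =>
  hL.convergesWeakly.tendstoUniformlyOn hx hP hq hh (hL.tendsto h hh) hK

/-! ### Weak limits, topological convergence and occupation densities -/

theorem integral_localTimeLp_mul (x : ℝ≥0 → ℝ) (P : TimePartition) (p : ℝ≥0∞) (t : ℝ≥0)
    (h : ℝ → ℝ) :
    ∫ u, localTimeLp x P p t u * h u = ∫ u, discreteLocalTime x P t u * h u :=
  integral_congr_ae ((memLp_discreteLocalTime x P t p).coeFn_toLp.mono fun u hu => by
    simp only [localTimeLp, hu])

theorem isWeakLimit_of_isLocalTime [Fact (1 ≤ p)] (hpq : p.HolderConjugate q)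
    {L : ℝ≥0 → Lp ℝ p (volume : Measure ℝ)} (hL : IsLocalTime x P p L) :
    IsWeakLimit x P q fun t => L t := by
  refine ⟨fun h hh t => ?_, fun h hh => ?_⟩
  · have h1 := (@Continuous.tendsto _ _ (lpTopology p) _ _
      (continuous_lpTopology_integral_mul hpq hh) (L t)).comp (hL.1 t)
    exact h1.congr fun n => integral_localTimeLp_mul x (P n) p t h
  · exact @Continuous.comp _ _ _ _ (lpTopology p) _ _ _
      (continuous_lpTopology_integral_mul hpq hh) hL.2

/-- Weak limits of the discrete local times vanish outside the range of the path. -/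
theorem IsWeakLimit.ae_eq_zero (hpq : p.HolderConjugate q) {L : ℝ≥0 → ℝ → ℝ}
    (hL : IsWeakLimit x P q L) {t : ℝ≥0} (hLp : MemLp (L t) p volume) {R : ℝ}
    (hR : ∀ s ≤ t, |x s| ≤ R) : ∀ᵐ u, u ∉ Icc (-R) R → L t u = 0 := by
  have hp := ENNReal.HolderConjugate.one_le p q
  set K := Icc (-R) R with hK
  have hKm : MeasurableSet K := measurableSet_Icc
  have hint : ∀ s, MeasurableSet s → volume s < ∞ → IntegrableOn (Kᶜ.indicator (L t)) s := by
    intro s hs hμs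
    have : IsFiniteMeasure (volume.restrict s) := ⟨by simpa using hμs⟩
    exact ((hLp.indicator hKm.compl).restrict s).integrable hp
  have h1 : Kᶜ.indicator (L t) =ᵐ[volume] 0 := by
    refine ae_eq_zero_of_forall_setIntegral_eq_of_sigmaFinite hint fun s hs hμs => ?_
    have h2 := hL.tendsto ((s ∩ Kᶜ).indicator 1)
      (memLp_indicator_one (hs.inter hKm.compl)
        ((measure_mono inter_subset_left).trans_lt hμs).ne q) t
    have h3 : ∀ n, ∫ u, discreteLocalTime x (P n) t u * (s ∩ Kᶜ).indicator 1 u = 0 := fun n => by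
      refine integral_eq_zero_of_ae (.of_forall fun u => ?_)
      by_cases hu : u ∈ K
      · simp [hu]
      · simp [discreteLocalTime_eq_zero hR (P n) le_rfl hu]
    simp only [h3] at h2
    rw [← integral_indicator hs]
    refine Eq.trans ?_ (tendsto_nhds_unique h2 tendsto_const_nhds)
    congr 1
    ext u
    by_cases hu : u ∈ s <;> by_cases hu' : u ∈ K <;> simp [hu, hu']
  filter_upwards [h1] with u hu hu'
  rwa [indicator_of_mem (by simpa using hu')] at hu

/-- Needed to regard L_t du as a positive measure in the occupation density formula. -/
theorem IsWeakLimit.ae_nonneg (hpq : p.HolderConjugate q) {L : ℝ≥0 → ℝ → ℝ}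
    (hL : IsWeakLimit x P q L) {t : ℝ≥0} (hLp : MemLp (L t) p volume) :
    ∀ᵐ u, 0 ≤ L t u := by
  have hp := ENNReal.HolderConjugate.one_le p q
  refine ae_nonneg_of_forall_setIntegral_nonneg_of_sigmaFinite (fun s hs hμs => ?_)
    fun s hs hμs => ?_
  · have : IsFiniteMeasure (volume.restrict s) := ⟨by simpa using hμs⟩
    exact (hLp.restrict s).integrable hp
  · have h2 := hL.tendsto (s.indicator 1) (memLp_indicator_one hs hμs.ne q) t
    have h3 : ∫ u in s, L t u = ∫ u, L t u * s.indicator 1 u := by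
      rw [← integral_indicator hs]
      congr 1
      ext u
      by_cases hu : u ∈ s <;> simp [hu]
    rw [h3]
    exact ge_of_tendsto' h2 fun n => integral_nonneg fun u =>
      mul_nonneg (discreteLocalTime_nonneg x (P n) t u) (indicator_nonneg (fun _ _ => zero_le_one) u)

theorem IsWeakLimit.isLocalTime [Fact (1 ≤ p)] (hpq : p.HolderConjugate q) (hx : Continuous x)
    {L : ℝ≥0 → Lp ℝ p (volume : Measure ℝ)} (hL : IsWeakLimit x P q fun t => L t) :
    IsLocalTime x P p L := by
  have hzero : ∀ T R, (∀ s ≤ T, |x s| ≤ R) → ∀ t ≤ T, ∀ᵐ u, u ∉ Icc (-R) R → L t u = 0 :=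
    fun T R hR t ht => hL.ae_eq_zero hpq (Lp.memLp (L t)) fun s hs => hR s (hs.trans ht)
  refine ⟨fun t => ?_, ?_⟩
  · obtain ⟨R, -, hR⟩ := exists_bound x hx t
    refine tendsto_lpTopology hpq (measurableSet_Icc (a := -R) (b := R)) (by simp)
      (.of_forall fun n => ?_) (hzero t R hR t le_rfl) fun h hh => ?_
    · filter_upwards [(memLp_discreteLocalTime x (P n) t p).coeFn_toLp] with u hu hu'
      rw [localTimeLp, hu, discreteLocalTime_eq_zero hR (P n) le_rfl hu']
    · simp only [integral_localTimeLp_mul]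
      exact hL.tendsto h hh t
  · refine @continuous_iff_continuousAt _ _ _ (lpTopology p) _ |>.2 fun t => ?_
    -- Times near t stay below t + 1, which gives nearby L_s one common bounded support.
    obtain ⟨R, -, hR⟩ := exists_bound x hx (t + 1)
    refine tendsto_lpTopology hpq (measurableSet_Icc (a := -R) (b := R)) (by simp) ?_
      (hzero (t + 1) R hR t (lt_add_one t).le) fun h hh => (hL.continuous h hh).tendsto t
    filter_upwards [gt_mem_nhds (lt_add_one t)] with s hs
    exact hzero (t + 1) R hR s hs.le

/-- The occupation density formula. -/
theorem IsWeakLimit.setIntegral_eq (hpq : p.HolderConjugate q) (hx : Continuous x)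
    (hP : ∀ t : ℝ≥0, Tendsto (fun n => osc x (P n) t) atTop (𝓝 0)) {L : ℝ≥0 → ℝ → ℝ}
    (hL : IsWeakLimit x P q L) {t : ℝ≥0} (hLp : MemLp (L t) p volume) {μ : Measure ℝ≥0}
    (hμ : IsQuadraticVariation x P μ) {h : ℝ → ℝ} (hh : Measurable h) {C : ℝ}
    (hC : ∀ u, |h u| ≤ C) :
    Integrable (fun u => L t u * h u) volume ∧ ∫ s in Iic t, h (x s) ∂μ = ∫ u, L t u * h u := by
  have := hμ.1
  have hp := ENNReal.HolderConjugate.one_le p q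
  obtain ⟨R, -, hR⟩ := exists_bound x hx t
  have hzero := hL.ae_eq_zero hpq hLp hR
  have hnn := hL.ae_nonneg hpq hLp
  set K := Icc (-R) R with hK
  have hLi : Integrable (L t) volume := by
    have : IsFiniteMeasure (volume.restrict K) := ⟨by simp [hK]⟩
    have h1 : Integrable (K.indicator (L t)) volume :=
      (integrable_indicator_iff measurableSet_Icc).2 ((hLp.restrict K).integrable hp)
    refine h1.congr ?_
    filter_upwards [hzero] with u hu
    by_cases hu' : u ∈ K
    · rw [indicator_of_mem hu']
    · rw [indicator_of_notMem hu', hu hu']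
  refine ⟨hLi.mul_bdd hh.aestronglyMeasurable (.of_forall hC), ?_⟩
  have hμfin : μ (Iic t) < ∞ := by
    have hI : Iic t = Icc 0 t := by
      ext s
      simp
    rw [hI]
    exact isCompact_Icc.measure_lt_top
  have : IsFiniteMeasure (μ.restrict (Iic t)) := ⟨by simpa using hμfin⟩
  set m₁ : Measure ℝ := (μ.restrict (Iic t)).map x with hm₁
  set m₂ : Measure ℝ := volume.withDensity fun u => ENNReal.ofReal (L t u) with hm₂
  have hm₂fin : IsFiniteMeasure m₂ := isFiniteMeasure_withDensity_ofReal hLi.2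
  have hint₁ : ∀ φ : ℝ → ℝ, Measurable φ → ∫ u, φ u ∂m₁ = ∫ s in Iic t, φ (x s) ∂μ := fun φ hφ =>
    integral_map hx.aemeasurable hφ.aestronglyMeasurable
  have hint₂ : ∀ φ : ℝ → ℝ, ∫ u, φ u ∂m₂ = ∫ u, L t u * φ u := fun φ => by
    rw [hm₂, integral_withDensity_eq_integral_toReal_smul₀ hLi.1.aemeasurable.ennreal_ofReal
      (.of_forall fun u => ENNReal.ofReal_lt_top)]
    refine integral_congr_ae ?_
    filter_upwards [hnn] with u hu
    rw [ENNReal.toReal_ofReal hu, smul_eq_mul]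
  -- The image of μ on [0,t] under x and the measure L_t du are finite, so agreement on bounded
  -- continuous φ, both integrals being limits of ∫ L^{π_n}_t φ, gives equality and hence the
  -- formula for bounded Borel h.
  have hm : m₁ = m₂ := by
    refine ext_of_forall_integral_eq_of_IsFiniteMeasure fun φ => ?_
    rw [hint₁ _ φ.continuous.measurable, hint₂]
    refine tendsto_nhds_unique
      (tendsto_integral_discreteLocalTime_mul hx hP hμ φ.continuous t) ?_
    -- φ itself need not be in L^q; cutting it off outside K changes no integral.
    have hφK : MemLp (K.indicator φ) q volume :=
      memLp_of_bounded_of_support measurableSet_Icc (by simp)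
        (φ.continuous.measurable.indicator measurableSet_Icc).aestronglyMeasurable (C := ‖φ‖)
        (fun u => by
          by_cases hu : u ∈ K
          · rw [indicator_of_mem hu]
            exact φ.norm_coe_le_norm u
          · rw [indicator_of_notMem hu, abs_zero]
            exact norm_nonneg _) (fun u hu => indicator_of_notMem hu _) q
    have h1 := hL.tendsto _ hφK t
    have h2 : ∫ u, L t u * K.indicator φ u = ∫ u, L t u * φ u := by
      refine integral_congr_ae ?_
      filter_upwards [hzero] with u hu
      by_cases hu' : u ∈ K
      · rw [indicator_of_mem hu']
      · rw [hu hu', zero_mul, zero_mul]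
    rw [h2] at h1
    refine h1.congr fun n => ?_
    congr 1
    ext u
    by_cases hu' : u ∈ K
    · rw [indicator_of_mem hu']
    · rw [discreteLocalTime_eq_zero hR (P n) le_rfl hu', zero_mul, zero_mul]
  rw [← hint₁ h hh, hm, hint₂]

end PathwiseLocalTime

end

/-! ### The equivalences and their consequences -/

open PathwiseLocalTime in
theorem theorem3p1 (x : ℝ≥0 → ℝ) (hx : Continuous x) (P : ℕ → TimePartition)
    (hP : ∀ t : ℝ≥0, Tendsto (fun n => osc x (P n) t) atTop (𝓝 0))
    (p q : ℝ≥0∞) [Fact (1 ≤ p)] (hpq : p.HolderConjugate q) :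
    List.TFAE [
      ∀ g : ℝ → ℝ, MemW1 q g → ∃ I : ℝ≥0 → ℝ, IsFollmerIntegral x P g I,
      ∀ g : ℝ → ℝ, MemW1 q g → ∃ I : ℝ≥0 → ℝ, ∀ K : Set ℝ≥0, IsCompact K →
        TendstoUniformlyOn (fun n t => riemannSum x (P n) g t) I atTop K,
      ∃ L : ℝ≥0 → Lp ℝ p (volume : Measure ℝ), IsLocalTime x P p L,
      ∃ L : ℝ≥0 → Lp ℝ p (volume : Measure ℝ), IsUniformLocalTime x P p q L,
      HasQuadraticVariation x P ∧ ∀ M : ℝ≥0, ∃ t : ℝ≥0, M ≤ t ∧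
        if p = 1 then EquiIntegrable (fun n => discreteLocalTime x (P n) t)
        else BoundedInLp p (fun n => discreteLocalTime x (P n) t)] ∧
    ∀ L : ℝ≥0 → Lp ℝ p (volume : Measure ℝ),
      (IsLocalTime x P p L ∨ IsUniformLocalTime x P p q L) →
      (∀ t : ℝ≥0, BoundedInLp p (fun n => discreteLocalTime x (P n) t)) ∧
      (∀ f : ℝ → ℝ, MemW2 q f → ∃ I : ℝ≥0 → ℝ, IsFollmerIntegral x P (deriv f) I ∧
        ∀ t : ℝ≥0, f (x t) - f (x 0) = I t + 1 / 2 * ∫ u, L t u * deriv (deriv f) u) ∧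
      ∃ μ : Measure ℝ≥0, IsQuadraticVariation x P μ ∧
        ∀ h : ℝ → ℝ, Measurable h → (∃ C : ℝ, ∀ u, |h u| ≤ C) → ∀ t : ℝ≥0,
          Integrable (fun u => L t u * h u) (volume : Measure ℝ) ∧
          ∫ s in Set.Iic t, h (x s) ∂μ = ∫ u, L t u * h u := by
  have hq : 1 ≤ q := ENNReal.HolderConjugate.one_le q p
  refine ⟨?_, fun L hL => ?_⟩
  · tfae_have 1 → 5 := fun H => by
      have hA := convergesWeakly_of_isFollmerIntegral hx hq H
      refine ⟨⟨hP, hA.exists_isQuadraticVariation hx hP⟩, fun M => ⟨M, le_rfl, ?_⟩⟩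
      split_ifs with hp
      · subst hp
        obtain rfl : q = ∞ := (ENNReal.HolderConjugate.eq_top_iff_eq_one q 1).2 rfl
        exact hA.equiIntegrable hx M
      · exact hA.boundedInLp hx hpq M
    tfae_have 5 → 4 := fun ⟨⟨_, μ, hμ⟩, hb⟩ => by
      obtain ⟨L, hL⟩ := (convergesWeakly_of_isQuadraticVariation hx hP hpq hμ hb).exists_isWeakLimit
        hx hpq
      exact ⟨L, hL.isUniformLocalTime hx hP hq⟩
    tfae_have 4 → 3 := fun ⟨L, hL⟩ =>
      ⟨L, (isWeakLimit_of_isUniformLocalTime hx hq hL).isLocalTime hpq hx⟩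
    tfae_have 3 → 2 := fun ⟨_, hL⟩ _ hg =>
      (isWeakLimit_of_isLocalTime hpq hL).convergesWeakly.exists_tendstoUniformlyOn_riemannSum
        hx hP hq hg
    tfae_have 2 → 1 := fun H g hg => by
      obtain ⟨I, hI⟩ := H g hg
      exact ⟨I, (tendstoLocallyUniformly_iff_forall_isCompact.2 hI).continuous
        (.of_forall fun n => continuous_riemannSum hx (P n) g),
        fun t => (hI {t} isCompact_singleton).tendsto_at rfl⟩
    tfae_finish
  · have hW : IsWeakLimit x P q fun t => L t :=
      hL.elim (isWeakLimit_of_isLocalTime hpq) (isWeakLimit_of_isUniformLocalTime hx hq)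
    have hA := hW.convergesWeakly
    obtain ⟨μ, hμ⟩ := hA.exists_isQuadraticVariation hx hP
    refine ⟨fun t => hA.boundedInLp hx hpq t, fun f hf => ?_, μ, hμ, fun h hh ⟨C, hC⟩ t =>
      hW.setIntegral_eq hpq hx hP (Lp.memLp (L t)) hμ hh hC⟩
    -- The limiting Itô formula for g = f' already contains the local time term; only ∫_{x_0}^{x_t}
    -- f' = f(x_t) - f(x_0) remains.
    refine ⟨_, isFollmerIntegral_of_tendsto hx hq hf.2 (hW.continuous _ hf.2.2)
      (hW.tendsto _ hf.2.2), fun t => ?_⟩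
    rw [intervalIntegral.integral_deriv_eq_sub
      (fun u _ => hf.1.differentiable one_ne_zero u) (intervalIntegrable_of_ac hf.2.1 _ _)]
    ring
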